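/- Let $n\ge 1$. In $\mathbb{R}^{n+1}$ write $x=(x_1,\dots,x_{n+1})$, $B_r(x)$ for the open Euclidean ball, $B_r=B_r(0)$, and identify $\mathbb{R}^n$ with the hyperplane $\{x_1=0\}$; $\pi_P$ is the Euclidean-orthogonal projection onto a plane $P$, and $|\cdot|$ is the operator norm on linear maps. For a $C^1$ Riemannian metric $g$ on an open set $U\subset\mathbb{R}^{n+1}$, let $\mathcal{H}^n_g$ be the ($n$-dimensional, normalized) Hausdorff measure and $\nabla^g$ the Levi-Civita connection of $g$. An $n$-rectifiable varifold $V$ in $(U,g)$ is a positive Radon measure on the Grassmannian bundle $U\times \mathrm{Gr}_n(n+1)$ of the form $V(\varphi)=\int_{M_V}\varphi(x,T_xM_V)\,\theta_{V,g}(x)\,d\mathcal{H}^n_g(x)$, where $M_V\subset U$ is a countably $n$-rectifiable $\mathcal{H}^n_g$-measurable set, $T_xM_V$ its (a.e. defined) approximate tangent plane and $\theta_{V,g}\ge 0$ is $\mathcal{H}^n_g\llcorner M_V$-measurable. Its mass measure is $\mu_V=\theta_{V,g}\,\mathcal{H}^n_g\llcorner M_V$, one writes $\pi_V(x)=\pi_{T_xM_V}$,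 and its density ratios are $\Theta_V(x,r)=\mu_V(B_r(x))/(\omega_n r^n)$, with $\omega_n$ the volume of the unit ball of $\mathbb{R}^n$. Its $g$-first variation is $$\delta_gV(X)=\int \sum_{i=1}^n g(e_i,\nabla^g_{e_i}X)\,d\mu_V,\qquad X\in C^1_c(U,\mathbb{R}^{n+1}),$$ with $(e_i)$ a $g$-orthonormal basis of $T_xM_V$. It is locally finite if for every open $W\subset\subset U$ there is a constant $C(W)$ with $|\delta_gV(X)|\le C(W)\sup|X|$ for all $X\in C^1_c(W,\mathbb{R}^{n+1})$. In that case $\delta_gV(X)=-\int g(H_{V,g},X)\,d\mu_V+\int g(\eta_{V,g},X)\,d\sigma_{V,g}$ with the generalized mean curvature $H_{V,g}\in L^1_{loc}(\mu_V)$, a Radon measure $\sigma_{V,g}$ on $U$ singular to $\mu_V$ (the generalized boundary measure), and a $\sigma_{V,g}$-measurable $g$-unit vector field $\eta_{V,g}$. **Theorem (Boundary rigidity).** For every $n\ge1$ and every $\alpha\in(0,1)$ there are constants $0<\eta<\gamma<1$, depending only on $n$ and $\alpha$, such that the following holds. Let $g$ be a $C^1$ metric on $B_1\subset\mathbb{R}^{n+1}$,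 and let $V$ be an $n$-rectifiable varifold in $(B_1\cap\{x_1<0\},g)$ with locally finite $g$-first variation and $\sigma_{V,g}=0$. Suppose that 1. $\theta_{V,g}(x)\ge 1$ for $\mu_V$-a.e. $x$; 2. $\Theta_V(x,r)\le 1-\alpha$ for all $x\in\mathbb{R}^n\cap B_{1/2}$ and all $r\in(0,1/2)$; 3. $\int_{B_1}|\pi_V-\pi_{\mathbb{R}^n}|^2\,d\mu_V\le\eta$; 4. $\max\{\|H_{V,g}\|_{L^\infty(B_1)},\ |g-g_{eucl}|_{C^1(B_1)}\}\le\eta$, where $\|\cdot\|_{L^\infty(B_1)}$ is taken with respect to $\mu_V$ and the Euclidean norm, and $|g-g_{eucl}|_{C^1(B_1)}=\sup_{B_1}|g-g_{eucl}|+\sup_{B_1}|Dg|$. Then $V\llcorner B_\gamma=0$. -/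

import Mathlib

open MeasureTheory Metric Set Filter TopologicalSpace
open scoped Topology ENNReal NNReal Manifold

set_option maxSynthPendingDepth 3

noncomputable section

namespace BoundaryRigidity

/-- The ambient Euclidean space `ℝ^{n+1}`; the first coordinate `x₁` is `x 0`. -/
abbrev Space (n : ℕ) : Type := EuclideanSpace ℝ (Fin (n + 1))

variable {n : ℕ}

/-- The open unit ball `B₁`. -/
def unitBall (n : ℕ) : Opens (Space n) := ⟨ball 0 1, isOpen_ball⟩

/-- The open half ball `B₁ ∩ {x₁ < 0}`. -/
def halfBall (n : ℕ) : Opens (Space n) :=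
  ⟨ball 0 1 ∩ {x | x 0 < 0},
    isOpen_ball.inter (isOpen_lt (EuclideanSpace.proj (𝕜 := ℝ) (0 : Fin (n + 1))).continuous
      continuous_const)⟩

theorem halfBall_le (n : ℕ) : halfBall n ≤ unitBall n := fun _ hx => hx.1

/-! ### Riemannian metrics of class `C¹` -/

/-- A `C¹` Riemannian metric on an open set `U ⊆ ℝ^{n+1}`. The values of `toFun` off `U` are
irrelevant. -/
structure C1Metric (U : Opens (Space n)) where
  toFun : Space n → Space n →L[ℝ] Space n →L[ℝ] ℝ
  contDiffOn : ContDiffOn ℝ 1 toFun U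
  symm : ∀ x ∈ U, ∀ v w, toFun x v w = toFun x w v
  pos : ∀ x ∈ U, ∀ v, v ≠ 0 → 0 < toFun x v v

namespace C1Metric

variable {U : Opens (Space n)}

/-- The restriction of a metric to a smaller open set. -/
def restrict (g : C1Metric U) {W : Opens (Space n)} (h : W ≤ U) : C1Metric W where
  toFun := g.toFun
  contDiffOn := g.contDiffOn.mono h
  symm x hx := g.symm x (h hx)
  pos x hx := g.pos x (h hx)

/-- The Euclidean metric, as a bilinear form. -/
def euclideanForm (n : ℕ) : Space n →L[ℝ] Space n →L[ℝ] ℝ := innerSL ℝ (E := Space n)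

/-- The norm `|g - g_eucl|_{C¹(U)} = sup_U |g - g_eucl| + sup_U |Dg|`, with values in `[0, ∞]`
(operator norms of multilinear forms). -/
def c1DistEuclidean (g : C1Metric U) : ℝ≥0∞ :=
  (⨆ x ∈ U, ‖g.toFun x - euclideanForm n‖ₑ) + ⨆ x ∈ U, ‖fderiv ℝ g.toFun x‖ₑ

theorem isVonNBounded (B : Space n →L[ℝ] Space n →L[ℝ] ℝ) (hpos : ∀ v, v ≠ 0 → 0 < B v v) :
    Bornology.IsVonNBounded ℝ {v : Space n | B v v < 1} := by
  have hcont : Continuous fun v : Space n => B v v := by fun_prop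
  obtain ⟨v₀, hv₀, hmin⟩ := (isCompact_sphere (0 : Space n) 1).exists_isMinOn
    (NormedSpace.sphere_nonempty.2 zero_le_one) hcont.continuousOn
  have hv₀' : v₀ ≠ 0 := by
    rintro rfl
    simp at hv₀
  have hc := hpos v₀ hv₀'
  set c := B v₀ v₀ with hcdef
  have key : ∀ v : Space n, c * ‖v‖ ^ 2 ≤ B v v := by
    intro v
    rcases eq_or_ne v 0 with rfl | hv
    · simp
    · have hn : ‖v‖ ≠ 0 := norm_ne_zero_iff.2 hv
      have h1 : ‖v‖⁻¹ • v ∈ sphere (0 : Space n) 1 := by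
        simp [norm_smul, hn]
      have h2 : c ≤ B (‖v‖⁻¹ • v) (‖v‖⁻¹ • v) := hmin h1
      simp only [map_smul, FunLike.coe_smul, Pi.smul_apply, smul_eq_mul] at h2
      have h3 : 0 < ‖v‖ := lt_of_le_of_ne (norm_nonneg v) hn.symm
      calc c * ‖v‖ ^ 2 ≤ (‖v‖⁻¹ * (‖v‖⁻¹ * B v v)) * ‖v‖ ^ 2 := by gcongr
        _ = B v v := by field_simp
  refine (NormedSpace.isVonNBounded_closedBall ℝ (Space n) (c⁻¹ + 1)).subset ?_
  intro v hv
  have hv' : B v v < 1 := hv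
  have h4 := key v
  rw [mem_closedBall_zero_iff]
  by_contra! hcon
  have h5 : 0 < c⁻¹ := inv_pos.2 hc
  have h6 : c * c⁻¹ = 1 := mul_inv_cancel₀ hc.ne'
  have h7 : ‖v‖ ≤ ‖v‖ ^ 2 := by nlinarith
  nlinarith

theorem trivializationAt_symm_eq (x y : U) (v : Space n) :
    (trivializationAt (Space n) (TangentSpace 𝓘(ℝ, Space n)) x).symm y v = v := by
  have h := TangentBundle.symmL_trivializationAt_eq_core (𝕜 := ℝ) (I := 𝓘(ℝ, Space n))
    (b₀ := x) (b := y) (mem_chart_source (Space n) y)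
  have h2 := (tangentBundleCore 𝓘(ℝ, Space n) U).coordChange_self (achart (Space n) y) y
    (mem_chart_source (Space n) y) v
  exact ((Bundle.Trivialization.symmL_apply (R := ℝ)
      (trivializationAt (Space n) (TangentSpace 𝓘(ℝ, Space n)) x) (mem_chart_source (Space n) y) v).symm.trans
    (congrArg (fun L : Space n →L[ℝ] Space n => L v) h)).trans h2

/-- The Riemannian metric `g` on the manifold `U`. -/
def toRiemannian (g : C1Metric U) :
    Bundle.ContinuousRiemannianMetric (Space n)
      (fun x : U => TangentSpace 𝓘(ℝ, Space n) x) where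
  inner x := g.toFun x.1
  symm x v w := g.symm x.1 x.2 v w
  pos x v hv := g.pos x.1 x.2 v hv
  isVonNBounded x := isVonNBounded (g.toFun x.1) (g.pos x.1 x.2)
  continuous := by
    rw [continuous_iff_continuousAt]
    intro x
    rw [FiberBundle.continuousAt_totalSpace]
    refine ⟨continuousAt_id, ?_⟩
    have h0 : Continuous fun y : U => g.toFun y.1 :=
      g.contDiffOn.continuousOn.comp_continuous continuous_subtype_val fun y => y.2
    convert! h0.continuousAt (x := x) using 1
    ext y v w
    rw [hom_trivializationAt_apply]
    let φ : TangentSpace 𝓘(ℝ, Space n) y →L[ℝ] TangentSpace 𝓘(ℝ, Space n) y →L[ℝ]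
        Bundle.Trivial U ℝ y := g.toFun y.1
    have h₃x : ∀ y : U, y ∈ (trivializationAt ℝ (Bundle.Trivial U ℝ) x).baseSet := fun _ =>
      Set.mem_univ _
    have h1 := inCoordinates_apply_eq₂ (x₀ := x) (x := y) (ϕ := φ) (v := v) (w := w)
      (mem_chart_source (Space n) y) (mem_chart_source (Space n) y)
      (h₃x y)
    refine h1.trans ?_
    rw [trivializationAt_symm_eq x y v, trivializationAt_symm_eq x y w]
    simp
    rfl

/-- `U` with the Riemannian distance of `g`, the infimum of the `g`-lengths of `C¹` paths in `U`.
Its topology is the usual one. -/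
@[reducible] def emetricSpace (g : C1Metric U) : EMetricSpace U :=
  letI : Bundle.RiemannianBundle (fun x : U => TangentSpace 𝓘(ℝ, Space n) x) :=
    ⟨g.toRiemannian.toRiemannianMetric⟩
  EMetricSpace.ofRiemannianMetric 𝓘(ℝ, Space n) U

/-- The `n`-dimensional Hausdorff measure `𝓗ⁿ_g` of `(U, g)`, as a measure on `ℝ^{n+1}` that is
concentrated on `U`; it is normalised so as to agree with Lebesgue measure on Euclidean `ℝⁿ`. -/
def hausdorff (g : C1Metric U) : Measure (Space n) :=
  letI : EMetricSpace U := g.emetricSpace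
  Measure.map (Subtype.val : U → Space n) (Measure.euclideanHausdorffMeasure n)

/-- The covector `z ↦ g(Γ(v, w), z) = ½ (∂_v g(w, z) + ∂_w g(v, z) - ∂_z g(v, w))` at `x`
(Koszul's formula for constant vector fields `v`, `w`, `z`). -/
def koszul (g : C1Metric U) (x v w : Space n) : Space n →L[ℝ] ℝ :=
  (1 / 2 : ℝ) • (fderiv ℝ g.toFun x v w + fderiv ℝ g.toFun x w v
    - ((fderiv ℝ g.toFun x).flip v).flip w)

/-- The Christoffel term `Γ(v, w)` at `x`, obtained from `koszul` by raising the index. -/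
def christoffel (g : C1Metric U) (x v w : Space n) : Space n :=
  (g.toFun x).inverse (g.koszul x v w)

theorem koszul_apply (g : C1Metric U) (x v w z : Space n) :
    g.koszul x v w z = 1 / 2 * (fderiv ℝ g.toFun x v w z + fderiv ℝ g.toFun x w v z
      - fderiv ℝ g.toFun x z v w) := by
  simp [koszul]

theorem apply_christoffel (g : C1Metric U) {x : Space n} (hx : x ∈ U) (v w z : Space n) :
    g.toFun x (g.christoffel x v w) z = g.koszul x v w z := by
  have hinj : Function.Injective (g.toFun x) := by
    rw [injective_iff_map_eq_zero]
    intro a ha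
    by_contra hne
    have := g.pos x hx a hne
    simp [ha] at this
  have hdim : Module.finrank ℝ (Space n) = Module.finrank ℝ (Space n →L[ℝ] ℝ) :=
    ((InnerProductSpace.toDual ℝ (Space n)).toLinearEquiv).finrank_eq
  let e : Space n ≃L[ℝ] (Space n →L[ℝ] ℝ) :=
    (LinearEquiv.ofInjectiveOfFinrankEq (g.toFun x).toLinearMap hinj hdim).toContinuousLinearEquiv
  have he : (e : Space n →L[ℝ] (Space n →L[ℝ] ℝ)) = g.toFun x := by
    ext a b
    rfl
  have h1 : (g.toFun x).inverse = (e.symm : (Space n →L[ℝ] ℝ) →L[ℝ] Space n) := by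
    rw [← he, ContinuousLinearMap.inverse_equiv]
  have h2 : g.toFun x (e.symm (g.koszul x v w)) = g.koszul x v w := e.apply_symm_apply _
  rw [christoffel, h1]
  exact congrArg (fun L : Space n →L[ℝ] ℝ => L z) h2

/-- The Levi-Civita covariant derivative `∇^g_v X = DX(v) + Γ(v, X)` at `x`. -/
def covDeriv (g : C1Metric U) (X : Space n → Space n) (x v : Space n) : Space n :=
  fderiv ℝ X x v + g.christoffel x v (X x)

end C1Metric

/-! ### The Grassmannian -/

/-- The Grassmannian `Gr_n(n+1)` of `n`-planes in `ℝ^{n+1}`. -/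
def Gr (n : ℕ) : Type := {S : Submodule ℝ (Space n) // Module.finrank ℝ S = n}

/-- The Euclidean-orthogonal projection `π_S`. -/
def Gr.proj (S : Gr n) : Space n →L[ℝ] Space n := S.1.starProjection

instance : TopologicalSpace (Gr n) := TopologicalSpace.induced Gr.proj inferInstance

instance : MeasurableSpace (Gr n) := borel (Gr n)

instance : BorelSpace (Gr n) := ⟨rfl⟩

/-- The orthogonal projection onto the hyperplane `{x₁ = 0}`, identified with `ℝⁿ`. -/
def wallProj (n : ℕ) : Space n →L[ℝ] Space n :=
  (LinearMap.ker (EuclideanSpace.proj (𝕜 := ℝ) (0 : Fin (n + 1)) :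
    Space n →L[ℝ] ℝ).toLinearMap).starProjection

/-! ### Rectifiable varifolds -/

/-- `M` is contained, up to an `𝓗ⁿ`-null set, in a countable union of Lipschitz images of `ℝⁿ`. -/
def IsCountablyRectifiable (M : Set (Space n)) : Prop :=
  ∃ f : ℕ → EuclideanSpace ℝ (Fin n) → Space n,
    (∀ i, ∃ K : ℝ≥0, LipschitzWith K (f i)) ∧
      Measure.hausdorffMeasure (n : ℝ) (M \ ⋃ i, range (f i)) = 0

/-- `P` is the approximate tangent plane at `x` of the weighted set underlying `μ`: the blow-ups
of `μ` at `x` converge, as Radon measures, to a positive multiple of `𝓗ⁿ ⌞ P`. -/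
def IsApproxTangentPlane (μ : Measure (Space n)) (x : Space n) (P : Gr n) : Prop :=
  ∃ c : ℝ, 0 < c ∧ ∀ f : Space n → ℝ, Continuous f → HasCompactSupport f →
    Tendsto (fun r : ℝ => (r ^ n)⁻¹ * ∫ y, f (r⁻¹ • (y - x)) ∂μ) (𝓝[>] 0)
      (𝓝 (c * ∫ y : P.1, f y))

/-- The measure `θ 𝓗ⁿ_g ⌞ M`. -/
def weightedMeasure {U : Opens (Space n)} (g : C1Metric U) (M : Set (Space n))
    (θ : Space n → ℝ≥0) : Measure (Space n) :=
  (g.hausdorff.restrict M).withDensity fun x => (θ x : ℝ≥0∞)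

/-- An `n`-rectifiable varifold in `(U, g)`, given by its rectifiable set `M_V`, its multiplicity
`θ_{V,g}` and the a.e. defined tangent field `x ↦ T_x M_V`. The Radon measure on the Grassmannian
bundle that these determine is `RectifiableVarifold.toMeasure`. -/
structure RectifiableVarifold {U : Opens (Space n)} (g : C1Metric U) where
  carrier : Set (Space n)
  carrier_subset : carrier ⊆ U
  nullMeasurableSet : NullMeasurableSet carrier g.hausdorff
  rectifiable : IsCountablyRectifiable carrier
  mult : Space n → ℝ≥0
  aemeasurable_mult : AEMeasurable mult (g.hausdorff.restrict carrier)
  locallyFinite : ∀ K : Set (Space n), IsCompact K → K ⊆ U →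
    weightedMeasure g carrier mult K < ⊤
  tangent : Space n → Gr n
  aemeasurable_tangent : AEMeasurable tangent (weightedMeasure g carrier mult)
  isApproxTangentPlane : ∀ᵐ x ∂weightedMeasure g carrier mult,
    IsApproxTangentPlane (weightedMeasure g carrier mult) x (tangent x)

namespace RectifiableVarifold

variable {U : Opens (Space n)} {g : C1Metric U}

/-- The mass measure `μ_V = θ_{V,g} 𝓗ⁿ_g ⌞ M_V`. -/
def mass (V : RectifiableVarifold g) : Measure (Space n) := weightedMeasure g V.carrier V.mult

/-- The varifold as a measure on the Grassmannian bundle: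
`V(φ) = ∫_{M_V} φ(x, T_x M_V) θ_{V,g}(x) d𝓗ⁿ_g(x)`. -/
def toMeasure (V : RectifiableVarifold g) : Measure (Space n × Gr n) :=
  V.mass.map fun x => (x, V.tangent x)

/-- The Euclidean density ratio `Θ_V(x, r) = μ_V(B_r(x)) / (ω_n rⁿ)`, for `r > 0`. -/
def densityRatio (V : RectifiableVarifold g) (x : Space n) (r : ℝ) : ℝ≥0∞ :=
  V.mass (ball x r) /
    (volume (ball (0 : EuclideanSpace ℝ (Fin n)) 1) * ENNReal.ofReal (r ^ n))

/-- The tilt-excess `∫_{B_r(x)} |π_V - π_{ℝⁿ}|² dμ_V` with respect to `{x₁ = 0}`. -/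
def tiltExcess (V : RectifiableVarifold g) (x : Space n) (r : ℝ) : ℝ≥0∞ :=
  ∫⁻ y in ball x r, ‖(V.tangent y).proj - wallProj n‖ₑ ^ 2 ∂V.mass

end RectifiableVarifold

/-! ### First variation -/

/-- `e` is a `g`-orthonormal basis of the plane `S` at the point `x`. -/
def IsOrthonormalBasisAt {U : Opens (Space n)} (g : C1Metric U) (x : Space n) (S : Gr n)
    (e : Fin n → Space n) : Prop :=
  (∀ i, e i ∈ S.1) ∧ ∀ i j, g.toFun x (e i) (e j) = if i = j then 1 else 0

/-- The tangential divergence `div_{S,g} X = ∑ᵢ g(eᵢ, ∇^g_{eᵢ} X)` at `x`, where `e` is a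
`g`-orthonormal basis of `S` (the sum does not depend on which one). -/
def tangentialDiv {U : Opens (Space n)} (g : C1Metric U) (X : Space n → Space n)
    (x : Space n) (S : Gr n) : ℝ :=
  let e : Fin n → Space n := Classical.epsilon (IsOrthonormalBasisAt g x S)
  ∑ i, g.toFun x (e i) (g.covDeriv X x (e i))

/-- `X` is a `C¹` vector field with compact support in the open set `W`. -/
def IsTestField (W : Set (Space n)) (X : Space n → Space n) : Prop :=
  ContDiff ℝ 1 X ∧ HasCompactSupport X ∧ tsupport X ⊆ W

namespace RectifiableVarifold

variable {U : Opens (Space n)} {g : C1Metric U}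

/-- The `g`-first variation `δ_g V(X) = ∫ div_{V,g}(X) dμ_V`. -/
def firstVariation (V : RectifiableVarifold g) (X : Space n → Space n) : ℝ :=
  ∫ x, tangentialDiv g X x (V.tangent x) ∂V.mass

/-- `V` has locally finite `g`-first variation in `U`. -/
def HasLocallyFiniteFirstVariation (V : RectifiableVarifold g) : Prop :=
  ∀ W : Opens (Space n), IsCompact (closure (W : Set (Space n))) →
    closure (W : Set (Space n)) ⊆ U →
    ∃ C : ℝ, ∀ X : Space n → Space n, IsTestField W X →
      ∀ b : ℝ, (∀ x, ‖X x‖ ≤ b) → |V.firstVariation X| ≤ C * b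

/-- `H`, `σ` and `ν` are the generalized `g`-mean curvature, the generalized `g`-boundary measure
and the `g`-conormal of `V`: they are the Lebesgue decomposition with respect to `μ_V`
`δ_g V(X) = - ∫ g(H, X) dμ_V + ∫ g(ν, X) dσ` of the first variation. -/
structure IsFirstVariationDecomposition (V : RectifiableVarifold g)
    (H : Space n → Space n) (σ : Measure (Space n)) (ν : Space n → Space n) : Prop where
  locallyIntegrable : LocallyIntegrableOn H U V.mass
  locallyFinite : ∀ K : Set (Space n), IsCompact K → K ⊆ U → σ K < ⊤
  compl_eq_zero : σ (U : Set (Space n))ᶜ = 0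
  mutuallySingular : σ ⟂ₘ V.mass
  aestronglyMeasurable : AEStronglyMeasurable ν σ
  unit : ∀ᵐ x ∂σ, g.toFun x (ν x) (ν x) = 1
  firstVariation_eq : ∀ X : Space n → Space n, IsTestField (U : Set (Space n)) X →
    V.firstVariation X =
      -(∫ x, g.toFun x (H x) (X x) ∂V.mass) + ∫ x, g.toFun x (ν x) (X x) ∂σ

end RectifiableVarifold

end BoundaryRigidity

end

/-!
# Boundary rigidity

Write `u = -x₀` for the depth below the wall `{x₀ = 0}` and `μ` for the mass of `V`.

*Density.* At `μ`-almost every point the blow-ups of `μ` converge to `c 𝓗ⁿ ⌞ P` with `P` the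
approximate tangent plane. Since the multiplicity is at least one and `g` is close to the Euclidean
metric, `c` is at least `√(1 - η) ^ n` (`RectifiableVarifold.ae_exists_hasBlowUp`). This needs no
structure theory of rectifiable sets: the density theorem for Hausdorff measures provides
arbitrarily small sets `C` with `μ C` at least almost `√(1 - η) ^ n κ (diam C)ⁿ`, where `κ`
normalises the Hausdorff measure, and the isodiametric bound `volume E ≤ κ (diam E)ⁿ` in `P`
(`volume_le_hausdorffFactor_mul_ediam_pow`) converts this into a bound for `c`.

*Mean value inequality.* Let `z` be such a point, `d = u z`, and let `ψ ≥ 0` be a function of the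
height `u / d` that vanishes near the wall. For a minimal hypersurface and a convex `ψ` the
function `f = ψ (u / d)` is subharmonic, so that `f z` is at most its mean over balls centred at
`z`. In the present setting, the first variation is tested with
`f κ(q) (x - z) + Φ(q) ψ' (u / d) ξ`, where `q` is the squared distance from `z` for the constant
metric `g z`, `κ` a regularised and truncated version of `|x - z| ^ (-n)`, `Φ` its primitive, and
`ξ` the gradient of the height. The second term cancels the contribution of `df`. The errors
caused by `g` and by the mean curvature are of relative size `η`. Near `z` they are absorbed by a
lower order correction of the kernel, since there `ψ'` and `ψ''` are bounded by `ψ`; at distance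
comparable to `d` they are bounded trivially. Failure of convexity costs only the tilt-excess,
because `Φ ψ''` is multiplied by the square of the tangential gradient of the height. When the
regularisation tends to zero, the blow-up at `z` contributes the volume of the unit ball
(`Gr.integral_bubble`), and the result is `IsAlmostMinimal.mean_value`.

*Conclusion.* If `f ≤ S` on a ball around `z` of radius `R` large compared with `d`, the mean of
`f` is at most about `(1 - α) S`, by the density bound at the foot of `z` on the wall; hence
`(1 - α) S ≥ 1` up to small errors (`exists_forall_not_ae_le`). A bump function for `ψ` and `R` of
order one show that no point of positive density near the origin has depth at least `δ`, once `η`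
is small in terms of `δ`. The convex cubic profile and `R = K d` need no smallness of `η` relative
to `d`, and show that no point `z` of positive density satisfies `u ≤ (1 + τ) u z` on the ball of
radius `2 K u z`. But if there were a point `x₀` of positive density near the origin, an almost
maximal point of `u - l |x - x₀|` would be such a `z` (`exists_almost_maximal`).
-/

/-! ### The Riemannian distance of a nearly Euclidean metric -/

namespace BoundaryRigidity
open Bundle

variable {n : ℕ}

theorem mfderiv_opens_apply {U : Opens (Space n)} {γ : ℝ → U} {t : ℝ}
    (h : MDifferentiableAt 𝓘(ℝ, ℝ) 𝓘(ℝ, Space n) γ t) (s : ℝ) :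
    (mfderiv 𝓘(ℝ, ℝ) 𝓘(ℝ, Space n) γ t s : Space n) = fderiv ℝ (fun t => (γ t : Space n)) t s := by
  have h1 := h.mfderiv
  have h2 : fderivWithin ℝ (writtenInExtChartAt 𝓘(ℝ, ℝ) 𝓘(ℝ, Space n) t γ)
      (range 𝓘(ℝ, ℝ)) (extChartAt 𝓘(ℝ, ℝ) t t) = fderiv ℝ (fun t => (γ t : Space n)) t := by
    simp only [mfld_simps, fderivWithin_univ]
    rfl
  exact congrArg (fun L : ℝ →L[ℝ] Space n => L s) (h1.trans h2)

theorem contDiff_coe_opens {U : Opens (Space n)} {γ : ℝ → U}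
    (h : ContMDiff 𝓘(ℝ, ℝ) 𝓘(ℝ, Space n) 1 γ) : ContDiff ℝ 1 (fun t => (γ t : Space n)) := by
  rw [← contMDiff_iff_contDiff]
  exact contMDiff_subtype_val.comp h

namespace C1Metric
variable {U : Opens (Space n)}

/-- A metric that dominates `c ^ 2` times the Euclidean one has a Riemannian distance of at least
  `c`
times the Euclidean distance, because it has longer paths. -/
theorem mul_enorm_sub_le_edist (g : C1Metric U) {c : ℝ} (hc : 0 ≤ c)
    (hg : ∀ x ∈ U, ∀ v, (c * ‖v‖) ^ 2 ≤ g.toFun x v v) (x y : U) :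
    ENNReal.ofReal c * edist (x : Space n) y ≤ g.emetricSpace.edist x y := by
  let : Bundle.RiemannianBundle (fun x : U => TangentSpace 𝓘(ℝ, Space n) x) :=
    ⟨g.toRiemannian.toRiemannianMetric⟩
  change _ ≤ Manifold.riemannianEDist 𝓘(ℝ, Space n) x y
  refine le_of_forall_gt fun r hr => ?_
  obtain ⟨γ, h0, h1, hγ, hlen, -, -⟩ :=
    Manifold.exists_lt_locally_constant_of_riemannianEDist_lt hr zero_lt_one
  refine lt_of_le_of_lt ?_ hlen
  rw [Manifold.pathELength_eq_lintegral_mfderiv_Icc]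
  have hcd := contDiff_coe_opens hγ
  have key : ∀ t, ENNReal.ofReal c * ‖deriv (fun t => (γ t : Space n)) t‖ₑ ≤
      ‖mfderiv 𝓘(ℝ, ℝ) 𝓘(ℝ, Space n) γ t (1 : ℝ)‖ₑ := by
    intro t
    have h2 : (mfderiv 𝓘(ℝ, ℝ) 𝓘(ℝ, Space n) γ t (1 : ℝ) : Space n) =
        deriv (fun t => (γ t : Space n)) t := by
      rw [mfderiv_opens_apply ((hγ.mdifferentiable one_ne_zero) t)]
      rfl
    have h3 : ‖mfderiv 𝓘(ℝ, ℝ) 𝓘(ℝ, Space n) γ t (1 : ℝ)‖ =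
        √(g.toFun (γ t) (deriv (fun t => (γ t : Space n)) t)
          (deriv (fun t => (γ t : Space n)) t)) := by
      rw [norm_eq_sqrt_real_inner, ← h2]
      rfl
    rw [← ofReal_norm, ← ofReal_norm, ← ENNReal.ofReal_mul hc, h3]
    exact ENNReal.ofReal_le_ofReal (Real.le_sqrt_of_sq_le (hg _ (γ t).2 _))
  calc ENNReal.ofReal c * edist (x : Space n) y
      ≤ ENNReal.ofReal c * ∫⁻ t in Icc (0 : ℝ) 1, ‖deriv (fun t => (γ t : Space n)) t‖ₑ := by
        gcongr
        rw [edist_comm, edist_eq_enorm_sub, ← h0, ← h1]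
        refine (enorm_sub_le_lintegral_derivWithin_Icc_of_contDiffOn_Icc
          (f := fun t => (γ t : Space n)) hcd.contDiffOn zero_le_one).trans_eq ?_
        rw [← restrict_Ioo_eq_restrict_Icc]
        refine setLIntegral_congr_fun measurableSet_Ioo fun t ht => ?_
        rw [derivWithin_of_mem_nhds (Icc_mem_nhds ht.1 ht.2)]
    _ = ∫⁻ t in Icc (0 : ℝ) 1, ENNReal.ofReal c * ‖deriv (fun t => (γ t : Space n)) t‖ₑ := by
        rw [lintegral_const_mul' _ _ ENNReal.ofReal_ne_top]
    _ ≤ _ := lintegral_mono fun t => key t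

end C1Metric
end BoundaryRigidity

/-! ### Hausdorff measures: comparison, density and an isodiametric bound -/

namespace BoundaryRigidity

variable {n : ℕ}

/-- The ratio of the normalised `n`-dimensional Hausdorff measure to the unnormalised one. -/
noncomputable def hausdorffFactor (n : ℕ) : ℝ≥0 :=
  Measure.addHaarScalarFactor (volume : Measure (EuclideanSpace ℝ (Fin n))) μH[n]

theorem hausdorffFactor_ne_zero (n : ℕ) : hausdorffFactor n ≠ 0 :=
  Measure.addHaarScalarFactor_volume_hausdorffMeasure_ne_zero n

theorem euclideanHausdorffMeasure_apply {X : Type*} [EMetricSpace X] [MeasurableSpace X]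
    [BorelSpace X] (s : Set X) :
    (Measure.euclideanHausdorffMeasure n : Measure X) s = hausdorffFactor n * μH[n] s := by
  rw [Measure.euclideanHausdorffMeasure_def]
  rfl

/-- Comparison of the Hausdorff measure of `g` with the Euclidean one, as the inclusion of `U` with
the distance of `g` is Lipschitz with constant `c⁻¹`. -/
theorem C1Metric.mul_hausdorffMeasure_le {U : Opens (Space n)} (g : C1Metric U) {c : ℝ}
    (hc : 0 < c) (hg : ∀ x ∈ U, ∀ v, (c * ‖v‖) ^ 2 ≤ g.toFun x v v) {A : Set (Space n)}
    (hA : A ⊆ U) :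
    ENNReal.ofReal (c ^ n) * hausdorffFactor n * μH[n] A ≤ g.hausdorff A := by
  let : EMetricSpace U := g.emetricSpace
  have hc' : ENNReal.ofReal c ≠ 0 := by simpa using hc
  have hK : ((c⁻¹.toNNReal : ℝ≥0) : ℝ≥0∞) = (ENNReal.ofReal c)⁻¹ :=
    ENNReal.ofReal_inv_of_pos hc
  have hlip : @LipschitzWith U (Space n) g.emetricSpace.toPseudoEMetricSpace _ (c⁻¹).toNNReal
      Subtype.val := by
    intro x y
    rw [hK]
    exact (ENNReal.mul_le_iff_le_inv hc' ENNReal.ofReal_ne_top).1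
      (g.mul_enorm_sub_le_edist hc.le hg x y)
  have h1 := @LipschitzWith.hausdorffMeasure_image_le U (Space n) g.emetricSpace _ _ _ _ _ _ _
    hlip n (by positivity) (Subtype.val ⁻¹' A)
  have himg : (Subtype.val : U → Space n) '' (Subtype.val ⁻¹' A) = A := by
    ext x
    simp only [mem_image, mem_preimage, Subtype.exists, exists_and_right, exists_eq_right]
    exact ⟨fun h => h.2, fun h => ⟨hA h, h⟩⟩
  rw [himg, hK] at h1
  have h2 : (@Measure.euclideanHausdorffMeasure U g.emetricSpace _ _ n) (Subtype.val ⁻¹' A) ≤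
    g.hausdorff A := Measure.le_map_apply (by fun_prop) A
  refine le_trans ?_ h2
  rw [euclideanHausdorffMeasure_apply, mul_comm (ENNReal.ofReal _), mul_assoc]
  gcongr
  rw [ENNReal.ofReal_pow hc.le]
  refine (mul_le_mul_right h1 _).trans_eq ?_
  rw [← mul_assoc, ENNReal.rpow_natCast, ← ENNReal.inv_pow, ENNReal.mul_inv_cancel, one_mul]
  · exact pow_ne_zero _ hc'
  · exact ENNReal.pow_ne_top ENNReal.ofReal_ne_top

/-- Upper density: if `μ` dominates `k` times the Hausdorff measure, then almost every point lies in
arbitrarily small sets `C` with `μ C` more than `t * ediam C ^ d`, for `t < k`. Otherwise the points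
where this fails would have Hausdorff measure at least `t⁻¹` times their `μ`-measure. The sets `C`
are arbitrary, not balls; for balls the constant would be worse by a power of two. -/
theorem measure_setOf_density_le_eq_zero {X : Type*} [EMetricSpace X] [MeasurableSpace X]
    [BorelSpace X] (μ : Measure X) (S : Set X) (hS : μ S ≠ ⊤) {k t : ℝ≥0∞} {d : ℝ}
    (hk : ∀ A ⊆ S, k * μH[d] A ≤ μ A) (htk : t < k) (ht : t ≠ 0) :
    μ {x ∈ S | ∃ δ > 0, ∀ C : Set X, x ∈ C → ediam C ≤ δ → μ C ≤ t * ediam C ^ d} = 0 := by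
  have key : ∀ δ : ℝ≥0∞, 0 < δ →
      μ {x ∈ S | ∀ C : Set X, x ∈ C → ediam C ≤ δ → μ C ≤ t * ediam C ^ d} = 0 := by
    intro δ hδ
    set N := {x ∈ S | ∀ C : Set X, x ∈ C → ediam C ≤ δ → μ C ≤ t * ediam C ^ d}
    have hle : t⁻¹ • μ.restrict N ≤ μH[d] := by
      refine Measure.le_hausdorffMeasure d _ δ hδ fun s hs => ?_
      have h0 : μ.restrict N s ≤ t * ediam s ^ d := by
        calc μ.restrict N s ≤ μ.restrict N (closure s) := measure_mono subset_closure
          _ = μ (closure s ∩ N) := Measure.restrict_apply isClosed_closure.measurableSet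
          _ ≤ t * ediam s ^ d := by
            rcases (closure s ∩ N).eq_empty_or_nonempty with h | ⟨x, hx, hxN⟩
            · simp [h]
            · have := hxN.2 (closure s) hx (by rwa [ediam_closure])
              rw [ediam_closure] at this
              exact (measure_mono inter_subset_left).trans this
      calc t⁻¹ * μ.restrict N s ≤ t⁻¹ * (t * ediam s ^ d) := by gcongr
        _ = ediam s ^ d := by
          rw [← mul_assoc, ENNReal.inv_mul_cancel ht htk.ne_top, one_mul]
    have h1 : t⁻¹ * μ N ≤ μH[d] N := by
      have := hle N
      simpa using this
    have hNS : N ⊆ S := fun x hx => hx.1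
    have h2 : k * (t⁻¹ * μ N) ≤ μ N := (by gcongr : _ ≤ k * μH[d] N).trans (hk N hNS)
    by_contra h0
    have hfin : μ N ≠ ⊤ := ne_top_of_le_ne_top hS (measure_mono hNS)
    have h3 : 1 < k * t⁻¹ := by
      rw [← ENNReal.mul_inv_cancel ht htk.ne_top]
      exact (ENNReal.mul_lt_mul_iff_left (by simpa using htk.ne_top) (by simpa using ht)).2 htk
    rw [← mul_assoc] at h2
    have h4 : 1 * μ N < k * t⁻¹ * μ N := (ENNReal.mul_lt_mul_iff_left h0 hfin).2 h3
    rw [one_mul] at h4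
    exact absurd h2 (not_le.2 h4)
  have hsub : {x ∈ S | ∃ δ > 0, ∀ C : Set X, x ∈ C → ediam C ≤ δ → μ C ≤ t * ediam C ^ d} ⊆
      ⋃ j : ℕ, {x ∈ S | ∀ C : Set X, x ∈ C → ediam C ≤ ((j : ℝ≥0∞) + 1)⁻¹ →
        μ C ≤ t * ediam C ^ d} := by
    rintro x ⟨hx, δ, hδ, h⟩
    obtain ⟨j, hj⟩ := ENNReal.exists_inv_nat_lt hδ.ne'
    refine mem_iUnion.2 ⟨j, hx, fun C hC hd => h C hC (hd.trans (le_trans ?_ hj.le))⟩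
    exact ENNReal.inv_le_inv.2 le_self_add
  refine measure_mono_null hsub (measure_iUnion_null fun j => key _ ?_)
  simp

open scoped Pointwise in
/-- Isodiametric inequality with the constant implicit in the normalisation of the Hausdorff
measure: small homothetic copies of `E` fill up a ball, hence are competitors in the definition of
the Hausdorff measure of that ball. -/
theorem volume_le_hausdorffFactor_mul_ediam_pow {V : Type*} [NormedAddCommGroup V]
    [InnerProductSpace ℝ V] [FiniteDimensional ℝ V] [MeasurableSpace V] [BorelSpace V]
    (hn : Module.finrank ℝ V = n) {E : Set V} (hE : IsOpen E) (hb : Bornology.IsBounded E) :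
    volume E ≤ hausdorffFactor n * ediam E ^ n := by
  rcases E.eq_empty_or_nonempty with rfl | hne
  · simp
  -- the closure of `E` is used since the covering theorem needs closed sets
  set D := closure E with hD
  have hDvol : volume D ≠ 0 :=
    (lt_of_lt_of_le (hE.measure_pos volume hne) (measure_mono subset_closure)).ne'
  have hDb : Bornology.IsBounded D := hb.closure
  have hDvol' : volume D ≠ ⊤ := hDb.measure_lt_top.ne
  obtain ⟨R, hR0, hR⟩ := hDb.subset_closedBall_lt 0 0
  have hvolH : ∀ s : Set V, volume s = hausdorffFactor n * μH[n] s := fun s => by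
    rw [← euclideanHausdorffMeasure_apply, ← hn,
      InnerProductSpace.euclideanHausdorffMeasure_eq_volume]
  set O : Set V := ball 0 1
  have hOvol : volume O ≠ 0 := (measure_ball_pos volume _ one_pos).ne'
  have hOvol' : volume O ≠ ⊤ := measure_ball_lt_top.ne
  let B : V × ℝ → Set V := fun a => a.1 +ᵥ a.2 • D
  have hBvol : ∀ a : V × ℝ, 0 < a.2 → volume (B a) = ENNReal.ofReal (a.2 ^ n) * volume D := by
    intro a ha
    simp only [B]
    rw [measure_vadd, Measure.addHaar_smul, hn, abs_of_pos (by positivity)]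
  have hBball : ∀ a : V × ℝ, 0 < a.2 → B a ⊆ closedBall a.1 (a.2 * R) := by
    rintro a ha _ ⟨_, ⟨y, hy, rfl⟩, rfl⟩
    have := hR hy
    simp only [mem_closedBall_zero_iff] at this
    simp only [vadd_eq_add, mem_closedBall, dist_self_add_left, norm_smul, Real.norm_eq_abs,
      abs_of_pos ha]
    gcongr
  -- disjoint small homothetic copies of `D` fill the unit ball up to a null set
  have hcover : ∀ ε : ℝ, 0 < ε → ∃ u : Set (V × ℝ), u.Countable ∧
      (∀ a ∈ u, 0 < a.2 ∧ a.2 * R ≤ ε ∧ B a ⊆ O) ∧ u.PairwiseDisjoint B ∧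
      volume (O \ ⋃ a ∈ u, B a) = 0 := by
    intro ε hε
    let T : Set (V × ℝ) := {a | 0 < a.2 ∧ a.2 * R ≤ ε ∧ closedBall a.1 (a.2 * R) ⊆ O}
    have hV1 : ∀ a ∈ T, volume (closedBall a.1 (3 * (a.2 * R))) ≤
      (volume (closedBall (0 : V) (3 * R)) / volume D).toNNReal * volume (B a) := by
      intro a ha
      rw [hBvol a ha.1, show 3 * (a.2 * R) = a.2 * (3 * R) by ring,
        Measure.addHaar_closedBall_mul _ _ ha.1.le (by positivity), hn,
        ENNReal.coe_toNNReal (ENNReal.div_ne_top measure_closedBall_lt_top.ne hDvol),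
        mul_left_comm, ENNReal.div_mul_cancel hDvol hDvol']
    have hV2 : ∀ a ∈ T, (interior (B a)).Nonempty := by
      intro a ha
      simp only [B]
      rw [interior_vadd, interior_smul₀ ha.1.ne']
      exact (((hne.mono (hE.subset_interior_iff.2 subset_closure)).smul_set).vadd_set)
    have hV3 : ∀ a ∈ T, IsClosed (B a) := by
      intro a ha
      exact (isClosed_closure.smul_of_ne_zero ha.1.ne').vadd _
    have hV4 : ∀ x ∈ O, ∀ δ > (0 : ℝ), ∃ a ∈ T, a.2 * R ≤ δ ∧ a.1 = x := by
      intro x hx δ hδ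
      obtain ⟨ρ, hρ, hρO⟩ := Metric.nhds_basis_closedBall.mem_iff.1 (isOpen_ball.mem_nhds hx)
      have hm : 0 < min (min ε δ) ρ := by positivity
      refine ⟨(x, min (min ε δ) ρ / R), ⟨by positivity, ?_, ?_⟩, ?_, rfl⟩
      · simp only [div_mul_cancel₀ _ hR0.ne']
        exact (min_le_left _ _).trans (min_le_left _ _)
      · simp only [div_mul_cancel₀ _ hR0.ne']
        exact (closedBall_subset_closedBall (min_le_right _ _)).trans hρO
      · simp only [div_mul_cancel₀ _ hR0.ne']
        exact (min_le_left _ _).trans (min_le_right _ _)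
    obtain ⟨u, hu, huc, hud, huv⟩ := Vitali.exists_disjoint_covering_ae (volume : Measure V) O T
      _ (fun a => a.2 * R) Prod.fst B (fun a ha => hBball a ha.1) hV1 hV2 hV3 hV4
    exact ⟨u, huc, fun a ha => ⟨(hu ha).1, (hu ha).2.1,
      (hBball a (hu ha).1).trans (hu ha).2.2⟩, hud, huv⟩
  choose u huc hu hud huv using fun j : ℕ => hcover (1 / ((j : ℝ) + 1)) (by positivity)
  set O' : Set V := O ∩ ⋂ j, ⋃ a ∈ u j, B a with hO'
  have hOO' : volume O ≤ volume O' := by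
    have h1 : O ⊆ O' ∪ ⋃ j, (O \ ⋃ a ∈ u j, B a) := by
      intro x hx
      by_cases h : ∀ j, x ∈ ⋃ a ∈ u j, B a
      · exact Or.inl ⟨hx, mem_iInter.2 h⟩
      · push Not at h
        obtain ⟨j, hj⟩ := h
        exact Or.inr (mem_iUnion.2 ⟨j, hx, hj⟩)
    refine (measure_mono h1).trans ((measure_union_le _ _).trans ?_)
    rw [measure_iUnion_null huv, add_zero]
  have hdiam : ∀ a : V × ℝ, 0 < a.2 → ediam (B a) = ENNReal.ofReal a.2 * ediam E := by
    intro a ha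
    simp only [B]
    rw [ediam_vadd, ediam_smul₀, hD, ediam_closure, ENNReal.smul_def, smul_eq_mul,
      ← Real.enorm_of_nonneg ha.le]
    rfl
  have hsum : ∀ j, ∑' a : u j, ediam (B a) ^ (n : ℝ) ≤ ediam E ^ n / volume D * volume O := by
    intro j
    have hcount : Countable (u j) := (huc j).to_subtype
    have hmeas : ∀ a ∈ u j, MeasurableSet (B a) := fun a ha =>
      ((isClosed_closure.smul_of_ne_zero (hu j a ha).1.ne').vadd _).measurableSet
    calc ∑' a : u j, ediam (B a) ^ (n : ℝ)
        = ∑' a : u j, ediam E ^ n / volume D * volume (B a) := by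
          refine tsum_congr fun a => ?_
          have ha := (hu j a a.2).1
          rw [hBvol a ha, hdiam a ha, ENNReal.rpow_natCast, mul_pow, ENNReal.ofReal_pow ha.le,
            mul_left_comm, ENNReal.div_mul_cancel hDvol hDvol']
      _ = ediam E ^ n / volume D * ∑' a : u j, volume (B a) := ENNReal.tsum_mul_left
      _ ≤ ediam E ^ n / volume D * volume O := by
          gcongr
          rw [← measure_biUnion (huc j) (hud j) hmeas]
          exact measure_mono (iUnion₂_subset fun a ha => (hu j a ha).2.2)
  -- these copies are competitors for the Hausdorff measure of the part of the ball that they cover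
  have hH : μH[n] O' ≤ ediam E ^ n / volume D * volume O := by
    have hcount : ∀ j, Countable (u j) := fun j => (huc j).to_subtype
    refine (Measure.hausdorffMeasure_le_liminf_tsum (ι := fun j => u j) (n : ℝ) O' (l := atTop)
      (fun j : ℕ => ENNReal.ofReal (2 * (1 / ((j : ℝ) + 1)))) ?_ (fun j a => B a) ?_ ?_).trans ?_
    · rw [← ENNReal.ofReal_zero]
      refine ENNReal.tendsto_ofReal ?_
      simpa using (tendsto_one_div_add_atTop_nhds_zero_nat (𝕜 := ℝ)).const_mul 2
    · refine Eventually.of_forall fun j a => ?_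
      have ha := hu j a a.2
      refine ediam_le_of_forall_dist_le fun x hx y hy => ?_
      have h1 := hBball a ha.1 hx
      have h2 := hBball a ha.1 hy
      rw [mem_closedBall] at h1 h2
      linarith [dist_triangle_right x y a.1.1, ha.2.1]
    · refine Eventually.of_forall fun j x hx => ?_
      have := mem_iInter.1 hx.2 j
      simpa only [iUnion_coe_set] using this
    · exact (liminf_le_liminf (Eventually.of_forall hsum)).trans_eq (by simp)
  have h3 : volume O ≤ hausdorffFactor n * (ediam E ^ n / volume D) * volume O := by
    rw [mul_assoc]
    refine hOO'.trans ?_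
    rw [hvolH]
    gcongr
  have h4 : 1 ≤ hausdorffFactor n * (ediam E ^ n / volume D) := by
    by_contra! h
    have := (ENNReal.mul_lt_mul_iff_left hOvol hOvol').2 h
    rw [one_mul] at this
    exact absurd h3 (not_le.2 this)
  rw [← mul_div_assoc, ENNReal.le_div_iff_mul_le (Or.inl hDvol) (Or.inl hDvol'), one_mul] at h4
  exact (measure_mono subset_closure).trans h4

end BoundaryRigidity

/-! ### Blow-ups with large density -/

namespace BoundaryRigidity

variable {n : ℕ}

/-- The blow-ups of `μ` at `x` converge to `c 𝓗ⁿ ⌞ P`. -/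
def HasBlowUp (μ : Measure (Space n)) (x : Space n) (P : Gr n) (c : ℝ) : Prop :=
  ∀ f : Space n → ℝ, Continuous f → HasCompactSupport f →
    Tendsto (fun r : ℝ => (r ^ n)⁻¹ * ∫ y, f (r⁻¹ • (y - x)) ∂μ) (𝓝[>] 0)
      (𝓝 (c * ∫ y : P.1, f y))

theorem thickening_ediam_le {X : Type*} [PseudoMetricSpace X] {F : Set X} {ρ b : ℝ}
    (hF : ∀ p ∈ F, ∀ q ∈ F, dist p q ≤ b) : ediam (thickening ρ F) ≤
        ENNReal.ofReal (b + 2 * ρ) := by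
  refine ediam_le_of_forall_dist_le fun x hx y hy => ?_
  obtain ⟨p, hp, hxp⟩ := mem_thickening_iff.1 hx
  obtain ⟨q, hq, hyq⟩ := mem_thickening_iff.1 hy
  have h1 := dist_triangle4 x p q y
  have h2 := hF p hp q hq
  rw [dist_comm q y] at h1
  linarith

/-- The isodiametric bound for the part in `P` of a neighbourhood of a set of diameter at most `b`. -/
theorem Gr.volume_preimage_thickening_le (P : Gr n) {F : Set (Space n)} {ρ b : ℝ}
    (hFb : Bornology.IsBounded F)
    (hF : ∀ p ∈ F, ∀ q ∈ F, dist p q ≤ b) (hb : 0 ≤ b + 2 * ρ) :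
    (volume ((Subtype.val : P.1 → Space n) ⁻¹' thickening ρ F)).toReal ≤
      hausdorffFactor n * (b + 2 * ρ) ^ n := by
  have h1 := volume_le_hausdorffFactor_mul_ediam_pow (V := P.1) P.2
    (E := (Subtype.val : P.1 → Space n) ⁻¹' thickening ρ F)
    (isOpen_thickening.preimage continuous_subtype_val)
    (by
      obtain ⟨R, hR⟩ := (hFb.thickening (δ := ρ)).subset_closedBall 0
      refine (isBounded_closedBall (x := (0 : P.1)) (r := R)).subset fun y hy => ?_
      have := hR hy
      simpa using this)
  have h2 : ediam ((Subtype.val : P.1 → Space n) ⁻¹' thickening ρ F) ≤ ENNReal.ofReal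
      (b + 2 * ρ) := by
    have h3 : ediam ((Subtype.val : P.1 → Space n) ''
        ((Subtype.val : P.1 → Space n) ⁻¹' thickening ρ F))
        = _ := (isometry_subtype_coe (s := (P.1 : Set (Space n)))).ediam_image _
    refine h3.symm.trans_le ((ediam_mono (image_preimage_subset _ _)).trans
        (thickening_ediam_le hF))
  refine ENNReal.toReal_le_of_le_ofReal (by positivity) (h1.trans ?_)
  rw [ENNReal.ofReal_mul (by positivity), ENNReal.ofReal_coe_nnreal, ENNReal.ofReal_pow hb]
  gcongr

/-- Small sets of large density at `x` bound the constant of the blow-up from below: rescaled to unit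
diameter they are covered by finite unions of balls, of which there are only finitely many up to
`ε`, so that the convergence of the blow-ups is uniform on them. -/
theorem HasBlowUp.le_of_frequently_small_sets {μ : Measure (Space n)} {x : Space n} {P : Gr n}
    {c τ ρ₀ : ℝ} (h : HasBlowUp μ x P c) (hc : 0 ≤ c) (hτ : 0 < τ) (hρ₀ : 0 < ρ₀)
    (hn : n ≠ 0)
    (hfin : μ (ball x ρ₀) ≠ ⊤)
    (hsets : ∀ δ : ℝ≥0∞, 0 < δ → ∃ C : Set (Space n), x ∈ C ∧ ediam C ≤ δ ∧
      ENNReal.ofReal τ * hausdorffFactor n * ediam C ^ n < μ C) : τ ≤ c := by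
  set κ : ℝ := ((hausdorffFactor n : ℝ≥0) : ℝ) with hκ
  have hκ0 : 0 < κ := by
    have := hausdorffFactor_ne_zero n
    exact_mod_cast pos_iff_ne_zero.2 this
  have main : ∀ ε : ℝ, 0 < ε → τ * κ ≤ c * (κ * (1 + 6 * ε) ^ n) + ε := by
    intro ε hε
    obtain ⟨N, -, hNfin, hN⟩ := (isCompact_closedBall (0 : Space n) 1).finite_cover_balls hε
    -- test functions adapted to finite unions of balls
    let T : Set (Space n) → Set (Space n) := fun F => thickening ε F
    let φ : Set (Space n) → Space n → ℝ := fun F y => (thickenedIndicator hε (T F) y : ℝ)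
    have hφc : ∀ F, Continuous (φ F) := fun F =>
      NNReal.continuous_coe.comp (thickenedIndicator hε (T F)).continuous
    have hφ1 : ∀ F y, y ∈ T F → φ F y = 1 := fun F y hy => by
      simp only [φ]
      rw [thickenedIndicator_one hε _ hy]
      rfl
    have hφ0 : ∀ F y, y ∉ thickening (2 * ε) F → φ F y = 0 := fun F y hy => by
      simp only [φ]
      rw [thickenedIndicator_zero hε]
      · rfl
      · intro h
        apply hy
        have := thickening_thickening_subset ε ε F h
        rwa [two_mul]
    have hφle : ∀ F y, φ F y ≤ 1 := fun F y => by
      have := thickenedIndicator_le_one hε (T F) y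
      exact_mod_cast this
    have hφnn : ∀ F y, 0 ≤ φ F y := fun F y => NNReal.coe_nonneg _
    have hφs : ∀ F ⊆ N, HasCompactSupport (φ F) := fun F hF => by
      have hb : Bornology.IsBounded (thickening (2 * ε) F) :=
          ((hNfin.subset hF).isBounded).thickening
      refine HasCompactSupport.of_support_subset_isCompact hb.isCompact_closure fun y hy => ?_
      by_contra hcon
      exact hy (hφ0 F y fun h => hcon (subset_closure h))
    have hlim : ∀ F ⊆ N, (∀ p ∈ F, ∀ q ∈ F, dist p q ≤ 1 + 2 * ε) →
        ∀ᶠ r : ℝ in 𝓝[>] 0, (r ^ n)⁻¹ * ∫ y, φ F (r⁻¹ • (y - x)) ∂μ <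
            c * (κ * (1 + 6 * ε) ^ n) + ε := by
      intro F hF hd
      have hint : ∫ y : P.1, φ F y ≤ κ * (1 + 6 * ε) ^ n := by
        have h1 := P.volume_preimage_thickening_le (ρ := 2 * ε) (b := 1 + 2 * ε)
          ((hNfin.subset hF).isBounded) hd (by positivity)
        have hmeas : MeasurableSet ((Subtype.val : P.1 → Space n) ⁻¹' thickening (2 * ε) F) :=
          (isOpen_thickening.preimage continuous_subtype_val).measurableSet
        have hbd : Bornology.IsBounded ((Subtype.val : P.1 →
            Space n) ⁻¹' thickening (2 * ε) F) := by
          obtain ⟨R, hR⟩ := (((hNfin.subset hF).isBounded).thickening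
              (δ := 2 * ε)).subset_closedBall 0
          refine (isBounded_closedBall (x := (0 : P.1)) (r := R)).subset fun y hy => ?_
          have := hR hy
          simpa using this
        calc ∫ y : P.1, φ F y
            ≤ ∫ y : P.1, ((Subtype.val : P.1 →
                Space n) ⁻¹' thickening (2 * ε) F).indicator 1 y := by
              refine integral_mono_of_nonneg (Eventually.of_forall fun y => hφnn F y) ?_
                (Eventually.of_forall fun y => ?_)
              · exact (integrable_indicator_iff hmeas).2
                  (integrableOn_const hbd.measure_lt_top.ne)
              · by_cases hy : (y : Space n) ∈ thickening (2 * ε) F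
                · simpa [indicator, hy] using hφle F y
                · simp [indicator, hy, hφ0 F y hy]
          _ = (volume ((Subtype.val : P.1 → Space n) ⁻¹' thickening (2 * ε) F)).toReal := by
              rw [integral_indicator_one hmeas]
              rfl
          _ ≤ _ := h1.trans_eq (by ring)
      refine (h (φ F) (hφc F) (hφs F hF)).eventually_lt_const ?_
      have : c * ∫ y : P.1, φ F y ≤ c * (κ * (1 + 6 * ε) ^ n) := by gcongr
      linarith
    have hall : ∀ᶠ r : ℝ in 𝓝[>] 0, ∀ F ∈ {F : Set (Space n) | F ⊆ N},
        (∀ p ∈ F, ∀ q ∈ F, dist p q ≤ 1 + 2 * ε) →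
        (r ^ n)⁻¹ * ∫ y, φ F (r⁻¹ • (y - x)) ∂μ < c * (κ * (1 + 6 * ε) ^ n) + ε := by
      rw [Filter.eventually_all_finite hNfin.finite_subsets]
      intro F hF
      by_cases hd : ∀ p ∈ F, ∀ q ∈ F, dist p q ≤ 1 + 2 * ε
      · filter_upwards [hlim F hF hd] with r hr _ using hr
      · exact Eventually.of_forall fun r h => absurd h hd
    obtain ⟨r₀, hr₀, hr₀'⟩ := (mem_nhdsGT_iff_exists_Ioo_subset).1 hall
    have hr₀pos : (0 : ℝ) < r₀ := hr₀
    obtain ⟨R, hR0, hR⟩ := ((hNfin.isBounded).thickening (δ := 2 * ε)).subset_closedBall_lt 0 0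
    set r₁ := min (r₀ / 2) (ρ₀ / (2 * R)) with hr₁
    have hr₁pos : 0 < r₁ := by positivity
    obtain ⟨C, hxC, hCd, hCμ⟩ := hsets (ENNReal.ofReal r₁) (by simpa using hr₁pos)
    have hCfin : ediam C ≠ ⊤ := ne_top_of_le_ne_top ENNReal.ofReal_ne_top hCd
    -- a positive radius at least the diameter of `C`, in order to allow `C` to be a point
    obtain ⟨r, hr0, hr1, hCr, hμr⟩ : ∃ r : ℝ, 0 < r ∧ r ≤ r₁ ∧ ediam C ≤ ENNReal.ofReal r ∧
        ENNReal.ofReal (τ * κ * r ^ n) ≤ μ C := by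
      rcases eq_or_ne (ediam C) 0 with h0 | h0
      · rw [h0, zero_pow hn, mul_zero] at hCμ
        have hcont : Tendsto (fun r : ℝ => ENNReal.ofReal (τ * κ * r ^ n)) (𝓝[>] 0) (𝓝 0) := by
          have : Continuous fun r : ℝ => ENNReal.ofReal (τ * κ * r ^ n) :=
            ENNReal.continuous_ofReal.comp (by fun_prop)
          have h2 := this.tendsto 0
          simp only [ne_eq, hn, not_false_eq_true, zero_pow, mul_zero, ENNReal.ofReal_zero] at h2
          exact h2.mono_left nhdsWithin_le_nhds
        obtain ⟨r, h3, h4⟩ := ((hcont.eventually_lt_const hCμ).and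
          (Ioo_mem_nhdsGT hr₁pos)).exists
        exact ⟨r, h4.1, h4.2.le, by simp [h0], h3.le⟩
      · refine ⟨(ediam C).toReal, ENNReal.toReal_pos h0 hCfin,
          ENNReal.toReal_le_of_le_ofReal hr₁pos.le hCd, by rw [ENNReal.ofReal_toReal hCfin], ?_⟩
        rw [ENNReal.ofReal_mul (by positivity), ENNReal.ofReal_mul (by positivity),
          ENNReal.ofReal_pow (by positivity), ENNReal.ofReal_toReal hCfin, hκ,
          ENNReal.ofReal_coe_nnreal]
        exact hCμ.le
    have hdistC : ∀ y ∈ C, ∀ z ∈ C, dist y z ≤ r := fun y hy z hz => by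
      have := (edist_le_ediam_of_mem hy hz).trans hCr
      rwa [edist_le_ofReal hr0.le] at this
    -- the centres of the balls that meet the rescaled set
    set F : Set (Space n) := {p ∈ N | ∃ y ∈ C, dist (r⁻¹ • (y - x)) p < ε}
    have hscale : ∀ y z : Space n, dist (r⁻¹ • (y - x)) (r⁻¹ • (z - x)) = r⁻¹ * dist y z :=
      fun y z => by
        rw [dist_smul₀, dist_sub_right, Real.norm_eq_abs, abs_of_pos (inv_pos.2 hr0)]
    have hFd : ∀ p ∈ F, ∀ q ∈ F, dist p q ≤ 1 + 2 * ε := by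
      rintro p ⟨-, y, hy, hyp⟩ q ⟨-, z, hz, hzq⟩
      have h1 := dist_triangle4 p (r⁻¹ • (y - x)) (r⁻¹ • (z - x)) q
      have h2 : r⁻¹ * dist y z ≤ 1 := by
        rw [inv_mul_le_iff₀ hr0, mul_one]
        exact hdistC y hy z hz
      rw [hscale, dist_comm p (r⁻¹ • (y - x))] at h1
      linarith
    have hCF : ∀ y ∈ C, r⁻¹ • (y - x) ∈ T F := by
      intro y hy
      have h1 : r⁻¹ • (y - x) ∈ closedBall (0 : Space n) 1 := by
        have := hscale y x
        rw [sub_self, smul_zero] at this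
        rw [mem_closedBall, this, inv_mul_le_iff₀ hr0, mul_one]
        exact hdistC y hy x hxC
      obtain ⟨p, hp, hyp⟩ := mem_iUnion₂.1 (hN h1)
      exact mem_thickening_iff.2 ⟨p, ⟨hp, y, hy, hyp⟩, hyp⟩
    have hfinal := hr₀' (show r ∈ Ioo 0 r₀ from ⟨hr0, by
      have := min_le_left (r₀ / 2) (ρ₀ / (2 * R)); linarith⟩) F (fun p hp => hp.1) hFd
    have hsupp : ∀ y, y ∉ ball x ρ₀ → φ F (r⁻¹ • (y - x)) = 0 := by
      intro y hy
      refine hφ0 F _ fun hmem => hy ?_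
      have h1 := hR (thickening_subset_of_subset (2 * ε) (fun p hp => hp.1 : F ⊆ N) hmem)
      rw [mem_closedBall_zero_iff, norm_smul, Real.norm_eq_abs, abs_of_pos (inv_pos.2 hr0),
        inv_mul_le_iff₀ hr0] at h1
      rw [mem_ball, dist_eq_norm]
      have h2 : r * R ≤ ρ₀ / 2 := by
        calc r * R ≤ ρ₀ / (2 * R) * R := by
              gcongr
              exact hr1.trans (min_le_right _ _)
          _ = ρ₀ / 2 := by field_simp
      linarith
    have hcts : Continuous fun y : Space n => φ F (r⁻¹ • (y - x)) :=
      (hφc F).comp (by fun_prop)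
    have hint : Integrable (fun y => φ F (r⁻¹ • (y - x))) μ := by
      have : IntegrableOn (fun y => φ F (r⁻¹ • (y - x))) (ball x ρ₀) μ :=
        Measure.integrableOn_of_bounded (M := 1) hfin hcts.aestronglyMeasurable
          (Eventually.of_forall fun y => by
            rw [Real.norm_eq_abs, abs_of_nonneg (hφnn _ _)]; exact hφle _ _)
      exact (integrableOn_iff_integrable_of_support_subset (fun y hy => by
        by_contra hcon; exact hy (hsupp y hcon))).1 this
    have hlow : τ * κ * r ^ n ≤ ∫ y, φ F (r⁻¹ • (y - x)) ∂μ := by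
      rw [← ENNReal.ofReal_le_ofReal_iff (integral_nonneg fun y => hφnn _ _),
        ofReal_integral_eq_lintegral_ofReal hint (Eventually.of_forall fun y => hφnn _ _)]
      set A : Set (Space n) := (fun y => r⁻¹ • (y - x)) ⁻¹' T F with hA
      have hAm : MeasurableSet A := by
        refine (isOpen_thickening.preimage ?_).measurableSet
        fun_prop
      calc ENNReal.ofReal (τ * κ * r ^ n) ≤ μ A := hμr.trans (measure_mono fun y hy => hCF y hy)
        _ = ∫⁻ y, A.indicator 1 y ∂μ := (lintegral_indicator_one hAm).symm
        _ ≤ _ := by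
          refine lintegral_mono fun y => ?_
          by_cases hy : y ∈ A
          · simp [indicator, hy, hφ1 F _ hy]
          · simp [indicator, hy]
    have h5 : τ * κ ≤ (r ^ n)⁻¹ * ∫ y, φ F (r⁻¹ • (y - x)) ∂μ := by
      rw [le_inv_mul_iff₀ (by positivity)]
      linarith
    linarith
  have hlim : Tendsto (fun ε : ℝ => c * (κ * (1 + 6 * ε) ^ n) + ε) (𝓝[>] 0) (𝓝 (c * κ)) := by
    have : Continuous fun ε : ℝ => c * (κ * (1 + 6 * ε) ^ n) + ε := by fun_prop
    have h2 := this.tendsto 0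
    simp only [mul_zero, add_zero, one_pow, mul_one] at h2
    exact h2.mono_left nhdsWithin_le_nhds
  have := ge_of_tendsto hlim (eventually_nhdsWithin_of_forall fun ε hε => main ε hε)
  exact le_of_mul_le_mul_right this hκ0

end BoundaryRigidity

/-! ### Density of rectifiable varifolds -/

namespace BoundaryRigidity

variable {n : ℕ}

namespace RectifiableVarifold

variable {U : Opens (Space n)} {g : C1Metric U}

theorem ae_mem_carrier (V : RectifiableVarifold g) : ∀ᵐ x ∂V.mass, x ∈ V.carrier := by
  refine (withDensity_absolutelyContinuous _ _).ae_le ?_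
  exact ae_restrict_mem₀ V.nullMeasurableSet

theorem ae_mem_domain (V : RectifiableVarifold g) : ∀ᵐ x ∂V.mass, x ∈ U :=
  V.ae_mem_carrier.mono fun _ hx => V.carrier_subset hx

theorem hausdorff_le_mass (V : RectifiableVarifold g) {A : Set (Space n)}
    (hA : A ⊆ {x ∈ V.carrier | 1 ≤ V.mult x}) : g.hausdorff A ≤ V.mass A := by
  -- `A` need not be measurable, so the integral is taken over a measurable hull
  set T := toMeasurable V.mass A
  have hT : MeasurableSet T := measurableSet_toMeasurable _ _
  calc g.hausdorff A = g.hausdorff (A ∩ V.carrier) := by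
        rw [inter_eq_left.2 fun x hx => (hA hx).1]
    _ = g.hausdorff.restrict V.carrier A := (Measure.restrict_apply₀' V.nullMeasurableSet).symm
    _ ≤ g.hausdorff.restrict V.carrier ({x | (1 : ℝ≥0∞) ≤ V.mult x} ∩ T) :=
        measure_mono fun x hx => ⟨by exact_mod_cast (hA hx).2, subset_toMeasurable _ _ hx⟩
    _ = (g.hausdorff.restrict V.carrier).restrict T {x | (1 : ℝ≥0∞) ≤ V.mult x} :=
        (Measure.restrict_apply' hT).symm
    _ ≤ ∫⁻ x in T, V.mult x ∂(g.hausdorff.restrict V.carrier) := by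
        have := mul_meas_ge_le_lintegral₀ (μ := (g.hausdorff.restrict V.carrier).restrict T)
          (f := fun x => (V.mult x : ℝ≥0∞)) (V.aemeasurable_mult.coe_nnreal_ennreal.restrict) 1
        simpa using this
    _ = V.mass T := (withDensity_apply _ hT).symm
    _ = V.mass A := measure_toMeasurable A

/-- Almost everywhere, the multiplicity of the approximate tangent plane is bounded below: this
combines the upper density theorem for Hausdorff measures with the isodiametric inequality in
the plane. -/
theorem ae_exists_hasBlowUp (V : RectifiableVarifold g) (hn : n ≠ 0) {c₀ : ℝ} (hc₀ : 0 < c₀)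
    (hg : ∀ x ∈ U, ∀ v, (c₀ * ‖v‖) ^ 2 ≤ g.toFun x v v) (hmult : ∀ᵐ x ∂V.mass, 1 ≤ V.mult x)
    {O : Set (Space n)} (hO : IsOpen O) (hfin : V.mass O ≠ ⊤) :
    ∀ᵐ x ∂V.mass, x ∈ O → ∃ c ≥ c₀ ^ n, HasBlowUp V.mass x (V.tangent x) c := by
  set κ : ℝ≥0∞ := ((hausdorffFactor n : ℝ≥0) : ℝ≥0∞)
  have hκ0 : κ ≠ 0 := ENNReal.coe_ne_zero.2 (hausdorffFactor_ne_zero n)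
  have hκ1 : κ ≠ ⊤ := ENNReal.coe_ne_top
  set S : Set (Space n) := {x ∈ V.carrier | 1 ≤ V.mult x} ∩ O
  have hS : V.mass S ≠ ⊤ := ne_top_of_le_ne_top hfin (measure_mono inter_subset_right)
  have hk : ∀ A ⊆ S, ENNReal.ofReal (c₀ ^ n) * κ * μH[n] A ≤ V.mass A := fun A hA =>
    (g.mul_hausdorffMeasure_le hc₀ hg fun x hx => V.carrier_subset (hA hx).1.1).trans
      (V.hausdorff_le_mass fun x hx => (hA hx).1)
  let τ : ℕ → ℝ := fun j => c₀ ^ n * (1 - 1 / ((j : ℝ) + 2))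
  have hτ : ∀ j, 0 < τ j ∧ τ j < c₀ ^ n := fun j => by
    have h1 : (0 : ℝ) < 1 / ((j : ℝ) + 2) := by positivity
    have h2 : 1 / ((j : ℝ) + 2) < 1 := by
      rw [div_lt_one (by positivity)]
      have : (0 : ℝ) ≤ j := j.cast_nonneg
      linarith
    have h3 : 0 < c₀ ^ n := by positivity
    constructor
    · exact mul_pos h3 (by linarith)
    · simp only [τ]
      nlinarith
  have hnull := fun j => measure_setOf_density_le_eq_zero V.mass S hS
    (k := ENNReal.ofReal (c₀ ^ n) * κ) (t := ENNReal.ofReal (τ j) * κ) (d := n) hk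
    ((ENNReal.mul_lt_mul_iff_left hκ0 hκ1).2
      ((ENNReal.ofReal_lt_ofReal_iff (by positivity)).2 (hτ j).2))
    (mul_ne_zero (by simpa using (hτ j).1) hκ0)
  have hae := ae_all_iff.2 fun j => (measure_eq_zero_iff_ae_notMem.1 (hnull j))
  filter_upwards [hae, hmult, V.ae_mem_carrier, V.isApproxTangentPlane] with x hx hm hxc htan hxO
  have hxS : x ∈ S := ⟨⟨hxc, hm⟩, hxO⟩
  obtain ⟨c, hc, hblow⟩ := htan
  obtain ⟨ρ, hρ, hρO⟩ := Metric.isOpen_iff.1 hO x hxO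
  refine ⟨c, ?_, hblow⟩
  have hle : ∀ j, τ j ≤ c := by
    intro j
    refine HasBlowUp.le_of_frequently_small_sets (μ := V.mass) hblow hc.le (hτ j).1 hρ hn
      (ne_top_of_le_ne_top hfin (measure_mono hρO)) ?_
    intro δ hδ
    have h1 := hx j
    simp only [not_and, not_exists, not_forall, not_le] at h1
    obtain ⟨C, hC1, hC2, hC3⟩ := h1 hxS δ hδ
    refine ⟨C, hC1, hC2, ?_⟩
    rwa [ENNReal.rpow_natCast] at hC3
  have hlim : Tendsto τ atTop (𝓝 (c₀ ^ n * (1 - 0))) := by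
    refine Tendsto.const_mul _ (Tendsto.const_sub _ ?_)
    have := (tendsto_one_div_add_atTop_nhds_zero_nat (𝕜 := ℝ)).comp (tendsto_add_atTop_nat 1)
    refine this.congr fun j => ?_
    simp only [Function.comp_apply]
    push_cast
    ring_nf
  rw [sub_zero, mul_one] at hlim
  exact le_of_tendsto' hlim hle

end RectifiableVarifold

end BoundaryRigidity

/-! ### Tangential divergence and orthonormal bases -/

namespace BoundaryRigidity

variable {n : ℕ} {U : Opens (Space n)}

theorem exists_isOrthonormalBasisAt (g : C1Metric U) {x : Space n} (hx : x ∈ U) (S : Gr n) :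
    ∃ e, IsOrthonormalBasisAt g x S e := by
  let B : LinearMap.BilinForm ℝ S.1 :=
    LinearMap.mk₂ ℝ (fun v w : S.1 => g.toFun x v w) (by simp) (by simp) (by simp) (by simp)
  have hB : LinearMap.IsSymm B := ⟨fun v w => g.symm x hx v w⟩
  obtain ⟨v, hv⟩ := LinearMap.BilinForm.exists_orthogonal_basis hB
  have hpos : ∀ i, 0 < g.toFun x (v i : Space n) (v i) := fun i =>
    g.pos x hx _ (by simpa using v.ne_zero i)
  let k : Fin n → Fin (Module.finrank ℝ S.1) := finCongr S.2.symm
  have hk : Function.Injective k := (finCongr S.2.symm).injective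
  refine ⟨fun i => (√(g.toFun x (v (k i) : Space n) (v (k i))))⁻¹ • (v (k i) : Space n),
    fun i => S.1.smul_mem _ (v (k i)).2, fun i j => ?_⟩
  simp only [map_smul, FunLike.coe_smul, Pi.smul_apply, smul_eq_mul]
  split_ifs with h
  · subst h
    rw [← mul_assoc, ← mul_inv, Real.mul_self_sqrt (hpos _).le, inv_mul_cancel₀ (hpos _).ne']
  · have : g.toFun x (v (k i) : Space n) (v (k j)) = 0 := hv (hk.ne h)
    simp [this]

namespace IsOrthonormalBasisAt

variable {g : C1Metric U} {x : Space n} {S : Gr n} {e : Fin n → Space n}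

theorem sum_smul_eq (he : IsOrthonormalBasisAt g x S e) {u : Space n} (hu : u ∈ S.1) :
    ∑ i, g.toFun x (e i) u • e i = u := by
  have hlin : LinearIndependent ℝ (fun i => (⟨e i, he.1 i⟩ : S.1)) := by
    rw [Fintype.linearIndependent_iff]
    intro c hc j
    have h1 : ∑ i, c i • e i = 0 := by
      have := congrArg (Subtype.val : S.1 → Space n) hc
      simpa using this
    have h2 := congrArg (g.toFun x (e j)) h1
    simpa [map_sum, he.2] using h2
  have hspan : ⊤ ≤ Submodule.span ℝ (range fun i => (⟨e i, he.1 i⟩ : S.1)) :=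
    (hlin.span_eq_top_of_card_eq_finrank' (by simp [S.2])).ge
  have h3 : (⟨u, hu⟩ : S.1) ∈ Submodule.span ℝ (range fun i => (⟨e i, he.1 i⟩ : S.1)) :=
    hspan trivial
  obtain ⟨c, hc⟩ := (Submodule.mem_span_range_iff_exists_fun ℝ).1 h3
  have h4 : ∑ i, c i • e i = u := by
    have := congrArg (Subtype.val : S.1 → Space n) hc
    simpa using this
  have h5 : ∀ j, g.toFun x (e j) u = c j := fun j => by
    rw [← h4]
    simp [map_sum, he.2]
  simp_rw [h5, h4]

theorem norm_le (he : IsOrthonormalBasisAt g x S e) {c₀ : ℝ} (hc₀ : 0 < c₀)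
    (hg : ∀ v, (c₀ * ‖v‖) ^ 2 ≤ g.toFun x v v) (i : Fin n) : ‖e i‖ ≤ c₀⁻¹ := by
  have h1 := hg (e i)
  rw [he.2 i i, if_pos rfl] at h1
  have h2 : c₀ * ‖e i‖ ≤ 1 := by
    have : 0 ≤ c₀ * ‖e i‖ := by positivity
    nlinarith
  rwa [← one_div, le_div_iff₀' hc₀]

/-- Bessel's inequality. -/
theorem sum_sq_le (he : IsOrthonormalBasisAt g x S e) (hx : x ∈ U) (y : Space n) :
    ∑ i, g.toFun x (e i) y ^ 2 ≤ g.toFun x y y := by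
  set p := ∑ i, g.toFun x (e i) y • e i with hp
  have h1 : 0 ≤ g.toFun x (y - p) (y - p) := by
    rcases eq_or_ne (y - p) 0 with h | h
    · simp [h]
    · exact (g.pos x hx _ h).le
  have h2 : g.toFun x p y = ∑ i, g.toFun x (e i) y ^ 2 := by
    simp [hp, map_sum, sq]
  have h3 : g.toFun x p p = ∑ i, g.toFun x (e i) y ^ 2 := by
    have : ∀ i, g.toFun x p (e i) = g.toFun x (e i) y := fun i => by
      simp [hp, map_sum, he.2]
    conv_lhs => rw [show g.toFun x p p = g.toFun x p (∑ i, g.toFun x (e i) y • e i) from rfl]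
    simp only [map_sum, map_smul, this, smul_eq_mul, sq]
  have h4 : g.toFun x y p = g.toFun x p y := g.symm x hx _ _
  simp only [map_sub, FunLike.coe_sub, Pi.sub_apply] at h1
  linarith

end IsOrthonormalBasisAt

namespace C1Metric

theorem differentiableAt (g : C1Metric U) {x : Space n} (hx : x ∈ U) :
    DifferentiableAt ℝ g.toFun x :=
  (g.contDiffOn.contDiffAt (U.isOpen.mem_nhds hx)).differentiableAt one_ne_zero

theorem fderiv_symm (g : C1Metric U) {x : Space n} (hx : x ∈ U) (u v w : Space n) :
    fderiv ℝ g.toFun x u v w = fderiv ℝ g.toFun x u w v := by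
  have hd := (g.differentiableAt hx).hasFDerivAt
  have key : ∀ v w : Space n, HasFDerivAt (fun y => g.toFun y v w)
      (((ContinuousLinearMap.apply ℝ ℝ w).comp
          (ContinuousLinearMap.apply ℝ (Space n →L[ℝ] ℝ) v)).comp
        (fderiv ℝ g.toFun x)) x := fun v w =>
    ((ContinuousLinearMap.apply ℝ ℝ w).comp
      (ContinuousLinearMap.apply ℝ (Space n →L[ℝ] ℝ) v)).hasFDerivAt.comp x hd
  have h1 : (fun y => g.toFun y v w) =ᶠ[𝓝 x] fun y => g.toFun y w v :=
    Filter.eventually_of_mem (U.isOpen.mem_nhds hx) fun y hy => g.symm y hy v w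
  have h2 := (key v w).unique ((key w v).congr_of_eventuallyEq h1)
  exact congrArg (fun L : Space n →L[ℝ] ℝ => L u) h2

/-- The bilinear form `(v, w) ↦ g(D_v X, w) + ½ (D_X g)(v, w)`. It has the same diagonal as
`(v, w) ↦ g(∇_v X, w)`, in which the Christoffel symbols enter through `koszul`. -/
noncomputable def divForm (g : C1Metric U) (X : Space n → Space n) (x : Space n) :
    Space n →L[ℝ] Space n →L[ℝ] ℝ :=
  (g.toFun x).comp (fderiv ℝ X x) + (1 / 2 : ℝ) • fderiv ℝ g.toFun x (X x)

theorem apply_covDeriv_self (g : C1Metric U) {x : Space n} (hx : x ∈ U)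
    (X : Space n → Space n) (v : Space n) :
    g.toFun x v (g.covDeriv X x v) = g.divForm X x v v := by
  rw [covDeriv, map_add, g.symm x hx v (g.christoffel _ _ _), g.apply_christoffel hx, koszul_apply,
    g.symm x hx v, divForm, g.fderiv_symm hx v (X x) v]
  simp

theorem exists_tangentialDiv_eq (g : C1Metric U) {x : Space n} (hx : x ∈ U)
    (X : Space n → Space n) (S : Gr n) :
    ∃ e, IsOrthonormalBasisAt g x S e ∧ tangentialDiv g X x S = ∑ i, g.divForm X x (e i) (e i) := by
  have he := Classical.epsilon_spec (exists_isOrthonormalBasisAt g hx S)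
  exact ⟨_, he, Finset.sum_congr rfl fun i _ => g.apply_covDeriv_self hx X _⟩

/-- The operator on `ℝ^{n+1}` that represents a bilinear form. -/
noncomputable def sharp : (Space n →L[ℝ] Space n →L[ℝ] ℝ) →L[ℝ] Space n →L[ℝ] Space n :=
  ContinuousLinearMap.compL ℝ (Space n) (Space n →L[ℝ] ℝ) (Space n)
    (LinearMap.toContinuousLinearMap
      { toFun := (InnerProductSpace.toDual ℝ (Space n)).symm
        map_add' := map_add _
        map_smul' := fun c φ => by simp })

theorem inner_sharp (b : Space n →L[ℝ] Space n →L[ℝ] ℝ) (v w : Space n) :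
    inner ℝ (sharp b v) w = b v w := by
  simp [sharp]

/-- For `π` the projection onto a plane `S`, the operator that is the compression to `S` of the
operator representing `b`, and the identity on the orthogonal complement of `S`. Its inverse raises
indices within `S`. -/
noncomputable def compression (b : Space n →L[ℝ] Space n →L[ℝ] ℝ) (π : Space n →L[ℝ] Space n) :
    Space n →L[ℝ] Space n :=
  π * sharp b * π + (1 - π)

end C1Metric

open C1Metric

theorem Gr.proj_mem (S : Gr n) (v : Space n) : S.proj v ∈ S.1 :=
  Submodule.starProjection_apply_mem _ _

theorem Gr.proj_eq_self (S : Gr n) {v : Space n} (hv : v ∈ S.1) : S.proj v = v :=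
  Submodule.starProjection_eq_self_iff.2 hv

theorem Gr.inner_proj (S : Gr n) (v w : Space n) : inner ℝ (S.proj v) w = inner ℝ v (S.proj w) :=
  S.1.inner_starProjection_left_eq_right v w

theorem isUnit_compression (b : Space n →L[ℝ] Space n →L[ℝ] ℝ) (S : Gr n)
    (hb : ∀ v, v ≠ 0 → 0 < b v v) : IsUnit (compression b S.proj) := by
  rw [ContinuousLinearMap.isUnit_iff_bijective]
  have hinj : Function.Injective (compression b S.proj) := by
    rw [injective_iff_map_eq_zero]
    intro v hv
    have h1 : S.proj (sharp b (S.proj v)) + (v - S.proj v) = 0 := hv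
    have h2 : S.proj v = 0 := by
      by_contra hne
      have h3 := hb _ hne
      have h4 := congrArg (fun w => inner ℝ w (S.proj v)) h1
      simp only [inner_add_left, inner_zero_left] at h4
      have h5 : inner ℝ (v - S.proj v) (S.proj v) = 0 := by
        rw [← S.inner_proj, map_sub, S.proj_eq_self (S.proj_mem v), sub_self, inner_zero_left]
      rw [h5, S.inner_proj, S.proj_eq_self (S.proj_mem v), inner_sharp] at h4
      linarith
    rw [h2] at h1
    simpa using h1
  exact ⟨hinj, (LinearMap.injective_iff_surjective
      (f := (compression b S.proj).toLinearMap)).1 hinj⟩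

/-- A formula for the trace over an orthonormal basis of `S` which does not involve a choice of
basis, and in which the dependence on the plane is visibly measurable. -/
theorem IsOrthonormalBasisAt.sum_eq_trace {g : C1Metric U} {x : Space n} {S : Gr n}
    {e : Fin n → Space n} (he : IsOrthonormalBasisAt g x S e) (hx : x ∈ U)
    (b : Space n →L[ℝ] Space n →L[ℝ] ℝ) :
    ∑ i, b (e i) (e i) = LinearMap.trace ℝ (Space n)
      (Ring.inverse (compression (g.toFun x) S.proj) * S.proj
          * sharp b : Space n →L[ℝ] Space n).toLinearMap := by
  set B := compression (g.toFun x) S.proj with hB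
  have hu : IsUnit B := isUnit_compression _ S (g.pos x hx)
  let Q : Space n →L[ℝ] Space n := ∑ i, (innerSL ℝ (e i)).smulRight (e i)
  have hQ : ∀ v, Q v = ∑ i, inner ℝ (e i) v • e i := fun v => by simp [Q]
  have hBQ : B * Q = S.proj := by
    ext1 v
    have hQS : S.proj (Q v) = Q v := S.proj_eq_self (by
      rw [hQ]
      exact S.1.sum_mem fun i _ => S.1.smul_mem _ (he.1 i))
    have h1 : (B * Q) v = S.proj (sharp (g.toFun x) (S.proj (Q v))) + (Q v - S.proj (Q v)) := rfl
    rw [h1, hQS, sub_self, add_zero]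
    refine ext_inner_right ℝ fun w => ?_
    rw [S.inner_proj, inner_sharp, hQ, map_sum, S.inner_proj]
    conv_rhs => rw [← he.sum_smul_eq (S.proj_mem w)]
    simp only [map_smul, FunLike.coe_sum, FunLike.coe_smul, Finset.sum_apply,
      Pi.smul_apply, smul_eq_mul, inner_sum, inner_smul_right]
    refine Finset.sum_congr rfl fun i _ => ?_
    rw [real_inner_comm, mul_comm]
  have hinv : Ring.inverse B * S.proj = Q := by
    rw [← hBQ, ← mul_assoc, Ring.inverse_mul_cancel _ hu, one_mul]
  rw [hinv]
  have h2 : (Q * sharp b : Space n →L[ℝ] Space n).toLinearMap =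
      ∑ i, (((innerSL ℝ (e i)).comp (sharp b)).toLinearMap.smulRight (e i)) := by
    ext1 v
    simp [hQ]
  rw [h2, map_sum]
  refine Finset.sum_congr rfl fun i _ => ?_
  rw [LinearMap.trace_smulRight]
  simp only [ContinuousLinearMap.coe_coe, ContinuousLinearMap.comp_apply, innerSL_apply_apply]
  rw [real_inner_comm, inner_sharp]

end BoundaryRigidity

/-! ### Measurability and integrability of the tangential divergence -/

namespace BoundaryRigidity

variable {n : ℕ} {U : Opens (Space n)}

theorem measurable_ringInverse {E : Type*} [NormedAddCommGroup E] [NormedSpace ℝ E]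
    [CompleteSpace E] : Measurable (Ring.inverse : (E →L[ℝ] E) → E →L[ℝ] E) := by
  have hopen : IsOpen {a : E →L[ℝ] E | IsUnit a} := Units.isOpen
  refine measurable_of_restrict_of_restrict_compl hopen.measurableSet ?_ ?_
  · refine Continuous.measurable ?_
    rw [continuous_iff_continuousAt]
    rintro ⟨a, ha⟩
    have h1 : ContinuousAt Ring.inverse a := by
      obtain ⟨u, rfl⟩ := ha
      exact NormedRing.inverse_continuousAt u
    exact ContinuousAt.comp (g := Ring.inverse) (f := Subtype.val) h1
      continuous_subtype_val.continuousAt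
  · have : {a : E →L[ℝ] E | IsUnit a}ᶜ.domRestrict (Ring.inverse : (E →L[ℝ] E) → E →L[ℝ] E) =
        fun _ => 0 := by
      ext1 a
      exact Ring.inverse_non_unit _ a.2
    rw [this]
    exact measurable_const

theorem Gr.continuous_proj : Continuous (Gr.proj : Gr n → Space n →L[ℝ] Space n) :=
  continuous_induced_dom

namespace C1Metric

theorem continuousOn_divForm (g : C1Metric U) {X : Space n → Space n} (hX : ContDiff ℝ 1 X) :
    ContinuousOn (g.divForm X) U := by
  have h1 := g.contDiffOn.continuousOn
  have h2 : ContinuousOn (fderiv ℝ g.toFun) U :=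
    g.contDiffOn.continuousOn_fderiv_of_isOpen U.isOpen le_rfl
  have h3 : Continuous (fderiv ℝ X) := hX.continuous_fderiv one_ne_zero
  have h4 := hX.continuous
  have h5 : ContinuousOn (fun x => (1 / 2 : ℝ) • fderiv ℝ g.toFun x (X x)) U :=
    (continuous_const_smul (1 / 2 : ℝ)).comp_continuousOn (h2.clm_apply h4.continuousOn)
  unfold divForm
  exact (h1.clm_comp h3.continuousOn).add h5

theorem divForm_eq_zero (g : C1Metric U) {X : Space n → Space n} {x : Space n}
    (hx : x ∉ tsupport X) : g.divForm X x = 0 := by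
  rw [divForm, image_eq_zero_of_notMem_tsupport hx,
    image_eq_zero_of_notMem_tsupport fun h => hx (tsupport_fderiv_subset ℝ h)]
  simp

end C1Metric

open C1Metric

namespace RectifiableVarifold

variable {g : C1Metric U}

theorem mass_restrict_domain (V : RectifiableVarifold g) : V.mass.restrict U = V.mass :=
  Measure.restrict_eq_self_of_ae_mem V.ae_mem_domain

theorem aestronglyMeasurable_of_continuousOn (V : RectifiableVarifold g) {F : Type*}
    [TopologicalSpace F] [PseudoMetrizableSpace F] {f : Space n → F}
    (hf : ContinuousOn f U) : AEStronglyMeasurable f V.mass := by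
  rw [← V.mass_restrict_domain]
  exact hf.aestronglyMeasurable U.isOpen.measurableSet

theorem aestronglyMeasurable_proj (V : RectifiableVarifold g) :
    AEStronglyMeasurable (fun x => (V.tangent x).proj) V.mass :=
  (Gr.continuous_proj.measurable.comp_aemeasurable V.aemeasurable_tangent).aestronglyMeasurable

theorem aestronglyMeasurable_tangentialDiv (V : RectifiableVarifold g) {X : Space n → Space n}
    (hX : ContDiff ℝ 1 X) :
    AEStronglyMeasurable (fun x => tangentialDiv g X x (V.tangent x)) V.mass := by
  have hπ := V.aestronglyMeasurable_proj
  have hg := V.aestronglyMeasurable_of_continuousOn (g.contDiffOn.continuousOn)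
  have hd := V.aestronglyMeasurable_of_continuousOn (g.continuousOn_divForm hX)
  have hB : AEStronglyMeasurable (fun x => compression (g.toFun x) (V.tangent x).proj) V.mass :=
    ((hπ.mul (sharp.continuous.comp_aestronglyMeasurable hg)).mul hπ).add
      (aestronglyMeasurable_const.sub hπ)
  have hI : AEStronglyMeasurable
      (fun x => Ring.inverse (compression (g.toFun x) (V.tangent x).proj)) V.mass :=
    (measurable_ringInverse.comp_aemeasurable hB.aemeasurable).aestronglyMeasurable
  have hT := (hI.mul hπ).mul (sharp.continuous.comp_aestronglyMeasurable hd)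
  have htr : Continuous fun A : Space n →L[ℝ] Space n =>
      LinearMap.trace ℝ (Space n) A.toLinearMap :=
    LinearMap.continuous_of_finiteDimensional
      ((LinearMap.trace ℝ (Space n)).comp (ContinuousLinearMap.coeLM ℝ))
  refine (htr.comp_aestronglyMeasurable hT).congr ?_
  filter_upwards [V.ae_mem_domain] with x hx
  obtain ⟨e, he, hsum⟩ := g.exists_tangentialDiv_eq hx X (V.tangent x)
  rw [hsum, he.sum_eq_trace hx]
  rfl

theorem integrable_tangentialDiv (V : RectifiableVarifold g) {X : Space n → Space n}
    (hX : IsTestField U X) {c₀ : ℝ} (hc₀ : 0 < c₀)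
    (hg : ∀ x ∈ U, ∀ v, (c₀ * ‖v‖) ^ 2 ≤ g.toFun x v v) :
    Integrable (fun x => tangentialDiv g X x (V.tangent x)) V.mass := by
  obtain ⟨hX1, hX2, hX3⟩ := hX
  obtain ⟨C, hC⟩ := hX2.isCompact.exists_bound_of_continuousOn
    ((g.continuousOn_divForm hX1).mono hX3)
  have hint : IntegrableOn (fun _ => n * (C * (c₀⁻¹ * c₀⁻¹))) (tsupport X) V.mass :=
    integrableOn_const (V.locallyFinite _ hX2.isCompact hX3).ne
  refine (hint.integrable_indicator (isClosed_tsupport X).measurableSet).mono'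
    (V.aestronglyMeasurable_tangentialDiv hX1) ?_
  filter_upwards [V.ae_mem_domain] with x hx
  obtain ⟨e, he, hsum⟩ := g.exists_tangentialDiv_eq hx X (V.tangent x)
  rw [hsum]
  by_cases hxX : x ∈ tsupport X
  · rw [indicator_of_mem hxX]
    have hC0 : 0 ≤ C := (norm_nonneg _).trans (hC x hxX)
    refine (norm_sum_le_of_le _ (f := fun i => g.divForm X x (e i) (e i))
      (n := fun _ => C * (c₀⁻¹ * c₀⁻¹)) fun i _ => ?_).trans_eq (by simp)
    refine (ContinuousLinearMap.le_opNorm₂ _ _ _).trans ?_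
    have := he.norm_le hc₀ (hg x hx) i
    rw [mul_assoc]
    have h1 := hC x hxX
    gcongr
  · rw [indicator_of_notMem hxX, g.divForm_eq_zero hxX]
    simp

end RectifiableVarifold

end BoundaryRigidity

/-! ### The radial kernel -/

namespace BoundaryRigidity

/-- A convex `C¹` approximation of the positive part, within `σ` of it. -/
noncomputable def softPos (σ s : ℝ) : ℝ := √(max s 0 ^ 2 + σ ^ 2) - σ

/-- The derivative of `softPos σ`. -/
noncomputable def softPosDeriv (σ s : ℝ) : ℝ := max s 0 / √(max s 0 ^ 2 + σ ^ 2)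

theorem hasDerivAt_max_zero_sq (s : ℝ) : HasDerivAt (fun s : ℝ => max s 0 ^ 2) (2 * max s 0) s := by
  rcases lt_trichotomy s 0 with h | rfl | h
  · rw [max_eq_right h.le, mul_zero]
    refine (hasDerivAt_const s (0 : ℝ)).congr_of_eventuallyEq ?_
    filter_upwards [Iio_mem_nhds h] with t ht
    rw [max_eq_right (le_of_lt ht), sq, mul_zero]
  · rw [max_self, mul_zero, hasDerivAt_iff_isLittleO_nhds_zero]
    have h1 : (fun h : ℝ => max (0 + h) 0 ^ 2 - max (0 : ℝ) 0 ^ 2 - h • (0 : ℝ)) =O[𝓝 0]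
        fun h : ℝ => h ^ 2 := by
      refine Asymptotics.isBigO_of_le _ fun h => ?_
      simp only [zero_add, max_self, smul_zero, sub_zero, norm_pow, Real.norm_eq_abs]
      norm_num
      rw [← sq_abs h]
      have : |max h 0| ≤ |h| := by
        rcases le_total h 0 with h0 | h0
        · rw [max_eq_right h0, abs_zero]; positivity
        · rw [max_eq_left h0]
      rw [← sq_abs (max h 0)]
      gcongr
    refine h1.trans_isLittleO ?_
    simpa using Asymptotics.isLittleO_pow_id (𝕜 := ℝ) one_lt_two
  · rw [max_eq_left h.le]
    refine ((hasDerivAt_pow 2 s).congr_of_eventuallyEq ?_).congr_deriv (by simp)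
    filter_upwards [Ioi_mem_nhds h] with t ht
    rw [max_eq_left (le_of_lt ht)]

theorem hasDerivAt_softPos {σ : ℝ} (hσ : 0 < σ) (s : ℝ) :
    HasDerivAt (softPos σ) (softPosDeriv σ s) s := by
  have h1 : 0 < max s 0 ^ 2 + σ ^ 2 := by positivity
  have h2 := (((hasDerivAt_max_zero_sq s).add_const (σ ^ 2)).sqrt h1.ne').sub_const σ
  refine h2.congr_deriv ?_
  rw [softPosDeriv]
  field_simp

theorem continuous_softPosDeriv {σ : ℝ} (hσ : 0 < σ) : Continuous (softPosDeriv σ) := by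
  unfold softPosDeriv
  refine Continuous.div (by fun_prop) (by fun_prop) fun s => ?_
  have : 0 < max s 0 ^ 2 + σ ^ 2 := by positivity
  exact (Real.sqrt_pos.2 this).ne'

theorem softPosDeriv_nonneg (σ s : ℝ) : 0 ≤ softPosDeriv σ s :=
  div_nonneg (le_max_right _ _) (Real.sqrt_nonneg _)

theorem softPosDeriv_le_one {σ : ℝ} (hσ : 0 < σ) (s : ℝ) : softPosDeriv σ s ≤ 1 := by
  have : 0 < max s 0 ^ 2 + σ ^ 2 := by positivity
  rw [softPosDeriv, div_le_one (Real.sqrt_pos.2 this)]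
  exact Real.le_sqrt_of_sq_le (by nlinarith)

theorem softPos_of_nonpos {σ : ℝ} (hσ : 0 < σ) {s : ℝ} (hs : s ≤ 0) : softPos σ s = 0 := by
  simp [softPos, max_eq_right hs, Real.sqrt_sq hσ.le]

theorem softPosDeriv_of_nonpos {σ : ℝ} {s : ℝ} (hs : s ≤ 0) : softPosDeriv σ s = 0 := by
  simp [softPosDeriv, max_eq_right hs]

theorem softPos_nonneg (σ s : ℝ) : 0 ≤ softPos σ s := by
  rw [softPos, sub_nonneg]
  exact Real.le_sqrt_of_sq_le (by nlinarith [sq_nonneg (max s 0)])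

theorem softPos_le {σ : ℝ} (hσ : 0 < σ) {s : ℝ} (hs : 0 ≤ s) : softPos σ s ≤
    s * softPosDeriv σ s := by
  rw [softPos, softPosDeriv, max_eq_left hs]
  have h0 : 0 < s ^ 2 + σ ^ 2 := by positivity
  have h1 := Real.sqrt_pos.2 h0
  have h2 := Real.sq_sqrt h0.le
  have h3 : σ ≤ √(s ^ 2 + σ ^ 2) := Real.le_sqrt_of_sq_le (by nlinarith)
  rw [mul_div_assoc', le_div_iff₀ h1]
  nlinarith

theorem le_softPos {σ : ℝ} (hσ : 0 < σ) {s : ℝ} (hs : 0 ≤ s) : s * softPosDeriv σ s - σ ≤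
    softPos σ s := by
  rw [softPos, softPosDeriv, max_eq_left hs]
  have h0 : 0 < s ^ 2 + σ ^ 2 := by positivity
  have h1 := Real.sqrt_pos.2 h0
  have h2 := Real.sq_sqrt h0.le
  rw [sub_le_sub_iff_right, mul_div_assoc', div_le_iff₀ h1]
  nlinarith

theorem half_le_softPosDeriv {σ : ℝ} (hσ : 0 < σ) {s : ℝ} (hs : σ ≤ s) : 1 / 2 ≤
    softPosDeriv σ s := by
  have hs0 : 0 < s := hσ.trans_le hs
  have h0 : 0 < s ^ 2 + σ ^ 2 := by positivity
  rw [softPosDeriv, max_eq_left hs0.le, le_div_iff₀ (Real.sqrt_pos.2 h0)]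
  have : √(s ^ 2 + σ ^ 2) ≤ 2 * s := Real.sqrt_le_left (by positivity) |>.2 (by nlinarith)
  linarith

theorem tendsto_softPosDeriv_atTop {σ : ℝ} (hσ : 0 < σ) : Tendsto (softPosDeriv σ) atTop (𝓝 1) := by
  have h1 : Tendsto (fun s : ℝ => 1 - σ / s) atTop (𝓝 (1 - 0)) :=
    tendsto_const_nhds.sub (tendsto_const_nhds.div_atTop tendsto_id)
  rw [sub_zero] at h1
  refine tendsto_of_tendsto_of_tendsto_of_le_of_le' h1 tendsto_const_nhds ?_
    (Eventually.of_forall fun s => softPosDeriv_le_one hσ s)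
  filter_upwards [eventually_gt_atTop 0] with s hs
  have h0 : 0 < s ^ 2 + σ ^ 2 := by positivity
  rw [softPosDeriv, max_eq_left hs.le, le_div_iff₀ (Real.sqrt_pos.2 h0)]
  have h2 : √(s ^ 2 + σ ^ 2) ≤ s + σ := Real.sqrt_le_left (by positivity) |>.2 (by nlinarith)
  rcases le_total (1 - σ / s) 0 with h3 | h3
  · nlinarith [Real.sqrt_nonneg (s ^ 2 + σ ^ 2)]
  · calc (1 - σ / s) * √(s ^ 2 + σ ^ 2) ≤ (1 - σ / s) * (s + σ) := by gcongr
      _ = s - σ ^ 2 / s := by field_simp; ring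
      _ ≤ s := by have : 0 ≤ σ ^ 2 / s := by positivity
                  linarith

/-- The regularised distance, as a function of the squared distance. -/
noncomputable def regDist (ε q : ℝ) : ℝ := √(q + ε ^ 2)

/-- The radial profile `w⁻ⁿ + a w¹⁻ⁿ`. The second term is the lower order correction that absorbs
the errors due to the metric. -/
noncomputable def profile (n : ℕ) (a w : ℝ) : ℝ := (1 + a * w) / w ^ n

/-- The derivative of the radial profile. -/
noncomputable def profileDeriv (n : ℕ) (a w : ℝ) : ℝ := -((n + a * (n - 1) * w) / w ^ (n + 1))

section profile

variable {n : ℕ} {a ε w q : ℝ}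

theorem regDist_pos (hq : -ε ^ 2 < q) : 0 < regDist ε q :=
  Real.sqrt_pos.2 (by linarith)

theorem regDist_sq (hq : -ε ^ 2 < q) : regDist ε q ^ 2 = q + ε ^ 2 :=
  Real.sq_sqrt (by linarith)

theorem hasDerivAt_regDist (hq : -ε ^ 2 < q) :
    HasDerivAt (regDist ε) (1 / (2 * regDist ε q)) q := by
  exact ((hasDerivAt_id q).add_const (ε ^ 2)).sqrt (by simp; linarith)

theorem regDist_le_regDist {q' : ℝ} (h : q ≤ q') : regDist ε q ≤ regDist ε q' :=
  Real.sqrt_le_sqrt (by linarith)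

theorem hasDerivAt_profile (hw : 0 < w) :
    HasDerivAt (profile n a) (profileDeriv n a w) w := by
  have h1 := (((hasDerivAt_id w).const_mul a).const_add 1).div (hasDerivAt_pow n w)
    (pow_ne_zero n hw.ne')
  refine h1.congr_deriv ?_
  rw [profileDeriv]
  rcases n with _ | n
  · simp
    field_simp
  · simp only [id, Nat.add_sub_cancel]
    push_cast
    field_simp
    ring

theorem profile_le (ha : 0 ≤ a) (hw : 0 < w) {w' : ℝ} (hn : 1 ≤ n) (h : w ≤ w') :
    profile n a w' ≤ profile n a w := by
  obtain ⟨m, rfl⟩ := Nat.exists_eq_add_of_le' hn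
  have hw' : 0 < w' := hw.trans_le h
  have h1 : ∀ v : ℝ, 0 < v → profile (m + 1) a v = (v ^ (m + 1))⁻¹ + a * (v ^ m)⁻¹ := fun v hv => by
    rw [profile]
    field_simp
    ring
  rw [h1 w hw, h1 w' hw']
  gcongr

theorem profileDeriv_nonpos (ha : 0 ≤ a) (hw : 0 < w) (hn : 1 ≤ n) : profileDeriv n a w ≤ 0 := by
  have : (1 : ℝ) ≤ n := by exact_mod_cast hn
  have : 0 ≤ (n : ℝ) - 1 := by linarith
  rw [profileDeriv, neg_nonpos]
  positivity

/-- The divergence of `y ↦ profile y`, with `q` the squared norm of `y`, along an `n`-plane that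
contains `y`: the term with `ε ^ 2` is an approximate identity, and the other one is the gain that
absorbs errors. -/
theorem le_profile_divergence (ha : 0 ≤ a) (hn : 1 ≤ n) (hq : 0 ≤ q) (hε : 0 < ε) :
    n * ε ^ 2 / regDist ε q ^ (n + 2) + a * (regDist ε q / regDist ε q ^ n) ≤
      n * profile n a (regDist ε q) + q * (profileDeriv n a (regDist ε q) / regDist ε q) := by
  have hq' : -ε ^ 2 < q := by have : 0 < ε ^ 2 := by positivity
                              linarith
  have hw := regDist_pos hq'
  have hsq := regDist_sq hq'
  set w := regDist ε q
  have hqw : q = w ^ 2 - ε ^ 2 := by linarith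
  have h1 : (1 : ℝ) ≤ n := by exact_mod_cast hn
  have h2 : n * profile n a w + q * (profileDeriv n a w / w) -
      (n * ε ^ 2 / w ^ (n + 2) + a * (w / w ^ n)) = a * (n - 1) * ε ^ 2 / w ^ (n + 1) := by
    rw [profile, profileDeriv, hqw]
    field_simp
    ring
  have h3 : 0 ≤ a * (n - 1) * ε ^ 2 / w ^ (n + 1) := by
    have : 0 ≤ (n : ℝ) - 1 := by linarith
    positivity
  linarith

end profile

/-- The radial kernel, as a function of the squared distance `q`: the profile of the regularised
distance, truncated at `q = R ^ 2` by a `C¹` substitute for the positive part. -/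
noncomputable def kernel (n : ℕ) (a ε σ R q : ℝ) : ℝ :=
  softPos σ (profile n a (regDist ε q) - profile n a (regDist ε (R ^ 2)))

/-- The factor with which the derivative of the profile enters that of the kernel. It tends to one
where the profile is large and vanishes outside the ball of radius `R`. -/
noncomputable def kernelWeight (n : ℕ) (a ε σ R q : ℝ) : ℝ :=
  softPosDeriv σ (profile n a (regDist ε q) - profile n a (regDist ε (R ^ 2)))

/-- The derivative of the kernel. -/
noncomputable def kernelDeriv (n : ℕ) (a ε σ R q : ℝ) : ℝ :=
  kernelWeight n a ε σ R q * (profileDeriv n a (regDist ε q) / (2 * regDist ε q))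

/-- The potential of the radial kernel, that is, the antiderivative of `-kernel / 2` vanishing at
`R ^ 2`. -/
noncomputable def potential (n : ℕ) (a ε σ R q : ℝ) : ℝ :=
  (1 / 2) * ∫ t in q..R ^ 2, kernel n a ε σ R t

section kernel

variable {n : ℕ} {a ε σ R q : ℝ}

theorem hasDerivAt_kernel (hσ : 0 < σ) (hq : -ε ^ 2 < q) :
    HasDerivAt (kernel n a ε σ R) (kernelDeriv n a ε σ R q) q := by
  have h1 := (hasDerivAt_profile (n := n) (a := a) (regDist_pos hq)).comp q (hasDerivAt_regDist hq)
  have h2 := (hasDerivAt_softPos hσ _).comp q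
    (h1.sub_const (profile n a (regDist ε (R ^ 2))))
  refine h2.congr_deriv ?_
  rw [kernelDeriv, kernelWeight, mul_one_div]
  rfl

theorem continuousOn_kernel (hσ : 0 < σ) : ContinuousOn (kernel n a ε σ R) (Ioi (-ε ^ 2)) :=
  fun _ hq => (hasDerivAt_kernel hσ hq).continuousAt.continuousWithinAt

theorem continuousOn_kernelWeight (hσ : 0 < σ) :
    ContinuousOn (kernelWeight n a ε σ R) (Ioi (-ε ^ 2)) := by
  intro q hq
  have h1 := ((hasDerivAt_profile (n := n) (a := a) (regDist_pos hq)).comp q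
    (hasDerivAt_regDist hq)).continuousAt
  exact ((continuous_softPosDeriv hσ).continuousAt.comp
    (h1.sub_const (profile n a (regDist ε (R ^ 2))))).continuousWithinAt

theorem continuousOn_kernelDeriv (hσ : 0 < σ) :
    ContinuousOn (kernelDeriv n a ε σ R) (Ioi (-ε ^ 2)) := by
  have hr : ContinuousOn (regDist ε) (Ioi (-ε ^ 2)) := fun q hq =>
    (hasDerivAt_regDist hq).continuousAt.continuousWithinAt
  have h0 : ∀ q ∈ Ioi (-ε ^ 2), regDist ε q ≠ 0 := fun q hq => (regDist_pos hq).ne'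
  unfold kernelDeriv profileDeriv
  refine (continuousOn_kernelWeight hσ).mul (ContinuousOn.div (ContinuousOn.neg
    (ContinuousOn.div (by fun_prop) (by fun_prop) fun q hq => pow_ne_zero _ (h0 q hq)))
    (by fun_prop) fun q hq => mul_ne_zero two_ne_zero (h0 q hq))

theorem kernel_nonneg (q : ℝ) : 0 ≤ kernel n a ε σ R q := softPos_nonneg _ _

theorem kernelWeight_nonneg (q : ℝ) : 0 ≤ kernelWeight n a ε σ R q := softPosDeriv_nonneg _ _

theorem kernelWeight_le_one (hσ : 0 < σ) (q : ℝ) : kernelWeight n a ε σ R q ≤ 1 :=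
  softPosDeriv_le_one hσ _

theorem profile_regDist_le (ha : 0 ≤ a) (hn : 1 ≤ n) (hε : 0 < ε) (hq : 0 ≤ q) {q' : ℝ}
    (h : q ≤ q') :
    profile n a (regDist ε q') ≤ profile n a (regDist ε q) :=
  profile_le ha (regDist_pos (by have : 0 < ε ^ 2 := by positivity
                                 linarith)) hn (regDist_le_regDist h)

theorem kernelWeight_eq_zero (ha : 0 ≤ a) (hn : 1 ≤ n) (hε : 0 < ε) (h : R ^ 2 ≤ q) :
    kernelWeight n a ε σ R q = 0 :=
  softPosDeriv_of_nonpos (sub_nonpos.2 (profile_regDist_le ha hn hε (sq_nonneg R) h))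

theorem kernel_eq_zero (hσ : 0 < σ) (ha : 0 ≤ a) (hn : 1 ≤ n) (hε : 0 < ε) (h : R ^ 2 ≤ q) :
    kernel n a ε σ R q = 0 :=
  softPos_of_nonpos hσ (sub_nonpos.2 (profile_regDist_le ha hn hε (sq_nonneg R) h))

theorem kernelDeriv_nonpos (ha : 0 ≤ a) (hn : 1 ≤ n) (hq : -ε ^ 2 < q) :
    kernelDeriv n a ε σ R q ≤ 0 := by
  have hw := regDist_pos hq
  exact mul_nonpos_of_nonneg_of_nonpos (kernelWeight_nonneg _)
    (div_nonpos_of_nonpos_of_nonneg (profileDeriv_nonpos ha hw hn) (by positivity))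

theorem kernel_le (hσ : 0 < σ) (ha : 0 ≤ a) (hn : 1 ≤ n) (hε : 0 < ε) (hq : 0 ≤ q) (hqR : q ≤ R ^ 2)
    (haw : a * regDist ε q ≤ 1) :
    kernel n a ε σ R q ≤ kernelWeight n a ε σ R q * (2 / regDist ε q ^ n) := by
  have hq' : -ε ^ 2 < q := by have : 0 < ε ^ 2 := by positivity
                              linarith
  have hR' : -ε ^ 2 < R ^ 2 := by have : 0 < ε ^ 2 := by positivity
                                  linarith
  have hw := regDist_pos hq'
  have hwR := regDist_pos hR'
  have h0 : 0 ≤ profile n a (regDist ε (R ^ 2)) := by unfold profile; positivity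
  have h1 : profile n a (regDist ε q) ≤ 2 / regDist ε q ^ n := by
    unfold profile
    gcongr
    linarith
  refine (softPos_le hσ (sub_nonneg.2 (profile_regDist_le ha hn hε hq hqR))).trans ?_
  rw [mul_comm]
  exact mul_le_mul_of_nonneg_left (by linarith) (kernelWeight_nonneg _)

theorem neg_kernelDeriv_le (hn : 1 ≤ n) (hq : -ε ^ 2 < q)
    (haw : a * regDist ε q ≤ 1) :
    -kernelDeriv n a ε σ R q ≤ kernelWeight n a ε σ R q * (n / regDist ε q ^ (n + 2)) := by
  have hw := regDist_pos hq
  have h1 : (1 : ℝ) ≤ n := by exact_mod_cast hn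
  rw [kernelDeriv, ← mul_neg]
  refine mul_le_mul_of_nonneg_left ?_ (kernelWeight_nonneg _)
  set w := regDist ε q
  rw [profileDeriv, neg_div, neg_neg, div_div, show w ^ (n + 1) * (2 * w) = 2 * w ^ (n + 2) by ring,
    div_le_div_iff₀ (by positivity) (by positivity)]
  have h2 : a * (n - 1) * w ≤ n := by
    have : a * w * (n - 1) ≤ 1 * (n - 1) := by
      have : 0 ≤ (n : ℝ) - 1 := by linarith
      gcongr
    linarith
  have h3 : 0 < w ^ (n + 2) := by positivity
  nlinarith

/-- A lower bound for the divergence of `y ↦ kernel (|y|²) y` along an `n`-plane containing `y`. -/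
theorem le_kernel_divergence (hσ : 0 < σ) (ha : 0 ≤ a) (hn : 1 ≤ n) (hε : 0 < ε) (hq : 0 ≤ q)
    (hqR : q ≤ R ^ 2) :
    kernelWeight n a ε σ R q *
        (n * ε ^ 2 / regDist ε q ^ (n + 2) + a * (regDist ε q / regDist ε q ^ n)) -
        n * (σ + profile n a (regDist ε (R ^ 2))) ≤
      n * kernel n a ε σ R q + 2 * q * kernelDeriv n a ε σ R q := by
  have hR' : -ε ^ 2 < R ^ 2 := by have : 0 < ε ^ 2 := by positivity
                                  nlinarith [sq_nonneg R]
  have hwR := regDist_pos hR'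
  have hc : 0 ≤ profile n a (regDist ε (R ^ 2)) := by unfold profile; positivity
  have h1 := le_profile_divergence ha hn hq hε
  have h2 : 2 * q * kernelDeriv n a ε σ R q =
      kernelWeight n a ε σ R q * (q * (profileDeriv n a (regDist ε q) / regDist ε q)) := by
    rw [kernelDeriv]
    ring
  have h3 := le_softPos hσ (sub_nonneg.2 (profile_regDist_le ha hn hε hq hqR))
  have h4 := mul_le_mul_of_nonneg_left h1 (kernelWeight_nonneg (n := n) (a := a) (ε := ε) (σ := σ)
      (R := R) q)
  have h5 := kernelWeight_le_one (n := n) (a := a) (ε := ε) (R := R) hσ q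
  have h6 := kernelWeight_nonneg (n := n) (a := a) (ε := ε) (σ := σ) (R := R) q
  rw [h2]
  change _ * kernelWeight n a ε σ R q - _ ≤ kernel n a ε σ R q at h3
  have h7 : (n : ℝ) * ((profile n a (regDist ε q) - profile n a (regDist ε (R ^ 2))) *
      kernelWeight n a ε σ R q - σ) ≤ n * kernel n a ε σ R q := by gcongr
  have h8 : (n : ℝ) * (kernelWeight n a ε σ R q * profile n a (regDist ε (R ^ 2))) ≤
      n * (1 * profile n a (regDist ε (R ^ 2))) := by gcongr
  linarith

theorem hasDerivAt_potential (hσ : 0 < σ) (hε : 0 < ε) (hq : -ε ^ 2 < q) :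
    HasDerivAt (potential n a ε σ R) (-(kernel n a ε σ R q / 2)) q := by
  have hR' : -ε ^ 2 < R ^ 2 := by have : 0 < ε ^ 2 := by positivity
                                  nlinarith [sq_nonneg R]
  have hsub : uIcc q (R ^ 2) ⊆ Ioi (-ε ^ 2) := fun t ht => lt_of_lt_of_le (lt_min hq hR') ht.1
  have hint : IntervalIntegrable (kernel n a ε σ R) volume q (R ^ 2) :=
    ((continuousOn_kernel hσ).mono hsub).intervalIntegrable
  have h1 := intervalIntegral.integral_hasDerivAt_left hint
    ((continuousOn_kernel hσ).stronglyMeasurableAtFilter isOpen_Ioi q hq)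
    (hasDerivAt_kernel hσ hq).continuousAt
  exact (h1.const_mul (1 / 2)).congr_deriv (by ring)

theorem potential_eq_zero (hσ : 0 < σ) (ha : 0 ≤ a) (hn : 1 ≤ n) (hε : 0 < ε) (h : R ^ 2 ≤ q) :
    potential n a ε σ R q = 0 := by
  rw [potential, intervalIntegral.integral_congr (g := fun _ => 0)]
  · simp
  · intro t ht
    rw [uIcc_of_ge h] at ht
    exact kernel_eq_zero hσ ha hn hε ht.1

theorem potential_nonneg (hσ : 0 < σ) (ha : 0 ≤ a) (hn : 1 ≤ n) (hε : 0 < ε) (q : ℝ) :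
    0 ≤ potential n a ε σ R q := by
  rcases le_total (R ^ 2) q with h | h
  · rw [potential_eq_zero hσ ha hn hε h]
  · exact mul_nonneg (by norm_num) (intervalIntegral.integral_nonneg h fun t _ => kernel_nonneg t)

/-- Near the centre the potential behaves like `w²⁻ⁿ` up to a factor `R / w`; this cruder bound
avoids a case distinction for `n ≤ 2`. -/
theorem potential_le (hσ : 0 < σ) (ha : 0 ≤ a) (hn : 1 ≤ n) (hε : 0 < ε) (hq : 0 ≤ q)
    (hqR : q ≤ R ^ 2) (haw : a * regDist ε (R ^ 2) ≤ 1) :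
    potential n a ε σ R q ≤ 2 * regDist ε (R ^ 2) * (regDist ε q / regDist ε q ^ n) := by
  have hε2 : 0 < ε ^ 2 := by positivity
  have hq' : -ε ^ 2 < q := by linarith
  have hsub : uIcc q (R ^ 2) ⊆ Ioi (-ε ^ 2) := fun t ht => by
    rw [uIcc_of_le hqR] at ht
    exact lt_of_lt_of_le hq' ht.1
  have hw := regDist_pos hq'
  obtain ⟨m, rfl⟩ := Nat.exists_eq_add_of_le' hn
  set w := regDist ε q with hwdef
  -- the kernel is bounded by a multiple of the derivative of the regularised distance
  have hb : ∀ t ∈ Icc q (R ^ 2), kernel (m + 1) a ε σ R t ≤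
      4 * (w / w ^ (m + 1)) * (1 / (2 * regDist ε t)) := by
    intro t ht
    have ht0 := hq.trans ht.1
    have hwt : w ≤ regDist ε t := regDist_le_regDist ht.1
    have hwt0 := hw.trans_le hwt
    have h1 := kernel_le hσ ha hn hε ht0 ht.2
      ((mul_le_mul_of_nonneg_left (regDist_le_regDist ht.2) ha).trans haw)
    refine h1.trans ?_
    have h2 : kernelWeight (m + 1) a ε σ R t * (2 / regDist ε t ^ (m + 1)) ≤
        1 * (2 / regDist ε t ^ (m + 1)) := by
      have := kernelWeight_le_one (n := m + 1) (a := a) (ε := ε) (R := R) hσ t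
      gcongr
    refine h2.trans ?_
    have h3 : 4 * (w / w ^ (m + 1)) * (1 / (2 * regDist ε t)) = 2 / (w ^ m * regDist ε t) := by
      field_simp
      ring
    rw [h3, one_mul, pow_succ]
    gcongr
  have hcont : ContinuousOn (fun t => 4 * (w / w ^ (m + 1)) * (1 / (2 * regDist ε t)))
      (uIcc q (R ^ 2)) := by
    have hr : ContinuousOn (regDist ε) (uIcc q (R ^ 2)) := fun q hq =>
      (hasDerivAt_regDist (hsub hq)).continuousAt.continuousWithinAt
    refine continuousOn_const.mul (continuousOn_const.div (continuousOn_const.mul hr)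
        fun t ht => ?_)
    exact mul_ne_zero two_ne_zero (regDist_pos (hsub ht)).ne'
  have h1 : ∫ t in q..R ^ 2, kernel (m + 1) a ε σ R t ≤
      ∫ t in q..R ^ 2, 4 * (w / w ^ (m + 1)) * (1 / (2 * regDist ε t)) :=
    intervalIntegral.integral_mono_on hqR ((continuousOn_kernel hσ).mono hsub).intervalIntegrable
      hcont.intervalIntegrable hb
  have h2 : ∫ t in q..R ^ 2, 4 * (w / w ^ (m + 1)) * (1 / (2 * regDist ε t)) =
      4 * (w / w ^ (m + 1)) * regDist ε (R ^ 2) - 4 * (w / w ^ (m + 1)) * w :=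
    intervalIntegral.integral_eq_sub_of_hasDerivAt
      (fun t ht => (hasDerivAt_regDist (hsub ht)).const_mul _) hcont.intervalIntegrable
  have h3 : 0 ≤ 4 * (w / w ^ (m + 1)) * w := by positivity
  rw [potential]
  linarith

end kernel

end BoundaryRigidity

/-! ### Pointwise lower bound for the divergence of the test field -/

namespace BoundaryRigidity

open C1Metric

variable {n : ℕ}

section forms

variable {B G : Space n →L[ℝ] Space n →L[ℝ] ℝ} {η : ℝ}

theorem abs_sub_inner_le (hB : ‖B - euclideanForm n‖ ≤ η) (v w : Space n) :
    |B v w - inner ℝ v w| ≤ η * ‖v‖ * ‖w‖ := by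
  refine ((B - euclideanForm n).le_opNorm₂ v w).trans ?_
  gcongr

theorem abs_form_le (hB : ‖B - euclideanForm n‖ ≤ η) (hη : η ≤ 1 / 4) (v w : Space n) :
    |B v w| ≤ 2 * ‖v‖ * ‖w‖ := by
  have h1 := abs_sub_inner_le hB v w
  have h2 := abs_real_inner_le_norm v w
  have h3 : |B v w| ≤ |B v w - inner ℝ v w| + |inner ℝ v w| := by
    simpa using abs_add_le (B v w - inner ℝ v w) (inner ℝ v w)
  have h4 : η * ‖v‖ * ‖w‖ ≤ 1 / 4 * ‖v‖ * ‖w‖ := by gcongr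
  have h5 : 0 ≤ ‖v‖ * ‖w‖ := by positivity
  linarith

theorem le_form_self (hB : ‖B - euclideanForm n‖ ≤ η) (v : Space n) :
    (1 - η) * ‖v‖ ^ 2 ≤ B v v := by
  have h1 := abs_le.1 (abs_sub_inner_le hB v v)
  rw [real_inner_self_eq_norm_sq] at h1
  nlinarith [h1.1]

theorem form_self_le (hB : ‖B - euclideanForm n‖ ≤ η) (v : Space n) :
    B v v ≤ (1 + η) * ‖v‖ ^ 2 := by
  have h1 := abs_le.1 (abs_sub_inner_le hB v v)
  rw [real_inner_self_eq_norm_sq] at h1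
  nlinarith [h1.2]

theorem abs_sub_form_le {ρ : ℝ} (h : ‖B - G‖ ≤ ρ) (v w : Space n) :
    |B v w - G v w| ≤ ρ * ‖v‖ * ‖w‖ := by
  refine ((B - G).le_opNorm₂ v w).trans ?_
  gcongr

variable {e : Fin n → Space n} {y ξ : Space n}

/-- If `B = G` this is Bessel's inequality for the orthonormal basis `e`; the error accounts for the
variation of the metric over the distance `‖y‖`. -/
theorem sum_radial_le (hB : ‖B - euclideanForm n‖ ≤ η) (hη : η ≤ 1 / 4)
    (hn : 1 ≤ n) (he : ∀ i, ‖e i‖ ≤ 3 / 2) (hh : ‖B - G‖ ≤ η * ‖y‖)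
    (hbessel : ∑ i, B (e i) y ^ 2 ≤ B y y) (hsymm : ∀ v w, B v w = B w v) :
    ∑ i, G y (e i) * B y (e i) ≤ G y y + 6 * n * η * ‖y‖ ^ 3 := by
  have hη0 : 0 ≤ η := (norm_nonneg _).trans hB
  have h1 : ∀ i, G y (e i) * B y (e i) ≤ B (e i) y ^ 2 + 9 / 2 * η * ‖y‖ ^ 3 := by
    intro i
    have h2 := abs_sub_form_le hh y (e i)
    have h3 := abs_form_le hB hη y (e i)
    have h4 : |(B y (e i) - G y (e i)) * B y (e i)| ≤ (η * ‖y‖ * ‖y‖ * (3 / 2)) *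
        (2 * ‖y‖ * (3 / 2)) := by
      rw [abs_mul]
      have := he i
      exact mul_le_mul (h2.trans (by gcongr)) (h3.trans (by gcongr)) (abs_nonneg _) (by positivity)
    have h5 := (abs_le.1 h4).1
    rw [hsymm (e i) y]
    nlinarith
  have h6 := abs_sub_form_le hh y y
  have h7 : (1 : ℝ) ≤ n := by exact_mod_cast hn
  calc ∑ i, G y (e i) * B y (e i) ≤ ∑ i, (B (e i) y ^ 2 + 9 / 2 * η * ‖y‖ ^ 3) :=
        Finset.sum_le_sum fun i _ => h1 i
    _ = ∑ i, B (e i) y ^ 2 + n * (9 / 2 * η * ‖y‖ ^ 3) := by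
        simp [Finset.sum_add_distrib]
    _ ≤ B y y + n * (9 / 2 * η * ‖y‖ ^ 3) := by gcongr
    _ ≤ G y y + 6 * n * η * ‖y‖ ^ 3 := by
        have h8 := (abs_le.1 h6).2
        have h9 : 0 ≤ η * ‖y‖ ^ 3 := by positivity
        nlinarith

/-- The mixed terms cancel for `B = G`: this is why the correction along `ξ` is added to the test
field. -/
theorem abs_sum_mixed_le (hB : ‖B - euclideanForm n‖ ≤ η) (hη : η ≤ 1 / 4)
    (he : ∀ i, ‖e i‖ ≤ 3 / 2) (hh : ‖B - G‖ ≤ η * ‖y‖) :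
    |∑ i, (G ξ (e i) * B y (e i) - G y (e i) * B ξ (e i))| ≤ 9 * n * η * ‖y‖ ^ 2 * ‖ξ‖ := by
  have hη0 : 0 ≤ η := (norm_nonneg _).trans hB
  have h1 : ∀ i, |G ξ (e i) * B y (e i) - G y (e i) * B ξ (e i)| ≤ 9 * η * ‖y‖ ^ 2 * ‖ξ‖ := by
    intro i
    have h2 := abs_sub_form_le hh y (e i)
    have h2' := abs_sub_form_le hh ξ (e i)
    have h3 := abs_form_le hB hη y (e i)
    have h3' := abs_form_le hB hη ξ (e i)
    have hei := he i
    have h4 : |(B y (e i) - G y (e i)) * B ξ (e i)| ≤ (η * ‖y‖ * ‖y‖ * (3 / 2)) *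
        (2 * ‖ξ‖ * (3 / 2)) := by
      rw [abs_mul]
      exact mul_le_mul (h2.trans (by gcongr)) (h3'.trans (by gcongr)) (abs_nonneg _) (by positivity)
    have h5 : |(B ξ (e i) - G ξ (e i)) * B y (e i)| ≤ (η * ‖y‖ * ‖ξ‖ * (3 / 2)) *
        (2 * ‖y‖ * (3 / 2)) := by
      rw [abs_mul]
      exact mul_le_mul (h2'.trans (by gcongr)) (h3.trans (by gcongr)) (abs_nonneg _) (by positivity)
    have h6 : G ξ (e i) * B y (e i) - G y (e i) * B ξ (e i) =
      (B y (e i) - G y (e i)) * B ξ (e i) - (B ξ (e i) - G ξ (e i)) * B y (e i) := by ring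
    rw [h6]
    refine (abs_sub _ _).trans ((add_le_add h4 h5).trans_eq ?_)
    ring
  refine (Finset.abs_sum_le_sum_abs _ _).trans ((Finset.sum_le_sum fun i _ => h1 i).trans_eq ?_)
  simp
  ring

/-- For `B = G` the contribution of `ξ` is the squared tangential gradient of the height. -/
theorem abs_sum_axial_le (hB : ‖B - euclideanForm n‖ ≤ η) (hG : ‖G - euclideanForm n‖ ≤ η)
    (hη : η ≤ 1 / 4) (he : ∀ i, ‖e i‖ ≤ 3 / 2) (hh : ‖B - G‖ ≤ η * ‖y‖) :
    |∑ i, G ξ (e i) * B ξ (e i) - ∑ i, G ξ (e i) ^ 2| ≤ 9 / 2 * n * η * ‖y‖ * ‖ξ‖ ^ 2 := by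
  have hη0 : 0 ≤ η := (norm_nonneg _).trans hB
  rw [← Finset.sum_sub_distrib]
  have h1 : ∀ i, |G ξ (e i) * B ξ (e i) - G ξ (e i) ^ 2| ≤ 9 / 2 * η * ‖y‖ * ‖ξ‖ ^ 2 := by
    intro i
    have h2 := abs_sub_form_le hh ξ (e i)
    have h3 := abs_form_le hG hη ξ (e i)
    have hei := he i
    have h4 : |(B ξ (e i) - G ξ (e i)) * G ξ (e i)| ≤ (η * ‖y‖ * ‖ξ‖ * (3 / 2)) *
        (2 * ‖ξ‖ * (3 / 2)) := by
      rw [abs_mul]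
      exact mul_le_mul (h2.trans (by gcongr)) (h3.trans (by gcongr)) (abs_nonneg _) (by positivity)
    have h6 : G ξ (e i) * B ξ (e i) - G ξ (e i) ^ 2 = (B ξ (e i) - G ξ (e i)) * G ξ (e i) := by ring
    rw [h6]
    exact h4.trans_eq (by ring)
  refine (Finset.abs_sum_le_sum_abs _ _).trans ((Finset.sum_le_sum fun i _ => h1 i).trans_eq ?_)
  simp
  ring

end forms

theorem wallProj_apply_zero (v : Space n) : (wallProj n v) 0 = 0 := by
  have : wallProj n v ∈ LinearMap.ker (EuclideanSpace.proj (𝕜 := ℝ) (0 : Fin (n + 1)) :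
      Space n →L[ℝ] ℝ).toLinearMap := Submodule.starProjection_apply_mem _ _
  simpa using this

/-- Vectors of a plane are almost horizontal if the plane is. -/
theorem abs_apply_zero_le_tilt (S : Gr n) {v : Space n} (hv : v ∈ S.1) :
    |v 0| ≤ ‖S.proj - wallProj n‖ * ‖v‖ := by
  have h1 : v 0 = ((S.proj - wallProj n) v) 0 := by
    rw [FunLike.coe_sub, Pi.sub_apply, S.proj_eq_self hv]
    change _ = v 0 - (wallProj n v) 0
    rw [wallProj_apply_zero, sub_zero]
  rw [h1]
  exact (PiLp.norm_apply_le _ _).trans ((S.proj - wallProj n).le_opNorm v)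

set_option maxHeartbeats 1000000 in
/-- The pointwise lower bound for the tangential divergence of a field `f κ y + Φ ψ₁ ξ` with radial
kernels `κ` and `Φ`, whose derivative is as in `hZ'`. The term `2 * η * ‖Z x‖` makes room for the
mean curvature. -/
theorem le_sum_divForm {U : Opens (Space n)} {g : C1Metric U} {x : Space n} (hx : x ∈ U)
    {S : Gr n} {e : Fin n → Space n} (he : IsOrthonormalBasisAt g x S e) (hn : 1 ≤ n)
    {G : Space n →L[ℝ] Space n →L[ℝ] ℝ} {η : ℝ} (hη : η ≤ 1 / 4)
    (hB : ‖g.toFun x - euclideanForm n‖ ≤ η) (hG : ‖G - euclideanForm n‖ ≤ η)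
    (hDg : ‖fderiv ℝ g.toFun x‖ ≤ η) {y ξ : Space n} (hh : ‖g.toFun x - G‖ ≤ η * ‖y‖)
    {d : ℝ} (hd : 0 < d) (hξ : ∀ v, G ξ v = -(v 0) / d)
    {Z : Space n → Space n} {f κ κ' Φ ψ₁ ψ₂ : ℝ}
    (hf : 0 ≤ f) (hκ : 0 ≤ κ) (hκ' : κ' ≤ 0) (hΦ : 0 ≤ Φ)
    (hZ : Z x = (f * κ) • y + (Φ * ψ₁) • ξ)
    (hZ' : ∀ v, fderiv ℝ Z x v = (κ * ψ₁ * G ξ v + 2 * f * κ' * G y v) • y + (f * κ) • v +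
      (Φ * ψ₂ * G ξ v - κ * ψ₁ * G y v) • ξ) :
    f * (n * κ + 2 * G y y * κ') - 20 * n * η * (f * (κ * ‖y‖ - κ' * ‖y‖ ^ 3) +
        (κ * |ψ₁| * ‖y‖ ^ 2 / d + Φ * |ψ₂| * ‖y‖ / d ^ 2 + Φ * |ψ₁| / d)) -
        Φ * max (-ψ₂) 0 * (3 * n * ‖S.proj - wallProj n‖ ^ 2 / d ^ 2) ≤
      ∑ i, g.divForm Z x (e i) (e i) - 2 * η * ‖Z x‖ := by
  have hη0 : 0 ≤ η := (norm_nonneg _).trans hB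
  have hn' : (1 : ℝ) ≤ n := by exact_mod_cast hn
  set B := g.toFun x with hBdef
  have hei : ∀ i, ‖e i‖ ≤ 3 / 2 := fun i => by
    have := he.norm_le (c₀ := 2 / 3) (by norm_num) (fun v => by
      have := le_form_self hB v
      nlinarith [sq_nonneg ‖v‖]) i
    norm_num at this
    linarith
  -- `ξ` is the gradient of the height, which has slope `1 / d`
  have hξn : ‖ξ‖ ≤ 2 / d := by
    have h1 := le_form_self hG ξ
    rw [hξ] at h1
    have h2 : |ξ 0| ≤ ‖ξ‖ := by
      rw [← Real.norm_eq_abs]; exact PiLp.norm_apply_le ξ 0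
    have h3 : -(ξ 0) / d ≤ ‖ξ‖ / d := by
      gcongr
      exact (neg_le_abs _).trans h2
    rcases (norm_nonneg ξ).eq_or_lt with h0 | h0
    · rw [← h0]; positivity
    · have h4 : ‖ξ‖ * (3 / 4 * ‖ξ‖) ≤ ‖ξ‖ * (1 / d) := by
        rw [mul_one_div]
        nlinarith
      have h5 := le_of_mul_le_mul_left h4 h0
      have h6 : 2 / d = 2 * (1 / d) := by ring
      have h7 : 0 < 1 / d := by positivity
      linarith
  have A1 := sum_radial_le hB hη hn hei hh (he.sum_sq_le hx y) (g.symm x hx)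
  have A2 := abs_sum_mixed_le (ξ := ξ) hB hη hei hh
  have A3 := abs_sum_axial_le (ξ := ξ) hB hG hη hei hh
  have A5 : ∑ i, G ξ (e i) ^ 2 ≤ 3 * n * ‖S.proj - wallProj n‖ ^ 2 / d ^ 2 := by
    have : ∀ i, G ξ (e i) ^ 2 ≤ 3 * ‖S.proj - wallProj n‖ ^ 2 / d ^ 2 := fun i => by
      rw [hξ, div_pow, neg_sq]
      gcongr
      have h1 := abs_apply_zero_le_tilt S (he.1 i)
      rw [← sq_abs]
      calc |(e i) 0| ^ 2 ≤ (‖S.proj - wallProj n‖ * (3 / 2)) ^ 2 := by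
            have := hei i
            gcongr
            exact h1.trans (by gcongr)
        _ ≤ _ := by nlinarith [sq_nonneg ‖S.proj - wallProj n‖]
    refine (Finset.sum_le_sum fun i _ => this i).trans_eq ?_
    simp
    ring
  have hZn : ‖Z x‖ ≤ f * κ * ‖y‖ + Φ * |ψ₁| * (2 / d) := by
    rw [hZ]
    refine (norm_add_le _ _).trans ?_
    rw [norm_smul, norm_smul, Real.norm_eq_abs, Real.norm_eq_abs, abs_of_nonneg (by positivity),
      abs_mul, abs_of_nonneg hΦ]
    gcongr
  -- expansion of the divergence
  have hexp : ∑ i, g.divForm Z x (e i) (e i) =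
      2 * f * κ' * ∑ i, G y (e i) * B y (e i) + n * (f * κ) +
      κ * ψ₁ * ∑ i, (G ξ (e i) * B y (e i) - G y (e i) * B ξ (e i)) +
      Φ * ψ₂ * ∑ i, G ξ (e i) * B ξ (e i) +
      ∑ i, 1 / 2 * fderiv ℝ g.toFun x (Z x) (e i) (e i) := by
    have : (n : ℝ) * (f * κ) = ∑ i : Fin n, f * κ * B (e i) (e i) := by
      simp [he.2, hBdef]
    rw [this]
    simp only [Finset.mul_sum, ← Finset.sum_add_distrib]
    refine Finset.sum_congr rfl fun i _ => ?_
    have : g.divForm Z x (e i) (e i) = B (fderiv ℝ Z x (e i)) (e i) +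
      1 / 2 * fderiv ℝ g.toFun x (Z x) (e i) (e i) := rfl
    rw [this, hZ']
    simp only [map_add, map_smul, FunLike.coe_add, FunLike.coe_smul, Pi.add_apply, Pi.smul_apply,
      smul_eq_mul]
    ring
  have A4 : |∑ i, 1 / 2 * fderiv ℝ g.toFun x (Z x) (e i) (e i)| ≤ 2 * n * η * ‖Z x‖ := by
    have : ∀ i, |1 / 2 * fderiv ℝ g.toFun x (Z x) (e i) (e i)| ≤ 2 * η * ‖Z x‖ := fun i => by
      have h1 : |fderiv ℝ g.toFun x (Z x) (e i) (e i)| ≤ (η * ‖Z x‖) * (3 / 2) * (3 / 2) := by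
        refine ((fderiv ℝ g.toFun x (Z x)).le_opNorm₂ (e i) (e i)).trans ?_
        have h2 := (fderiv ℝ g.toFun x).le_opNorm (Z x)
        have := hei i
        have h3 : ‖fderiv ℝ g.toFun x (Z x)‖ ≤ η * ‖Z x‖ := h2.trans (by gcongr)
        gcongr
      rw [abs_mul, abs_of_pos (by norm_num : (0 : ℝ) < 1 / 2)]
      have : 0 ≤ η * ‖Z x‖ := by positivity
      nlinarith
    refine (Finset.abs_sum_le_sum_abs _ _).trans ((Finset.sum_le_sum fun i _ => this i).trans_eq ?_)
    simp
    ring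
  have B1 : 2 * f * κ' * (G y y + 6 * n * η * ‖y‖ ^ 3) ≤ 2 * f * κ' * ∑ i, G y (e i) * B y (e i) :=
    mul_le_mul_of_nonpos_left A1 (mul_nonpos_of_nonneg_of_nonpos (by positivity) hκ')
  have B2 : -(κ * |ψ₁| * (9 * n * η * ‖y‖ ^ 2 * (2 / d))) ≤
      κ * ψ₁ * ∑ i, (G ξ (e i) * B y (e i) - G y (e i) * B ξ (e i)) := by
    refine neg_le_of_abs_le ?_
    rw [abs_mul, abs_mul, abs_of_nonneg hκ]
    have : 9 * n * η * ‖y‖ ^ 2 * ‖ξ‖ ≤ 9 * n * η * ‖y‖ ^ 2 * (2 / d) := by gcongr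
    exact mul_le_mul_of_nonneg_left (A2.trans this) (by positivity)
  have B3 : -(Φ * |ψ₂| * (9 / 2 * n * η * ‖y‖ * (2 / d) ^ 2)) -
      Φ * max (-ψ₂) 0 * (3 * n * ‖S.proj - wallProj n‖ ^ 2 / d ^ 2) ≤
      Φ * ψ₂ * ∑ i, G ξ (e i) * B ξ (e i) := by
    have h1 : 9 / 2 * n * η * ‖y‖ * ‖ξ‖ ^ 2 ≤ 9 / 2 * n * η * ‖y‖ * (2 / d) ^ 2 := by gcongr
    have h2 : |ψ₂ * (∑ i, G ξ (e i) * B ξ (e i) - ∑ i, G ξ (e i) ^ 2)| ≤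
        |ψ₂| * (9 / 2 * n * η * ‖y‖ * (2 / d) ^ 2) := by
      rw [abs_mul]
      exact mul_le_mul_of_nonneg_left (A3.trans h1) (abs_nonneg _)
    have h3 : -(max (-ψ₂) 0 * (3 * n * ‖S.proj - wallProj n‖ ^ 2 / d ^ 2)) ≤
        ψ₂ * ∑ i, G ξ (e i) ^ 2 := by
      have h4 : max (-ψ₂) 0 * ∑ i, G ξ (e i) ^ 2 ≤
        max (-ψ₂) 0 * (3 * n * ‖S.proj - wallProj n‖ ^ 2 / d ^ 2) :=
        mul_le_mul_of_nonneg_left A5 (le_max_right _ _)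
      have h5 : -ψ₂ * ∑ i, G ξ (e i) ^ 2 ≤ max (-ψ₂) 0 * ∑ i, G ξ (e i) ^ 2 :=
        mul_le_mul_of_nonneg_right (le_max_left _ _) (Finset.sum_nonneg fun i _ => sq_nonneg _)
      linarith
    have h6 := neg_le_of_abs_le h2
    have h7 : -(|ψ₂| * (9 / 2 * n * η * ‖y‖ * (2 / d) ^ 2)) -
      max (-ψ₂) 0 * (3 * n * ‖S.proj - wallProj n‖ ^ 2 / d ^ 2) ≤
      ψ₂ * ∑ i, G ξ (e i) * B ξ (e i) := by linarith
    have := mul_le_mul_of_nonneg_left h7 hΦ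
    linarith
  have B4 := neg_le_of_abs_le A4
  have B5 : 2 * n * η * ‖Z x‖ + 2 * η * ‖Z x‖ ≤
      4 * n * η * (f * κ * ‖y‖ + Φ * |ψ₁| * (2 / d)) := by
    have h1 : 0 ≤ η * ‖Z x‖ := by positivity
    calc 2 * n * η * ‖Z x‖ + 2 * η * ‖Z x‖ ≤ 4 * n * η * ‖Z x‖ := by nlinarith
      _ ≤ _ := by gcongr
  have C1 : 0 ≤ n * η * f * (-κ') * ‖y‖ ^ 3 := by
    have : 0 ≤ -κ' := by linarith
    positivity
  have C2 : 0 ≤ n * η * f * κ * ‖y‖ := by positivity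
  have C3 : 0 ≤ n * η * (κ * |ψ₁| * ‖y‖ ^ 2 / d) := by positivity
  have C4 : 0 ≤ n * η * (Φ * |ψ₂| * ‖y‖ / d ^ 2) := by positivity
  have C5 : 0 ≤ n * η * (Φ * |ψ₁| / d) := by positivity
  have E2 : κ * |ψ₁| * (9 * n * η * ‖y‖ ^ 2 * (2 / d)) =
      18 * (n * η * (κ * |ψ₁| * ‖y‖ ^ 2 / d)) := by
    ring
  have E3 : Φ * |ψ₂| * (9 / 2 * n * η * ‖y‖ * (2 / d) ^ 2) =
      18 * (n * η * (Φ * |ψ₂| * ‖y‖ / d ^ 2)) := by ring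
  have E5 : 4 * n * η * (f * κ * ‖y‖ + Φ * |ψ₁| * (2 / d)) =
      4 * (n * η * f * κ * ‖y‖) + 8 * (n * η * (Φ * |ψ₁| / d)) := by ring
  rw [hexp]
  rw [E2] at B2
  rw [E3] at B3
  rw [E5] at B5
  linarith

end BoundaryRigidity

/-! ### Absorption of the error terms -/

namespace BoundaryRigidity

/-- The size, relative to the metric error `η`, of the coefficient `a` of the profile that is
needed to absorb the errors near the centre, where `M` bounds the derivatives of the height profile
by the profile itself. -/
noncomputable def absorbConst (n : ℕ) (K M : ℝ) : ℝ := 20 * n * (12 * n + (2 + 12 * K) * M)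

/-- The constant in front of the error terms away from the centre, where `M` bounds the derivatives
of the height profile. -/
noncomputable def farConst (n : ℕ) (K M : ℝ) : ℝ := 4 ^ n * (100 * n * M * K + 3 * n * K)

section scalar

variable {n : ℕ} {K M M' η a ε σ R d q r f ψ₁ ψ₂ τ b : ℝ}

theorem two_regDist_ge (hη : η ≤ 1 / 4) (hr : 0 ≤ r) (hqr : (1 - η) * r ^ 2 ≤ q)
    (hε : 0 < ε) : r ≤ 2 * regDist ε q := by
  have hq : 0 ≤ q := by nlinarith
  have h1 : -ε ^ 2 < q := by nlinarith
  have h2 := regDist_sq h1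
  have h3 := regDist_pos h1
  nlinarith [sq_nonneg r, sq_nonneg ε]

theorem regDist_le_two_mul (hR : 0 < R) (hε : 0 < ε) (hεR : ε ≤ R) (hqR : q ≤ R ^ 2) :
    regDist ε q ≤ 2 * R :=
  (Real.sqrt_le_left (by positivity)).2 (by nlinarith)

theorem div_pow_le_of_le {v w : ℝ} (hn : 1 ≤ n) (hv : 0 < v) (h : v ≤ w) :
    w / w ^ n ≤ v / v ^ n := by
  obtain ⟨m, rfl⟩ := Nat.exists_eq_add_of_le' hn
  have hw := hv.trans_le h
  have h1 : ∀ u : ℝ, 0 < u → u / u ^ (m + 1) = (u ^ m)⁻¹ := fun u hu => by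
    rw [pow_succ]; field_simp
  rw [h1 v hv, h1 w hw]
  gcongr

/-- The weight is at least `1 / 2` in the ball of radius `d / 2`, provided the kernel extends at
least to radius `2 d`. -/
theorem half_le_kernelWeight (hn : 1 ≤ n) (ha : 0 ≤ a) (ha' : a ≤ 1 / 2)
    (hd : 0 < d) (hdR : 2 * d ≤ R) (hR : R ≤ 1 / 4) (hε : 0 < ε) (hεd : ε ≤ d / 4)
    (hσ : 0 < σ) (hσ' : σ ≤ 1 / (4 * d ^ n)) (hη : η ≤ 1 / 4) (hr : 0 ≤ r) (hrd : r ≤ d / 2)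
    (hqr : q ≤ (1 + η) * r ^ 2) (hq : 0 ≤ q) : 1 / 2 ≤ kernelWeight n a ε σ R q := by
  have hR0 : 0 < R := by linarith
  have hq1 : -ε ^ 2 < q := by nlinarith
  have hq2 : -ε ^ 2 < R ^ 2 := by nlinarith
  have hw := regDist_pos hq1
  have hw2 := regDist_pos hq2
  refine half_le_softPosDeriv hσ ?_
  have h1 : regDist ε q ≤ d := (Real.sqrt_le_left hd.le).2 (by nlinarith)
  have h2 : R ≤ regDist ε (R ^ 2) := Real.le_sqrt_of_sq_le (by nlinarith)
  have h3 : profile n a (regDist ε (R ^ 2)) ≤ profile n a R := profile_le ha hR0 hn h2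
  have h4 : profile n a R ≤ (9 / 8) / (2 * d ^ n) := by
    unfold profile
    have h5 : 2 * d ^ n ≤ R ^ n := by
      calc 2 * d ^ n = 2 ^ 1 * d ^ n := by ring
        _ ≤ 2 ^ n * d ^ n := by gcongr; norm_num
        _ = (2 * d) ^ n := (mul_pow _ _ _).symm
        _ ≤ R ^ n := by gcongr
    have h6 : a * R ≤ 1 / 2 * (1 / 4) := by gcongr
    gcongr
    linarith
  have h5 : 1 / d ^ n ≤ profile n a (regDist ε q) := by
    unfold profile
    gcongr
    nlinarith
  have h6 : (9 / 8) / (2 * d ^ n) + 1 / (4 * d ^ n) = (13 / 16) * (1 / d ^ n) := by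
    field_simp
    norm_num
  have h7 : 0 < 1 / d ^ n := by positivity
  linarith

set_option maxHeartbeats 1000000 in
/-- The error terms of `le_sum_divForm` for the concrete kernels. In the ball of radius `d / 2` they
are absorbed by the gain `a w¹⁻ⁿ`, since `ψ₁` and `ψ₂` are bounded by `f` there; further out they
are at most `η` or `b * τ ^ 2` times a constant times `d ^ (-n)`. -/
theorem le_kernel_terms (hn : 1 ≤ n) (hK : 1 ≤ K) (hM : 0 ≤ M) (hM' : 0 ≤ M')
    (hη0 : 0 ≤ η) (hη : η ≤ 1 / 4) (ha : a = absorbConst n K M' * η) (ha' : a ≤ 1 / 2)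
    (hd : 0 < d) (hdR : 2 * d ≤ R) (hRK : R ≤ K * d) (hR : R ≤ 1 / 4)
    (hε : 0 < ε) (hεd : ε ≤ d / 4) (hσ : 0 < σ) (hσ' : σ ≤ 1 / (4 * d ^ n))
    (hr : 0 ≤ r) (hq : 0 ≤ q) (hqr : (1 - η) * r ^ 2 ≤ q) (hqr' : q ≤ (1 + η) * r ^ 2)
    (hqR : q ≤ R ^ 2) (hf : 0 ≤ f) (h₁ : |ψ₁| ≤ M) (h₂ : |ψ₂| ≤ M)
    (hnear : r ≤ d / 2 → |ψ₁| ≤ M' * f ∧ |ψ₂| ≤ M' * f ∧ 0 ≤ ψ₂) (hb : 0 ≤ b)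
    (h₂b : -ψ₂ ≤ b) :
    f * (kernelWeight n a ε σ R q * (n * ε ^ 2 / regDist ε q ^ (n + 2))) -
        n * (σ + profile n a (regDist ε (R ^ 2))) * f -
        farConst n K M / d ^ n * (η + b * τ ^ 2) ≤
      f * (n * kernel n a ε σ R q + 2 * q * kernelDeriv n a ε σ R q) -
        20 * n * η * (f * (kernel n a ε σ R q * r - kernelDeriv n a ε σ R q * r ^ 3) +
        (kernel n a ε σ R q * |ψ₁| * r ^ 2 / d + potential n a ε σ R q * |ψ₂| * r / d ^ 2 +
          potential n a ε σ R q * |ψ₁| / d)) -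
        potential n a ε σ R q * max (-ψ₂) 0 * (3 * n * τ ^ 2 / d ^ 2) := by
  have hn' : (1 : ℝ) ≤ n := by exact_mod_cast hn
  have ha0 : 0 ≤ a := by rw [ha, absorbConst]; positivity
  have hR0 : 0 < R := by linarith
  have hq1 : -ε ^ 2 < q := by nlinarith
  have hq2 : -ε ^ 2 < R ^ 2 := by nlinarith
  have hw := regDist_pos hq1
  have hrw := two_regDist_ge hη hr hqr hε
  have hw2 := regDist_le_two_mul hR0 hε (by linarith) hqR
  have hwR2 := regDist_le_two_mul hR0 hε (by linarith) (le_refl (R ^ 2))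
  have haw : a * regDist ε q ≤ 1 := by nlinarith
  have haw' : a * regDist ε (R ^ 2) ≤ 1 := by nlinarith
  have hdiv := le_kernel_divergence hσ ha0 hn hε hq hqR
  have hκ := kernel_le hσ ha0 hn hε hq hqR haw
  have hκ' := neg_kernelDeriv_le (σ := σ) (R := R) hn hq1 haw
  have hΦ := potential_le hσ ha0 hn hε hq hqR haw'
  have hκ0 := kernel_nonneg (n := n) (a := a) (ε := ε) (σ := σ) (R := R) q
  have hΦ0 := potential_nonneg (R := R) hσ ha0 hn hε q
  have hkw0 := kernelWeight_nonneg (n := n) (a := a) (ε := ε) (σ := σ) (R := R) q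
  have hkw1 := kernelWeight_le_one (n := n) (a := a) (ε := ε) (R := R) hσ q
  have hhalf : r ≤ d / 2 → 1 / 2 ≤ kernelWeight n a ε σ R q := fun h =>
    half_le_kernelWeight hn ha0 ha' hd hdR hR hε hεd hσ hσ' hη hr h hqr' hq
  have hwlow : d / 2 ≤ r → d / 4 ≤ regDist ε q := fun h =>
    Real.le_sqrt_of_sq_le (by nlinarith)
  set κ := kernel n a ε σ R q
  set κ' := kernelDeriv n a ε σ R q
  set Φ := potential n a ε σ R q
  set kw := kernelWeight n a ε σ R q
  set c := profile n a (regDist ε (R ^ 2))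
  set w := regDist ε q
  set T := w / w ^ n with hT
  have hT0 : 0 < T := by positivity
  -- the terms that are proportional to `f`
  have X1 : κ * r ≤ 4 * (kw * T) := by
    calc κ * r ≤ (kw * (2 / w ^ n)) * (2 * w) := by gcongr
      _ = 4 * (kw * T) := by rw [hT]; ring
  have X2 : -κ' * r ^ 3 ≤ 8 * n * (kw * T) := by
    calc -κ' * r ^ 3 ≤ (kw * (n / w ^ (n + 2))) * (2 * w) ^ 3 := by gcongr
      _ = 8 * n * (kw * T) := by
        rw [hT, pow_add]
        field_simp
        norm_num
  have X3 : f * (κ * r - κ' * r ^ 3) ≤ 12 * n * (f * (kw * T)) := by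
    have : κ * r - κ' * r ^ 3 ≤ 12 * n * (kw * T) := by
      have : 0 ≤ kw * T := by positivity
      nlinarith
    calc f * (κ * r - κ' * r ^ 3) ≤ f * (12 * n * (kw * T)) := by gcongr
      _ = _ := by ring
  have X4 := mul_le_mul_of_nonneg_left hdiv hf
  have X5 : Φ ≤ 4 * R * T := by
    refine hΦ.trans ?_
    calc 2 * regDist ε (R ^ 2) * T ≤ 2 * (2 * R) * T := by gcongr
      _ = 4 * R * T := by ring
  have hfk : 0 ≤ f * (kw * T) := by positivity
  have hfar0 : 0 ≤ farConst n K M := by rw [farConst]; positivity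
  rcases le_total r (d / 2) with hrd | hrd
  -- near the centre the weight is at least `1 / 2`, so that all errors are multiples of `f * kw * T`
  · obtain ⟨g1, g2, g3⟩ := hnear hrd
    have hk2 := hhalf hrd
    have hmax : max (-ψ₂) 0 = 0 := max_eq_right (by linarith)
    have Y1 : κ * |ψ₁| * r ^ 2 / d ≤ 2 * M' * (f * (kw * T)) := by
      have : r / d ≤ 1 / 2 := by rw [div_le_iff₀ hd]; linarith
      calc κ * |ψ₁| * r ^ 2 / d = (κ * r) * |ψ₁| * (r / d) := by ring
        _ ≤ (4 * (kw * T)) * (M' * f) * (1 / 2) := by gcongr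
        _ = _ := by ring
    have hRd : R / d ≤ K := by rwa [div_le_iff₀ hd]
    have Y2 : Φ * |ψ₂| * r / d ^ 2 ≤ 4 * K * M' * (f * (kw * T)) := by
      have : r / d ≤ 1 / 2 := by rw [div_le_iff₀ hd]; linarith
      calc Φ * |ψ₂| * r / d ^ 2 = Φ / d * |ψ₂| * (r / d) := by ring
        _ ≤ (4 * R * T) / d * (M' * f) * (1 / 2) := by gcongr
        _ = 2 * (R / d) * M' * (f * (1 * T)) := by ring
        _ ≤ 2 * K * M' * (f * (2 * kw * T)) := by gcongr; linarith
        _ = _ := by ring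
    have Y3 : Φ * |ψ₁| / d ≤ 8 * K * M' * (f * (kw * T)) := by
      calc Φ * |ψ₁| / d ≤ (4 * R * T) * (M' * f) / d := by gcongr
        _ = 4 * (R / d) * M' * (f * (1 * T)) := by ring
        _ ≤ 4 * K * M' * (f * (2 * kw * T)) := by gcongr; linarith
        _ = _ := by ring
    have Y4 : 20 * n * η * (f * (κ * r - κ' * r ^ 3) +
        (κ * |ψ₁| * r ^ 2 / d + Φ * |ψ₂| * r / d ^ 2 + Φ * |ψ₁| / d)) ≤ a * (f * (kw * T)) := by
      rw [ha, absorbConst]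
      calc _ ≤ 20 * n * η * (12 * n * (f * (kw * T)) + (2 * M' * (f * (kw * T)) +
            4 * K * M' * (f * (kw * T)) + 8 * K * M' * (f * (kw * T)))) := by gcongr
        _ = _ := by ring
    have Y5 : 0 ≤ farConst n K M / d ^ n * (η + b * τ ^ 2) := by positivity
    rw [hmax, mul_zero, zero_mul]
    have X4' : f * (kw * (n * ε ^ 2 / w ^ (n + 2) + a * T) - n * (σ + c)) =
      f * (kw * (n * ε ^ 2 / w ^ (n + 2))) + a * (f * (kw * T)) - n * (σ + c) * f := by ring
    rw [X4'] at X4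
    linarith
  -- away from the centre the kernels are bounded in terms of `d`
  · have hwd := hwlow hrd
    have hT1 : T ≤ d / 4 * (4 ^ n / d ^ n) := by
      refine (div_pow_le_of_le hn (by positivity) hwd).trans_eq ?_
      rw [div_pow]
      field_simp
    have hw1 : 2 / w ^ n ≤ 2 * (4 ^ n / d ^ n) := by
      calc 2 / w ^ n ≤ 2 / (d / 4) ^ n := by gcongr
        _ = _ := by rw [div_pow]; field_simp
    set D := (4 : ℝ) ^ n / d ^ n with hD
    have hD0 : 0 < D := by positivity
    have hr2 : r ≤ 2 * R := by nlinarith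
    have hRd : R / d ≤ K := by rwa [div_le_iff₀ hd]
    have hκ2 : κ ≤ 2 * D := by
      refine hκ.trans ((mul_le_mul hkw1 hw1 (by positivity) zero_le_one).trans_eq (one_mul _))
    have hΦ2 : Φ ≤ R * d * D := by
      refine X5.trans ?_
      calc 4 * R * T ≤ 4 * R * (d / 4 * D) := by gcongr
        _ = _ := by ring
    have Y1 : κ * |ψ₁| * r ^ 2 / d ≤ 2 * (M * K * D) := by
      calc κ * |ψ₁| * r ^ 2 / d ≤ (2 * D) * M * (2 * R) ^ 2 / d := by gcongr
        _ = 8 * D * M * (R / d) * R := by ring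
        _ ≤ 8 * D * M * K * (1 / 4) := by gcongr
        _ = _ := by ring
    have Y2 : Φ * |ψ₂| * r / d ^ 2 ≤ 1 / 2 * (M * K * D) := by
      calc Φ * |ψ₂| * r / d ^ 2 ≤ (R * d * D) * M * (2 * R) / d ^ 2 := by gcongr
        _ = 2 * D * M * (R / d) * R := by field_simp
        _ ≤ 2 * D * M * K * (1 / 4) := by gcongr
        _ = _ := by ring
    have Y3 : Φ * |ψ₁| / d ≤ 1 / 4 * (M * K * D) := by
      calc Φ * |ψ₁| / d ≤ (R * d * D) * M / d := by gcongr
        _ = D * M * 1 * R := by field_simp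
        _ ≤ D * M * K * (1 / 4) := by gcongr
        _ = _ := by ring
    have Y4 : Φ * max (-ψ₂) 0 * (3 * n * τ ^ 2 / d ^ 2) ≤ 3 * n * K * D * (b * τ ^ 2) := by
      have : max (-ψ₂) 0 ≤ b := max_le h₂b hb
      calc Φ * max (-ψ₂) 0 * (3 * n * τ ^ 2 / d ^ 2) ≤
          (R * d * D) * b * (3 * n * τ ^ 2 / d ^ 2) := by
            gcongr
        _ = 3 * n * (R / d) * D * (b * τ ^ 2) := by field_simp
        _ ≤ _ := by gcongr
    have Y5 : 20 * n * η * (f * (κ * r - κ' * r ^ 3) +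
        (κ * |ψ₁| * r ^ 2 / d + Φ * |ψ₂| * r / d ^ 2 + Φ * |ψ₁| / d)) ≤
        a * (f * (kw * T)) + 60 * n * M * K * D * η := by
      have h1 : 20 * n * (12 * n) * η * (f * (kw * T)) ≤ a * (f * (kw * T)) := by
        rw [ha, absorbConst]
        have : 0 ≤ 20 * n * ((2 + 12 * K) * M') * η * (f * (kw * T)) := by positivity
        nlinarith
      calc _ ≤ 20 * n * η * (12 * n * (f * (kw * T)) + (2 * (M * K * D) +
            1 / 2 * (M * K * D) + 1 / 4 * (M * K * D))) := by gcongr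
        _ = 20 * n * (12 * n) * η * (f * (kw * T)) + 55 * (n * M * K * D * η) := by ring
        _ ≤ _ := by
          have : 0 ≤ n * M * K * D * η := by positivity
          linarith
    have Y6 : farConst n K M / d ^ n * (η + b * τ ^ 2) =
        100 * (n * M * K * D * η) + 3 * (n * K * D * η) + 100 * (n * M * K * D * (b * τ ^ 2)) +
          3 * n * K * D * (b * τ ^ 2) := by
      rw [farConst, hD]
      ring
    have Y7 : 0 ≤ n * M * K * D * η := by positivity
    have Y8 : 0 ≤ n * K * D * η := by positivity
    have Y9 : 0 ≤ n * M * K * D * (b * τ ^ 2) := by positivity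
    have X4' : f * (kw * (n * ε ^ 2 / w ^ (n + 2) + a * T) - n * (σ + c)) =
      f * (kw * (n * ε ^ 2 / w ^ (n + 2))) + a * (f * (kw * T)) - n * (σ + c) * f := by ring
    rw [X4'] at X4
    rw [Y6]
    linarith

end scalar

end BoundaryRigidity

/-! ### The test field and almost minimal varifolds -/

namespace BoundaryRigidity

open C1Metric

variable {n : ℕ}

/-- The gradient of a linear form with respect to `B`. -/
theorem exists_form_eq {B : Space n →L[ℝ] Space n →L[ℝ] ℝ} (hB : ∀ v, v ≠ 0 → 0 < B v v)
    (φ : Space n →L[ℝ] ℝ) : ∃ ξ, ∀ v, B ξ v = φ v := by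
  have hinj : Function.Injective B.toLinearMap := by
    rw [injective_iff_map_eq_zero]
    intro a ha
    by_contra hne
    have h1 := hB a hne
    have h2 : B a = 0 := ha
    simp [h2] at h1
  have hdim : Module.finrank ℝ (Space n) = Module.finrank ℝ (Space n →L[ℝ] ℝ) :=
    ((InnerProductSpace.toDual ℝ (Space n)).toLinearEquiv).finrank_eq
  obtain ⟨ξ, hξ⟩ := (LinearMap.injective_iff_surjective_of_finrank_eq_finrank hdim).1 hinj φ
  exact ⟨ξ, fun v => congrArg (fun L : Space n →L[ℝ] ℝ => L v) hξ⟩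

theorem contDiffOn_one_of_hasDerivAt {f f' : ℝ → ℝ} {s : Set ℝ} (hs : IsOpen s)
    (hf : ∀ x ∈ s, HasDerivAt f (f' x) x) (hf' : ContinuousOn f' s) : ContDiffOn ℝ 1 f s := by
  rw [← zero_add (1 : WithTop ℕ∞), contDiffOn_succ_iff_deriv_of_isOpen hs]
  refine ⟨fun x hx => (hf x hx).differentiableAt.differentiableWithinAt, by simp, ?_⟩
  rw [contDiffOn_zero]
  exact hf'.congr fun x hx => (hf x hx).deriv

/-- The height above the wall in units of `d`. -/
noncomputable def height (d : ℝ) (x : Space n) : ℝ := -(x 0) / d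

theorem height_sub (d : ℝ) (x z : Space n) : height d x - height d z = -((x - z) 0) / d := by
  simp [height]
  ring

theorem hasFDerivAt_height (d : ℝ) (x : Space n) :
    HasFDerivAt (height d) ((-d⁻¹) • (EuclideanSpace.proj (0 : Fin (n + 1)) :
        Space n →L[ℝ] ℝ)) x := by
  have h := ((-d⁻¹) • (EuclideanSpace.proj (0 : Fin (n + 1)) : Space n →L[ℝ] ℝ)).hasFDerivAt
      (x := x)
  refine h.congr_of_eventuallyEq (Eventually.of_forall fun y => ?_)
  simp [height]
  ring

theorem contDiff_height (d : ℝ) {m : WithTop ℕ∞} : ContDiff ℝ m (height d : Space n → ℝ) := by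
  have h := ((-d⁻¹) • (EuclideanSpace.proj (0 : Fin (n + 1)) : Space n →L[ℝ] ℝ)).contDiff (n := m)
  convert! h using 1
  ext y
  simp [height]
  ring

/-- The squared distance to `z` in the norm of the bilinear form `B`. -/
noncomputable def sqDist (B : Space n →L[ℝ] Space n →L[ℝ] ℝ) (z x : Space n) : ℝ :=
  B (x - z) (x - z)

theorem contDiff_sqDist (B : Space n →L[ℝ] Space n →L[ℝ] ℝ) (z : Space n) {m : WithTop ℕ∞} :
    ContDiff ℝ m (sqDist B z) := by
  unfold sqDist
  fun_prop

theorem hasFDerivAt_sqDist {B : Space n →L[ℝ] Space n →L[ℝ] ℝ} (hB : ∀ v w, B v w = B w v)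
    (z x : Space n) : HasFDerivAt (sqDist B z) ((2 : ℝ) • B (x - z)) x := by
  have h1 : HasFDerivAt (fun x : Space n => x - z) (ContinuousLinearMap.id ℝ (Space n)) x :=
    (hasFDerivAt_id x).sub_const z
  have h2 := (B.hasFDerivAt.comp x h1).clm_apply h1
  refine h2.congr_fderiv ?_
  ext v
  simp [hB v x, hB v z]
  ring

/-- The test field: a radial field, truncated by `ψ` of the height, plus the correction
that turns the truncation into a subharmonic weight. -/
noncomputable def testField (κ Φ ψ ψ₁ : ℝ → ℝ) (B : Space n →L[ℝ] Space n →L[ℝ] ℝ) (d : ℝ)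
    (z ξ x : Space n) : Space n :=
  (ψ (height d x) * κ (sqDist B z x)) • (x - z) + (Φ (sqDist B z x) * ψ₁ (height d x)) • ξ

section testField

variable {κ κ' Φ ψ ψ₁ ψ₂ : ℝ → ℝ} {B : Space n →L[ℝ] Space n →L[ℝ] ℝ} {d : ℝ} {z ξ : Space n}

theorem contDiff_testField {s : Set ℝ} (hs : IsOpen s) (hBs : ∀ x, sqDist B z x ∈ s)
    (hκ : ContDiffOn ℝ 1 κ s) (hΦ : ContDiffOn ℝ 1 Φ s) (hψ : ContDiff ℝ 1 ψ)
    (hψ₁ : ContDiff ℝ 1 ψ₁) : ContDiff ℝ 1 (testField κ Φ ψ ψ₁ B d z ξ) := by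
  have h1 : ContDiff ℝ 1 fun x => κ (sqDist B z x) := contDiff_iff_contDiffAt.2 fun x =>
    (hκ.contDiffAt (hs.mem_nhds (hBs x))).comp x (contDiff_sqDist B z).contDiffAt
  have h2 : ContDiff ℝ 1 fun x => Φ (sqDist B z x) := contDiff_iff_contDiffAt.2 fun x =>
    (hΦ.contDiffAt (hs.mem_nhds (hBs x))).comp x (contDiff_sqDist B z).contDiffAt
  have h3 : ContDiff ℝ 1 fun x : Space n => ψ (height d x) := hψ.comp (contDiff_height d)
  have h4 : ContDiff ℝ 1 fun x : Space n => ψ₁ (height d x) := hψ₁.comp (contDiff_height d)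
  exact ((h3.mul h1).smul (contDiff_id.sub contDiff_const)).add ((h2.mul h4).smul contDiff_const)

/-- Since `2 Φ' = -κ`, the derivative of the correction along `ξ` contains the mirror image of the
term in which `ψ` is differentiated. -/
theorem fderiv_testField (hB : ∀ v w, B v w = B w v) (hξ : ∀ v, B ξ v = -(v 0) / d) {x : Space n}
    (hκ : HasDerivAt κ (κ' (sqDist B z x)) (sqDist B z x))
    (hΦ : HasDerivAt Φ (-(κ (sqDist B z x) / 2)) (sqDist B z x))
    (hψ : ∀ t, HasDerivAt ψ (ψ₁ t) t) (hψ₁ : ∀ t, HasDerivAt ψ₁ (ψ₂ t) t) (v : Space n) :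
    fderiv ℝ (testField κ Φ ψ ψ₁ B d z ξ) x v =
      (κ (sqDist B z x) * ψ₁ (height d x) * B ξ v +
        2 * ψ (height d x) * κ' (sqDist B z x) * B (x - z) v) • (x - z) +
      (ψ (height d x) * κ (sqDist B z x)) • v +
      (Φ (sqDist B z x) * ψ₂ (height d x) * B ξ v -
        κ (sqDist B z x) * ψ₁ (height d x) * B (x - z) v) • ξ := by
  have h1 := hκ.comp_hasFDerivAt x (hasFDerivAt_sqDist hB z x)
  have h2 := hΦ.comp_hasFDerivAt x (hasFDerivAt_sqDist hB z x)
  have h3 := (hψ (height d x)).comp_hasFDerivAt x (hasFDerivAt_height d x)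
  have h4 := (hψ₁ (height d x)).comp_hasFDerivAt x (hasFDerivAt_height d x)
  have h5 : HasFDerivAt (fun x : Space n => x - z) (ContinuousLinearMap.id ℝ (Space n)) x :=
    (hasFDerivAt_id x).sub_const z
  have h6 := ((h3.mul h1).smul h5).add ((h2.mul h4).smul_const ξ)
  have h7 : HasFDerivAt (testField κ Φ ψ ψ₁ B d z ξ) _ x := h6
  have hp : (EuclideanSpace.proj (0 : Fin (n + 1)) : Space n →L[ℝ] ℝ) v = v 0 := rfl
  rw [h7.fderiv, hξ]
  simp only [Function.comp_apply, FunLike.coe_add, FunLike.coe_smul, Pi.add_apply, Pi.smul_apply,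
    ContinuousLinearMap.smulRight_apply, ContinuousLinearMap.id_apply, hp,
    smul_eq_mul, Pi.mul_apply]
  module

end testField

/-- The hypotheses on the varifold that are used away from the wall, with `η` measuring the
deviation of the metric from the Euclidean one and the mean curvature `H`. The ball of radius
`7 / 16` contains all ellipsoids of radius at most `1 / 4` centred in the ball of radius `1 / 8`. -/
structure IsAlmostMinimal {g : C1Metric (halfBall n)} (V : RectifiableVarifold g)
    (H : Space n → Space n) (η : ℝ) : Prop where
  nonneg : 0 ≤ η
  le : η ≤ 1 / 4
  norm_sub_le : ∀ x ∈ halfBall n, ‖g.toFun x - euclideanForm n‖ ≤ η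
  norm_fderiv_le : ∀ x ∈ halfBall n, ‖fderiv ℝ g.toFun x‖ ≤ η
  norm_curvature_le : ∀ᵐ x ∂V.mass, ‖H x‖ ≤ η
  firstVariation_eq : ∀ X, IsTestField (halfBall n : Set (Space n)) X →
    V.firstVariation X = -∫ x, g.toFun x (H x) (X x) ∂V.mass
  mass_ne_top : V.mass (ball 0 (7 / 16)) ≠ ⊤

theorem convex_halfBall (n : ℕ) : Convex ℝ (halfBall n : Set (Space n)) := by
  refine (convex_ball 0 1).inter ?_
  exact convex_halfSpace_lt (f := fun x : Space n => x 0) ⟨fun _ _ => rfl, fun _ _ => rfl⟩ 0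

namespace IsAlmostMinimal

variable {g : C1Metric (halfBall n)} {V : RectifiableVarifold g} {H : Space n → Space n} {η : ℝ}

theorem norm_sub_le_mul (h : IsAlmostMinimal V H η) {x z : Space n} (hx : x ∈ halfBall n)
    (hz : z ∈ halfBall n) : ‖g.toFun x - g.toFun z‖ ≤ η * ‖x - z‖ :=
  (convex_halfBall n).norm_image_sub_le_of_norm_fderiv_le
    (fun _ hy => g.differentiableAt hy) (fun y hy => h.norm_fderiv_le y hy) hz hx

theorem le_sqDist (h : IsAlmostMinimal V H η) {z : Space n} (hz : z ∈ halfBall n) (x : Space n) :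
    (1 - η) * ‖x - z‖ ^ 2 ≤ sqDist (g.toFun z) z x :=
  le_form_self (h.norm_sub_le z hz) _

theorem sqDist_le (h : IsAlmostMinimal V H η) {z : Space n} (hz : z ∈ halfBall n) (x : Space n) :
    sqDist (g.toFun z) z x ≤ (1 + η) * ‖x - z‖ ^ 2 :=
  form_self_le (h.norm_sub_le z hz) _

theorem sqDist_nonneg (h : IsAlmostMinimal V H η) {z : Space n} (hz : z ∈ halfBall n) (x : Space n)
    :
    0 ≤ sqDist (g.toFun z) z x := by
  have := h.le_sqDist hz x
  have h1 := h.le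
  have : 0 ≤ (1 - η) * ‖x - z‖ ^ 2 := mul_nonneg (by linarith) (by positivity)
  linarith

/-- Ellipsoids of `g` at `z` lie in slightly larger balls. -/
theorem norm_sub_le_of_sqDist_le (h : IsAlmostMinimal V H η) {z x : Space n}
    (hz : z ∈ halfBall n) {R : ℝ} (hR : 0 ≤ R) (hx : sqDist (g.toFun z) z x ≤ R ^ 2) :
    ‖x - z‖ ≤ R * (1 + η) := by
  have h1 := h.le_sqDist hz x
  have h2 := h.le
  have h3 := h.nonneg
  have h4 : 1 ≤ (1 - η) * (1 + η) ^ 2 := by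
    have : 0 ≤ η * (1 - η - η ^ 2) := mul_nonneg h3 (by nlinarith)
    nlinarith
  have h5 : (1 - η) * ‖x - z‖ ^ 2 ≤ (1 - η) * (R * (1 + η)) ^ 2 := by
    have : R ^ 2 * 1 ≤ R ^ 2 * ((1 - η) * (1 + η) ^ 2) := by gcongr
    nlinarith
  have h6 : ‖x - z‖ ^ 2 ≤ (R * (1 + η)) ^ 2 := le_of_mul_le_mul_left h5 (by linarith)
  exact (sq_le_sq₀ (norm_nonneg _) (by positivity)).1 h6

end IsAlmostMinimal

end BoundaryRigidity

/-! ### The integral inequality -/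

namespace BoundaryRigidity

open C1Metric

variable {n : ℕ}

/-- A profile `ψ` of the height, with derivatives `ψ₁` and `ψ₂`, that vanishes near the wall and is
positive and convex near height one. The bounds are those of the mean value inequality: `K` is the
range of scales, `M` bounds the derivatives, `M'` compares them to `ψ` near height one, and `b`
bounds the failure of convexity. -/
structure IsHeightProfile (ψ ψ₁ ψ₂ : ℝ → ℝ) (K M M' b : ℝ) : Prop where
  hasDerivAt : ∀ t, HasDerivAt ψ (ψ₁ t) t
  hasDerivAt_deriv : ∀ t, HasDerivAt ψ₁ (ψ₂ t) t
  continuous_deriv : Continuous ψ₂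
  nonneg : ∀ t, 0 ≤ ψ t
  exists_eq_zero : ∃ s > 0, ∀ t ≤ s, ψ t = 0
  one_le : 1 ≤ K
  bound_nonneg : 0 ≤ M
  near_bound_nonneg : 0 ≤ M'
  convexity_nonneg : 0 ≤ b
  abs_le : ∀ t, |t| ≤ 1 + 2 * K → |ψ₁ t| ≤ M ∧ |ψ₂ t| ≤ M
  near : ∀ t, |t - 1| ≤ 1 / 2 → |ψ₁ t| ≤ M' * ψ t ∧ |ψ₂ t| ≤ M' * ψ t ∧ 0 ≤ ψ₂ t
  neg_le : ∀ t, -ψ₂ t ≤ b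

namespace IsHeightProfile

variable {ψ ψ₁ ψ₂ : ℝ → ℝ} {K M M' b : ℝ}

theorem continuous (h : IsHeightProfile ψ ψ₁ ψ₂ K M M' b) : Continuous ψ :=
  continuous_iff_continuousAt.2 fun t => (h.hasDerivAt t).continuousAt

theorem contDiff_deriv (h : IsHeightProfile ψ ψ₁ ψ₂ K M M' b) : ContDiff ℝ 1 ψ₁ :=
  contDiffOn_univ.1 (contDiffOn_one_of_hasDerivAt isOpen_univ (fun t _ => h.hasDerivAt_deriv t)
    h.continuous_deriv.continuousOn)

theorem contDiff (h : IsHeightProfile ψ ψ₁ ψ₂ K M M' b) : ContDiff ℝ 1 ψ :=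
  contDiffOn_univ.1 (contDiffOn_one_of_hasDerivAt isOpen_univ (fun t _ => h.hasDerivAt t)
    h.contDiff_deriv.continuous.continuousOn)

theorem exists_deriv_eq_zero (h : IsHeightProfile ψ ψ₁ ψ₂ K M M' b) :
    ∃ s > 0, ∀ t < s, ψ t = 0 ∧ ψ₁ t = 0 := by
  obtain ⟨s, hs, hz⟩ := h.exists_eq_zero
  refine ⟨s, hs, fun t ht => ⟨hz t ht.le, ?_⟩⟩
  refine (h.hasDerivAt t).unique ((hasDerivAt_const t (0 : ℝ)).congr_of_eventuallyEq ?_)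
  filter_upwards [Iio_mem_nhds ht] with y hy using hz y (le_of_lt hy)

end IsHeightProfile

theorem abs_apply_zero_le (x : Space n) : |x 0| ≤ ‖x‖ := by
  simpa using PiLp.norm_apply_le x 0

namespace IsAlmostMinimal

variable {g : C1Metric (halfBall n)} {V : RectifiableVarifold g} {H : Space n → Space n} {η : ℝ}

theorem norm_le_of_sqDist_le (h : IsAlmostMinimal V H η) {z x : Space n}
    (hz : z ∈ halfBall n) (hz' : ‖z‖ < 1 / 8) {R : ℝ} (hR : 0 ≤ R) (hR' : R ≤ 1 / 4)
    (hx : sqDist (g.toFun z) z x ≤ R ^ 2) : ‖x‖ < 7 / 16 := by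
  have h1 := h.norm_sub_le_of_sqDist_le hz hR hx
  have h2 := h.le
  have h3 := h.nonneg
  have h4 : ‖x‖ ≤ ‖x - z‖ + ‖z‖ := norm_le_norm_sub_add x z
  nlinarith

theorem isCompact_setOf_sqDist_le (h : IsAlmostMinimal V H η) {z : Space n}
    (hz : z ∈ halfBall n) {R : ℝ} (hR : 0 ≤ R) :
    IsCompact {x | sqDist (g.toFun z) z x ≤ R ^ 2} := by
  refine (isCompact_closedBall z (R * (1 + η))).of_isClosed_subset
    (isClosed_le (contDiff_sqDist (m := 0) _ z).continuous continuous_const) fun x hx => ?_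
  rw [mem_closedBall, dist_eq_norm]
  exact h.norm_sub_le_of_sqDist_le hz hR hx

theorem mass_setOf_sqDist_le_ne_top (h : IsAlmostMinimal V H η) {z : Space n}
    (hz : z ∈ halfBall n) (hz' : ‖z‖ < 1 / 8) {R : ℝ} (hR : 0 ≤ R) (hR' : R ≤ 1 / 4) :
    V.mass {x | sqDist (g.toFun z) z x ≤ R ^ 2} ≠ ⊤ :=
  ne_top_of_le_ne_top h.mass_ne_top (measure_mono fun x hx => by
    simpa using h.norm_le_of_sqDist_le hz hz' hR hR' hx)

theorem sq_le_apply (h : IsAlmostMinimal V H η) {x : Space n} (hx : x ∈ halfBall n) (v : Space n) :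
    (√(1 - η) * ‖v‖) ^ 2 ≤ g.toFun x v v := by
  rw [mul_pow, Real.sq_sqrt (by linarith [h.le])]
  exact le_form_self (h.norm_sub_le x hx) v

end IsAlmostMinimal

theorem norm_tilt_le (S : Gr n) : ‖S.proj - wallProj n‖ ≤ 2 := by
  have h1 : ‖S.proj‖ ≤ 1 := Submodule.starProjection_norm_le _
  have h2 : ‖wallProj n‖ ≤ 1 := Submodule.starProjection_norm_le _
  linarith [norm_sub_le S.proj (wallProj n)]

theorem RectifiableVarifold.integrableOn_tilt_sq {U : Opens (Space n)} {g : C1Metric U}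
    (V : RectifiableVarifold g) {s : Set (Space n)} (hs : V.mass s ≠ ⊤) :
    IntegrableOn (fun x => ‖(V.tangent x).proj - wallProj n‖ ^ 2) s V.mass := by
  refine Measure.integrableOn_of_bounded (M := 4) hs
    ((V.aestronglyMeasurable_proj.sub aestronglyMeasurable_const).norm.pow 2) ?_
  refine Eventually.of_forall fun x => ?_
  have := norm_tilt_le (V.tangent x)
  rw [Real.norm_of_nonneg (by positivity)]
  nlinarith [norm_nonneg ((V.tangent x).proj - wallProj n)]

section

variable {g : C1Metric (halfBall n)} {V : RectifiableVarifold g} {H : Space n → Space n} {η : ℝ}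
  {ψ ψ₁ ψ₂ : ℝ → ℝ} {K M M' b : ℝ} {z : Space n} {d R a ε σ : ℝ}

theorem IsAlmostMinimal.abs_height_sub_one_le (hd : 0 < d) (hzd : z 0 = -d) (x : Space n) :
    |height d x - 1| ≤ ‖x - z‖ / d := by
  have h1 : height d z = 1 := by
    rw [height, hzd, neg_neg, div_self hd.ne']
  rw [← h1, height_sub, abs_div, abs_neg, abs_of_pos hd]
  gcongr
  exact abs_apply_zero_le _

/-- The test field is compactly supported in the open half ball: `ψ` cuts it off near the wall, and
the kernels cut it off at distance `R`. -/
theorem IsAlmostMinimal.isTestField_testField (h : IsAlmostMinimal V H η)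
    (hψ : IsHeightProfile ψ ψ₁ ψ₂ K M M' b) (hn : 1 ≤ n) (hz : z ∈ halfBall n) (hz' : ‖z‖ < 1 / 8)
    (hd : 0 < d) (hR : 0 ≤ R) (hR' : R ≤ 1 / 4) (ha : 0 ≤ a) (hε : 0 < ε) (hσ : 0 < σ)
    (ξ : Space n) :
    IsTestField (halfBall n : Set (Space n))
        (testField (kernel n a ε σ R) (potential n a ε σ R) ψ ψ₁ (g.toFun z) d z ξ) ∧
      tsupport (testField (kernel n a ε σ R) (potential n a ε σ R) ψ ψ₁ (g.toFun z) d z ξ) ⊆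
        {x | sqDist (g.toFun z) z x ≤ R ^ 2} := by
  obtain ⟨s, hs, hz0⟩ := hψ.exists_deriv_eq_zero
  set Z := testField (kernel n a ε σ R) (potential n a ε σ R) ψ ψ₁ (g.toFun z) d z ξ with hZ
  have hc1 : Continuous (sqDist (g.toFun z) z) := (contDiff_sqDist (m := 0) _ z).continuous
  have hsub : tsupport Z ⊆ {x | sqDist (g.toFun z) z x ≤ R ^ 2} ∩ {x | s ≤ height d x} := by
    refine closure_minimal ?_ ((isClosed_le hc1 continuous_const).inter
      (isClosed_le continuous_const (contDiff_height (m := 0) d).continuous))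
    intro x hx
    by_contra hcon
    refine hx ?_
    rw [mem_inter_iff, not_and_or] at hcon
    rcases hcon with hcon | hcon
    · have hq : R ^ 2 ≤ sqDist (g.toFun z) z x := (not_le.1 hcon).le
      simp [hZ, testField, kernel_eq_zero hσ ha hn hε hq, potential_eq_zero hσ ha hn hε hq]
    · have := hz0 _ (not_le.1 hcon)
      simp [hZ, testField, this.1, this.2]
  have hε2 : 0 < ε ^ 2 := by positivity
  refine ⟨⟨?_, ?_, ?_⟩, hsub.trans inter_subset_left⟩
  · refine contDiff_testField (s := Ioi (-ε ^ 2)) isOpen_Ioi (fun x => ?_)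
      (contDiffOn_one_of_hasDerivAt isOpen_Ioi (fun q hq => hasDerivAt_kernel hσ hq)
        (continuousOn_kernelDeriv hσ))
      (contDiffOn_one_of_hasDerivAt isOpen_Ioi (fun q hq => hasDerivAt_potential hσ hε hq)
        ((continuousOn_kernel hσ).div_const 2).neg) hψ.contDiff hψ.contDiff_deriv
    have := h.sqDist_nonneg hz x
    rw [mem_Ioi]
    linarith
  · exact (h.isCompact_setOf_sqDist_le hz hR).of_isClosed_subset isClosed_closure
      (hsub.trans inter_subset_left)
  · intro x hx
    obtain ⟨hx1, hx2⟩ := hsub hx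
    have h1 := h.norm_le_of_sqDist_le hz hz' hR hR' hx1
    refine ⟨by rw [mem_ball_zero_iff]; linarith, ?_⟩
    have h2 : 0 < height d x := hs.trans_le hx2
    rw [height, div_pos_iff_of_pos_right hd] at h2
    exact neg_pos.1 h2

/-- The first variation tested against `testField`: the mean value inequality before `ε → 0`. -/
theorem IsAlmostMinimal.integral_kernelWeight_le (h : IsAlmostMinimal V H η)
    (hψ : IsHeightProfile ψ ψ₁ ψ₂ K M M' b) (hn : 1 ≤ n) (hz : z ∈ halfBall n) (hz' : ‖z‖ < 1 / 8)
    (hd : 0 < d) (hzd : z 0 = -d) (hdR : 2 * d ≤ R) (hRK : R ≤ K * d) (hR' : R ≤ 1 / 4)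
    (ha : a = absorbConst n K M' * η) (ha' : a ≤ 1 / 2) (ha0 : 0 ≤ a)
    (hε : 0 < ε) (hεd : ε ≤ d / 4) (hσ : 0 < σ) (hσ' : σ ≤ 1 / (4 * d ^ n)) :
    ∫ x, ψ (height d x) * (kernelWeight n a ε σ R (sqDist (g.toFun z) z x) *
        (n * ε ^ 2 / regDist ε (sqDist (g.toFun z) z x) ^ (n + 2))) ∂V.mass ≤
      n * (σ + profile n a (regDist ε (R ^ 2))) *
          ∫ x in {x | sqDist (g.toFun z) z x ≤ R ^ 2}, ψ (height d x) ∂V.mass +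
        farConst n K M / d ^ n *
          (η * V.mass.real {x | sqDist (g.toFun z) z x ≤ R ^ 2} +
            b * ∫ x in {x | sqDist (g.toFun z) z x ≤ R ^ 2},
              ‖(V.tangent x).proj - wallProj n‖ ^ 2 ∂V.mass) := by
  have hR : 0 ≤ R := by linarith
  obtain ⟨ξ, hξ⟩ := exists_form_eq (B := g.toFun z) (g.pos z hz)
    ((-d⁻¹) • (EuclideanSpace.proj (0 : Fin (n + 1)) : Space n →L[ℝ] ℝ))
  have hξ' : ∀ v, g.toFun z ξ v = -(v 0) / d := fun v => by
    rw [hξ]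
    simp
    ring
  have hη := h.le
  have hη0 := h.nonneg
  have hε2 : 0 < ε ^ 2 := by positivity
  set T := {x | sqDist (g.toFun z) z x ≤ R ^ 2} with hT
  set q := sqDist (g.toFun z) z with hqdef
  have hq0 : ∀ x, 0 ≤ q x := h.sqDist_nonneg hz
  set Z := testField (kernel n a ε σ R) (potential n a ε σ R) ψ ψ₁ (g.toFun z) d z ξ with hZ
  obtain ⟨htest, hsupp⟩ := h.isTestField_testField hψ hn hz hz' hd hR hR' ha0 hε hσ ξ
  rw [← hZ] at htest hsupp
  replace hsupp : tsupport Z ⊆ T := hsupp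
  have hTc : IsCompact T := h.isCompact_setOf_sqDist_le hz hR
  have hTm : MeasurableSet T := hTc.isClosed.measurableSet
  have hTfin : V.mass T ≠ ⊤ := h.mass_setOf_sqDist_le_ne_top hz hz' hR hR'
  have hqc : Continuous q := (contDiff_sqDist (m := 0) _ z).continuous
  have hhc : Continuous (height d : Space n → ℝ) := (contDiff_height (m := 0) d).continuous
  have hfc : Continuous fun x : Space n => ψ (height d x) := hψ.continuous.comp hhc
  set τ : Space n → ℝ := fun x => ‖(V.tangent x).proj - wallProj n‖ with hτ
  set A : Space n → ℝ := fun x => ψ (height d x) * (kernelWeight n a ε σ R (q x) *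
        (n * ε ^ 2 / regDist ε (q x) ^ (n + 2))) with hA
  set c := σ + profile n a (regDist ε (R ^ 2)) with hc
  set F := farConst n K M / d ^ n with hF
  -- continuous functions supported in `T` are integrable
  have hint : ∀ {f : Space n → ℝ}, Continuous f → (∀ x ∉ T, f x = 0) → Integrable f V.mass := by
    intro f hf h0
    rw [← integrableOn_iff_integrable_of_support_subset (s := T)
      (fun x hx => by_contra fun hx' => hx (h0 x hx'))]
    obtain ⟨C, hC⟩ := hTc.exists_bound_of_continuousOn hf.continuousOn
    exact Measure.integrableOn_of_bounded hTfin hf.aestronglyMeasurable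
      (ae_restrict_of_forall_mem hTm hC)
  have hAint : Integrable A V.mass := by
    refine hint ?_ fun x hx => ?_
    · have hm : ∀ x, q x ∈ Ioi (-ε ^ 2) := fun x => by
        rw [mem_Ioi]
        linarith [hq0 x]
      refine hfc.mul (((continuousOn_kernelWeight hσ).comp_continuous hqc hm).mul
        (continuous_const.div ?_ fun x => (pow_pos (regDist_pos (hm x)) _).ne'))
      unfold regDist
      fun_prop
    · simp only [hA]
      rw [kernelWeight_eq_zero ha0 hn hε (not_le.1 hx).le]
      simp
  have hfT : IntegrableOn (fun x => ψ (height d x)) T V.mass := by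
    obtain ⟨C, hC⟩ := hTc.exists_bound_of_continuousOn hfc.continuousOn
    exact Measure.integrableOn_of_bounded hTfin hfc.aestronglyMeasurable
      (ae_restrict_of_forall_mem hTm hC)
  have hτT : IntegrableOn (fun x => τ x ^ 2) T V.mass := V.integrableOn_tilt_sq hTfin
  have hconst : IntegrableOn (fun _ : Space n => η) T V.mass := integrableOn_const hTfin
  set E : Space n → ℝ := fun x => n * c * ψ (height d x) + F * (η + b * τ x ^ 2) with hE
  have hET : IntegrableOn E T V.mass :=
    (hfT.const_mul _).add ((hconst.add (hτT.const_mul b)).const_mul F)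
  have hZc : Continuous Z := htest.1.continuous
  have hZ0 : ∀ x ∉ T, Z x = 0 := fun x hx => by
    by_contra hne
    exact hx (hsupp (subset_tsupport Z hne))
  have hZint : Integrable (fun x => 2 * η * ‖Z x‖) V.mass :=
    hint (continuous_const.mul hZc.norm) fun x hx => by simp [hZ0 x hx]
  have hDint := V.integrable_tangentialDiv htest
    (Real.sqrt_pos.2 (by linarith : 0 < 1 - η)) fun x hx v => h.sq_le_apply hx v
  -- pointwise inequality
  have hpt : ∀ᵐ x ∂V.mass, A x - T.indicator E x ≤
      tangentialDiv g Z x (V.tangent x) - 2 * η * ‖Z x‖ := by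
    filter_upwards [V.ae_mem_domain] with x hx
    obtain ⟨e, he, hdiv⟩ := exists_tangentialDiv_eq g hx Z (V.tangent x)
    rw [hdiv]
    by_cases hxT : x ∈ T
    · have hxq : q x ≤ R ^ 2 := hxT
      have hqx : -ε ^ 2 < q x := by linarith [hq0 x]
      have hxz := h.norm_sub_le_of_sqDist_le hz hR hxq
      have hh1 := abs_height_sub_one_le hd hzd x
      have hfar : |height d x| ≤ 1 + 2 * K := by
        have h1 : ‖x - z‖ / d ≤ 2 * K := by
          rw [div_le_iff₀ hd]
          nlinarith [hψ.one_le]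
        have h2 := abs_sub_abs_le_abs_sub (height d x) 1
        rw [abs_one] at h2
        linarith
      have hb := hψ.abs_le _ hfar
      have key1 := le_kernel_terms (n := n) (τ := τ x) hn hψ.one_le hψ.bound_nonneg
        hψ.near_bound_nonneg hη0 hη ha ha' hd hdR hRK hR' hε hεd hσ hσ' (norm_nonneg (x - z))
        (hq0 x) (h.le_sqDist hz x) (h.sqDist_le hz x) hxq (hψ.nonneg (height d x)) hb.1 hb.2
        (fun hr => hψ.near _ (hh1.trans (by rw [div_le_iff₀ hd]; linarith)))
        hψ.convexity_nonneg (hψ.neg_le (height d x))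
      have key2 := le_sum_divForm hx he hn hη (h.norm_sub_le x hx) (h.norm_sub_le z hz)
        (h.norm_fderiv_le x hx) (h.norm_sub_le_mul hx hz) hd hξ' (hψ.nonneg (height d x))
        (kernel_nonneg (n := n) (a := a) (ε := ε) (σ := σ) (R := R) (q x))
        (kernelDeriv_nonpos (σ := σ) (R := R) ha0 hn hqx)
        (potential_nonneg (R := R) hσ ha0 hn hε (q x)) (ψ₁ := ψ₁ (height d x))
        (ψ₂ := ψ₂ (height d x)) (Z := Z) rfl
        (fderiv_testField (g.symm z hz) hξ' (hasDerivAt_kernel hσ hqx)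
          (hasDerivAt_potential hσ hε hqx) hψ.hasDerivAt hψ.hasDerivAt_deriv)
      rw [indicator_of_mem hxT]
      have hGq : g.toFun z (x - z) (x - z) = q x := rfl
      rw [hGq] at key2
      refine le_trans (le_of_eq ?_) (key1.trans key2)
      simp only [hA, hE]
      ring
    · have hts : x ∉ tsupport Z := fun hx' => hxT (hsupp hx')
      rw [indicator_of_notMem hxT, hZ0 x hxT]
      have hA0 : A x = 0 := by
        simp only [hA]
        rw [kernelWeight_eq_zero ha0 hn hε (not_le.1 hxT).le]
        simp
      simp [hA0, divForm_eq_zero g hts]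
  have hI1 := integral_mono_ae (hAint.sub (hET.integrable_indicator hTm)) (hDint.sub hZint) hpt
  simp only [Pi.sub_apply] at hI1
  rw [integral_sub hAint (hET.integrable_indicator hTm), integral_sub hDint hZint,
    integral_indicator hTm] at hI1
  have hfv := h.firstVariation_eq Z htest
  rw [RectifiableVarifold.firstVariation] at hfv
  have hH : ‖∫ x, g.toFun x (H x) (Z x) ∂V.mass‖ ≤ ∫ x, 2 * η * ‖Z x‖ ∂V.mass := by
    refine norm_integral_le_of_norm_le hZint ?_
    filter_upwards [V.ae_mem_domain, h.norm_curvature_le] with x hx hHx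
    have h1 := abs_form_le (h.norm_sub_le x hx) hη (H x) (Z x)
    rw [Real.norm_eq_abs]
    refine h1.trans ?_
    gcongr
  have hH' := neg_abs_le (∫ x, g.toFun x (H x) (Z x) ∂V.mass)
  rw [Real.norm_eq_abs] at hH
  have hEval : ∫ x in T, E x ∂V.mass = n * c * ∫ x in T, ψ (height d x) ∂V.mass +
      F * (η * V.mass.real T + b * ∫ x in T, τ x ^ 2 ∂V.mass) := by
    simp only [hE]
    have h1 : IntegrableOn (fun x => F * (η + b * τ x ^ 2)) T V.mass :=
      (hconst.add (hτT.const_mul b)).const_mul F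
    rw [integral_add (hfT.const_mul _) h1,
      integral_const_mul, integral_const_mul, integral_add hconst (hτT.const_mul b),
      integral_const_mul, setIntegral_const, smul_eq_mul, mul_comm η]
  linarith

end

end BoundaryRigidity

/-! ### The standard bubble -/

namespace BoundaryRigidity

open C1Metric

variable {n : ℕ}

theorem hasDerivAt_div_sqrt_one_add_sq_pow (hn : 1 ≤ n) (y : ℝ) :
    HasDerivAt (fun y : ℝ => (n : ℝ)⁻¹ * (y / √(1 + y ^ 2)) ^ n)
      (y ^ (n - 1) / √(1 + y ^ 2) ^ (n + 2)) y := by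
  have hpos : 0 < 1 + y ^ 2 := by positivity
  have hs : 0 < √(1 + y ^ 2) := Real.sqrt_pos.2 hpos
  have h1 : HasDerivAt (fun y : ℝ => 1 + y ^ 2) (2 * y) y := by
    simpa using (hasDerivAt_pow 2 y).const_add 1
  have h2 := (((hasDerivAt_id y).div (h1.sqrt hpos.ne') hs.ne').pow n).const_mul (n : ℝ)⁻¹
  refine h2.congr_deriv ?_
  have hsq : √(1 + y ^ 2) ^ 2 = 1 + y ^ 2 := Real.sq_sqrt hpos.le
  obtain ⟨m, rfl⟩ : ∃ m, n = m + 1 := ⟨n - 1, by omega⟩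
  simp only [id, Pi.div_apply, Nat.add_sub_cancel]
  set s := √(1 + y ^ 2)
  have hm : ((m : ℝ) + 1) ≠ 0 := by positivity
  have h3 : (1 * s - y * (2 * y / (2 * s))) = 1 / s := by
    field_simp
    linarith
  rw [h3, div_pow]
  push_cast
  field_simp
  ring

theorem tendsto_div_sqrt_one_add_sq_pow :
    Tendsto (fun y : ℝ => (n : ℝ)⁻¹ * (y / √(1 + y ^ 2)) ^ n) atTop (𝓝 (n : ℝ)⁻¹) := by
  have h1 : Tendsto (fun y : ℝ => y / √(1 + y ^ 2)) atTop (𝓝 1) := by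
    have h2 : Tendsto (fun y : ℝ => √((1 + (y ^ 2)⁻¹)⁻¹)) atTop (𝓝 (√((1 + 0)⁻¹))) := by
      refine ((tendsto_const_nhds.add ?_).inv₀ (by norm_num)).sqrt
      exact tendsto_inv_atTop_zero.comp (tendsto_pow_atTop two_ne_zero)
    rw [add_zero, inv_one, Real.sqrt_one] at h2
    refine h2.congr' ?_
    filter_upwards [eventually_gt_atTop 0] with y hy
    have : (1 + (y ^ 2)⁻¹)⁻¹ = y ^ 2 / (1 + y ^ 2) := by
      field_simp
      ring
    rw [this, Real.sqrt_div (sq_nonneg y), Real.sqrt_sq hy.le]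
  simpa using (h1.pow n).const_mul (n : ℝ)⁻¹

theorem integrableOn_pow_div_sqrt (hn : 1 ≤ n) :
    IntegrableOn (fun y : ℝ => y ^ (n - 1) / √(1 + y ^ 2) ^ (n + 2)) (Ioi 0) :=
  integrableOn_Ioi_deriv_of_nonneg' (fun y _ => hasDerivAt_div_sqrt_one_add_sq_pow hn y)
    (fun y hy => by have : 0 < y := hy; positivity) tendsto_div_sqrt_one_add_sq_pow

theorem integral_pow_div_sqrt (hn : 1 ≤ n) :
    ∫ y in Ioi (0 : ℝ), y ^ (n - 1) / √(1 + y ^ 2) ^ (n + 2) = (n : ℝ)⁻¹ := by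
  rw [integral_Ioi_of_hasDerivAt_of_nonneg' (fun y _ => hasDerivAt_div_sqrt_one_add_sq_pow hn y)
    (fun y hy => by have : 0 < y := hy; positivity) tendsto_div_sqrt_one_add_sq_pow]
  have : n ≠ 0 := by omega
  simp [this]

/-- The volume of the unit ball of `ℝⁿ`. -/
noncomputable def unitBallVolume (n : ℕ) : ℝ :=
  volume.real (ball (0 : EuclideanSpace ℝ (Fin n)) 1)

theorem unitBallVolume_pos (n : ℕ) : 0 < unitBallVolume n := by
  rw [unitBallVolume, measureReal_def]
  exact ENNReal.toReal_pos (measure_ball_pos _ _ one_pos).ne' measure_ball_lt_top.ne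

theorem Gr.volume_real_ball (P : Gr n) : volume.real (ball (0 : P.1) 1) = unitBallVolume n := by
  have e := (stdOrthonormalBasis ℝ P.1).reindex (finCongr P.2)
  have h := e.measurePreserving_repr.measure_preimage
    (measurableSet_ball (x := (0 : EuclideanSpace ℝ (Fin n))) (ε := 1)).nullMeasurableSet
  have h2 : e.repr ⁻¹' ball 0 1 = ball (0 : P.1) 1 := by
    ext v
    simp
  rw [measureReal_def, unitBallVolume, measureReal_def, ← h, ← h2]

theorem Gr.integrable_bubble (P : Gr n) (hn : 1 ≤ n) :
    Integrable fun y : P.1 => 1 / √(1 + ‖y‖ ^ 2) ^ (n + 2) := by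
  have : Nontrivial P.1 := Module.nontrivial_of_finrank_pos (R := ℝ) (by rw [P.2]; omega)
  have h := (integrable_fun_norm_addHaar (E := P.1) (volume : Measure P.1)
    (f := fun y : ℝ => 1 / √(1 + y ^ 2) ^ (n + 2))).1
  refine (integrable_fun_norm_addHaar (E := P.1) (volume : Measure P.1)
    (f := fun y : ℝ => 1 / √(1 + y ^ 2) ^ (n + 2))).2 ?_
  rw [P.2]
  refine (integrableOn_pow_div_sqrt hn).congr_fun (fun y _ => ?_) measurableSet_Ioi
  simp [div_eq_mul_inv]

/-- The standard bubble has the mass of the unit ball. -/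
theorem Gr.integral_bubble (P : Gr n) (hn : 1 ≤ n) :
    ∫ y : P.1, 1 / √(1 + ‖y‖ ^ 2) ^ (n + 2) = unitBallVolume n := by
  have : Nontrivial P.1 := Module.nontrivial_of_finrank_pos (R := ℝ) (by rw [P.2]; omega)
  rw [integral_fun_norm_addHaar (E := P.1) (volume : Measure P.1)
    (fun y : ℝ => 1 / √(1 + y ^ 2) ^ (n + 2)), P.2, P.volume_real_ball]
  have h1 : ∫ y in Ioi (0 : ℝ), y ^ (n - 1) • (1 / √(1 + y ^ 2) ^ (n + 2)) = (n : ℝ)⁻¹ := by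
    rw [← integral_pow_div_sqrt hn]
    simp [div_eq_mul_inv]
  rw [h1]
  have : n ≠ 0 := by omega
  simp
  field_simp

/-- The standard bubble, cut off outside the ball of radius `N + 1`. -/
noncomputable def cutBubble (n : ℕ) (N : ℝ) (v : Space n) : ℝ :=
  max 0 (min 1 (N + 1 - ‖v‖)) * (1 / √(1 + ‖v‖ ^ 2) ^ (n + 2))

theorem continuous_cutBubble (N : ℝ) : Continuous (cutBubble n N) := by
  unfold cutBubble
  refine Continuous.mul (by fun_prop) (continuous_const.div (by fun_prop) fun v => ?_)
  positivity

theorem cutBubble_nonneg (N : ℝ) (v : Space n) : 0 ≤ cutBubble n N v := by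
  unfold cutBubble
  positivity

theorem cutBubble_le (N : ℝ) (v : Space n) : cutBubble n N v ≤ 1 / √(1 + ‖v‖ ^ 2) ^ (n + 2) :=
  mul_le_of_le_one_left (by positivity) (max_le zero_le_one (min_le_left _ _))

theorem cutBubble_eq_zero {N : ℝ} {v : Space n} (h : N + 1 ≤ ‖v‖) : cutBubble n N v = 0 := by
  have : min 1 (N + 1 - ‖v‖) ≤ 0 := (min_le_right _ _).trans (by linarith)
  simp [cutBubble, this]

theorem hasCompactSupport_cutBubble (N : ℝ) : HasCompactSupport (cutBubble n N) :=
  HasCompactSupport.of_support_subset_isCompact (isCompact_closedBall 0 (N + 1)) fun v hv => by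
    by_contra h
    rw [mem_closedBall_zero_iff, not_le] at h
    exact hv (cutBubble_eq_zero h.le)

theorem tendsto_integral_cutBubble (P : Gr n) (hn : 1 ≤ n) :
    Tendsto (fun N : ℕ => ∫ y : P.1, cutBubble n N y) atTop (𝓝 (unitBallVolume n)) := by
  rw [← P.integral_bubble hn]
  refine tendsto_integral_of_dominated_convergence (fun y : P.1 => 1 / √(1 + ‖y‖ ^ 2) ^ (n + 2))
    (fun N => ((continuous_cutBubble _).comp continuous_subtype_val).aestronglyMeasurable)
    (P.integrable_bubble hn) (fun N => Eventually.of_forall fun y => ?_)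
    (Eventually.of_forall fun y => ?_)
  · rw [Real.norm_of_nonneg (cutBubble_nonneg _ _)]
    exact cutBubble_le _ _
  · refine tendsto_const_nhds.congr' ?_
    filter_upwards [eventually_ge_atTop ⌈‖y‖⌉₊] with N hN
    have h1 : ‖y‖ ≤ N := (Nat.le_ceil _).trans (by exact_mod_cast hN)
    have h2 : min 1 ((N : ℝ) + 1 - ‖(y : Space n)‖) = 1 := min_eq_left (by
      rw [Submodule.coe_norm] at *
      linarith)
    simp [cutBubble, h2]

end BoundaryRigidity

/-! ### The mean value inequality -/

namespace BoundaryRigidity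

open C1Metric

variable {n : ℕ}

/-- The weight of the truncated kernel tends to one, uniformly on balls of radius comparable to
the regularisation. -/
theorem eventually_le_kernelWeight {a σ R ρ : ℝ} (hn : 1 ≤ n) (ha : 0 ≤ a) (hσ : 0 < σ) (hR : 0 < R)
    (hρ : ρ < 1) (L : ℝ) :
    ∀ᶠ ε in 𝓝[>] (0 : ℝ), ∀ q, 0 ≤ q → q ≤ (L * ε) ^ 2 → ρ ≤ kernelWeight n a ε σ R q := by
  obtain ⟨S, hS⟩ := eventually_atTop.1 ((tendsto_softPosDeriv_atTop hσ).eventually_const_le hρ)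
  have h1 : Tendsto (fun ε : ℝ => ((|L| + 1) * ε)⁻¹ - profile n a R) (𝓝[>] 0) atTop := by
    refine tendsto_atTop_add_const_right _ _ (tendsto_inv_nhdsGT_zero.comp ?_)
    refine tendsto_nhdsWithin_iff.2 ⟨?_, ?_⟩
    · have h2 : Continuous fun ε : ℝ => (|L| + 1) * ε := by fun_prop
      simpa using (h2.tendsto 0).mono_left nhdsWithin_le_nhds
    · filter_upwards [self_mem_nhdsWithin] with ε hε
      have : 0 < ε := hε
      exact mem_Ioi.2 (by positivity)
  have h3 : ∀ᶠ ε in 𝓝[>] (0 : ℝ), (|L| + 1) * ε ≤ 1 := by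
    have h2 : Continuous fun ε : ℝ => (|L| + 1) * ε := by fun_prop
    have h4 : ∀ᶠ ε in 𝓝 (0 : ℝ), (|L| + 1) * ε < 1 :=
      (h2.tendsto 0).eventually_lt_const (by simp)
    exact (h4.filter_mono nhdsWithin_le_nhds).mono fun _ h => h.le
  filter_upwards [h1.eventually_ge_atTop S, h3, self_mem_nhdsWithin] with ε hε1 hε2 hε q hq0 hq
  have hε0 : 0 < ε := hε
  have hε' : 0 < ε ^ 2 := by positivity
  refine hS _ (hε1.trans (sub_le_sub ?_ ?_))
  · have hw : 0 < regDist ε q := regDist_pos (by linarith)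
    have hw2 : regDist ε q ≤ (|L| + 1) * ε := by
      refine Real.sqrt_le_iff.2 ⟨by positivity, ?_⟩
      have : 0 ≤ |L| := abs_nonneg L
      have h5 : (L * ε) ^ 2 = |L| ^ 2 * ε ^ 2 := by rw [mul_pow, sq_abs]
      nlinarith
    have hwn : regDist ε q ^ n ≤ (|L| + 1) * ε :=
      (pow_le_of_le_one hw.le (hw2.trans hε2) (by omega)).trans hw2
    rw [profile, inv_eq_one_div]
    have : 0 ≤ a * regDist ε q := by positivity
    have h6 : 0 < regDist ε q ^ n := by positivity
    gcongr
    linarith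
  · exact profile_le ha hR hn (Real.le_sqrt_of_sq_le (by linarith))

section

variable {g : C1Metric (halfBall n)} {V : RectifiableVarifold g} {H : Space n → Space n} {η : ℝ}
  {ψ ψ₁ ψ₂ : ℝ → ℝ} {K M M' b : ℝ} {z : Space n} {d R a : ℝ}

/-- The limit `ε → 0` on the left-hand side of `IsAlmostMinimal.integral_kernelWeight_le`: the
approximate identity concentrates at `z` and is a rescaled bubble there, so that the blow-up at `z`
yields `c` times the volume of the unit ball. -/
theorem IsAlmostMinimal.le_of_forall_integral_le (h : IsAlmostMinimal V H η)
    (hψ : IsHeightProfile ψ ψ₁ ψ₂ K M M' b) (hψ1 : 0 < ψ 1) (hn : 1 ≤ n) (hz : z ∈ halfBall n)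
    (hd : 0 < d) (hzd : z 0 = -d) (ha0 : 0 ≤ a) {σ : ℝ} (hσ : 0 < σ) (hR : 0 < R)
    {P : Gr n} {c Q : ℝ} (hc : HasBlowUp V.mass z P c)
    (hfin : V.mass {x | sqDist (g.toFun z) z x ≤ R ^ 2} ≠ ⊤)
    (hQ : ∀ᶠ ε in 𝓝[>] (0 : ℝ), ∫ x, ψ (height d x) *
        (kernelWeight n a ε σ R (sqDist (g.toFun z) z x) *
        (n * ε ^ 2 / regDist ε (sqDist (g.toFun z) z x) ^ (n + 2))) ∂V.mass ≤ Q) :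
    ψ 1 * (n / √(1 + η) ^ (n + 2)) * (c * unitBallVolume n) ≤ Q := by
  have hη0 := h.nonneg
  have hη := h.le
  set q := sqDist (g.toFun z) z with hqdef
  have hq0 : ∀ x, 0 ≤ q x := h.sqDist_nonneg hz
  have hqc : Continuous q := (contDiff_sqDist (m := 0) _ z).continuous
  have hhc : Continuous (height d : Space n → ℝ) := (contDiff_height (m := 0) d).continuous
  have hhz : height d z = 1 := by rw [height, hzd, neg_neg, div_self hd.ne']
  have hTc := h.isCompact_setOf_sqDist_le hz hR.le
  set T := {x | q x ≤ R ^ 2} with hT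
  have hs1 : 0 < √(1 + η) := Real.sqrt_pos.2 (by linarith)
  -- the inequality for one cut-off bubble and a weight below one
  have key : ∀ ρ ∈ Ioo (0 : ℝ) 1, ∀ N : ℕ,
      ρ * ψ 1 * ρ * (n / √(1 + η) ^ (n + 2)) * (c * ∫ y : P.1, cutBubble n N y) ≤ Q := by
    intro ρ hρ N
    have hlim := (hc (cutBubble n N) (continuous_cutBubble _)
        (hasCompactSupport_cutBubble _)).const_mul
      (ρ * ψ 1 * ρ * (n / √(1 + η) ^ (n + 2)))
    refine le_of_tendsto hlim ?_
    have hev1 : ∀ᶠ ε in 𝓝[>] (0 : ℝ), ∀ x, ‖x - z‖ ≤ (N + 1) * ε → ρ * ψ 1 ≤ ψ (height d x) := by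
      have h1 : ∀ᶠ x in 𝓝 z, ρ * ψ 1 < ψ (height d x) := by
        refine (hψ.continuous.comp hhc).continuousAt.eventually_const_lt ?_
        simp only [Function.comp_apply, hhz]
        nlinarith [hρ.2]
      obtain ⟨δ, hδ, hball⟩ := Metric.eventually_nhds_iff.1 h1
      have h2 : Continuous fun ε : ℝ => ((N : ℝ) + 1) * ε := by fun_prop
      have h4 : ∀ᶠ ε in 𝓝 (0 : ℝ), ((N : ℝ) + 1) * ε < δ :=
        (h2.tendsto 0).eventually_lt_const (by simpa using hδ)
      filter_upwards [h4.filter_mono nhdsWithin_le_nhds] with ε hε x hx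
      exact (hball (by rw [dist_eq_norm]; linarith)).le
    filter_upwards [hQ, hev1, eventually_le_kernelWeight hn ha0 hσ hR hρ.2 (√(1 + η) * (N + 1)),
      self_mem_nhdsWithin] with ε hεQ hε1 hε2 hε
    have hε0 : 0 < ε := hε
    have hε' : 0 < ε ^ 2 := by positivity
    have hm : ∀ x, q x ∈ Ioi (-ε ^ 2) := fun x => by
      rw [mem_Ioi]
      linarith [hq0 x]
    have hw : ∀ x, 0 < regDist ε (q x) := fun x => regDist_pos (hm x)
    refine le_trans ?_ hεQ
    rw [← mul_assoc, ← integral_const_mul]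
    have hint : Integrable (fun x => ψ (height d x) * (kernelWeight n a ε σ R (q x) *
        (n * ε ^ 2 / regDist ε (q x) ^ (n + 2)))) V.mass := by
      rw [← integrableOn_iff_integrable_of_support_subset (s := T) fun x hx => by
        by_contra hx'
        refine hx ?_
        simp only [kernelWeight_eq_zero ha0 hn hε0 (not_le.1 hx').le, zero_mul, mul_zero]]
      have hcont : Continuous (fun x => ψ (height d x) * (kernelWeight n a ε σ R (q x) *
          (n * ε ^ 2 / regDist ε (q x) ^ (n + 2)))) := by
        refine (hψ.continuous.comp hhc).mul (((continuousOn_kernelWeight hσ).comp_continuous hqc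
          hm).mul (continuous_const.div ?_ fun x => (pow_pos (hw x) _).ne'))
        unfold regDist
        fun_prop
      obtain ⟨C, hC⟩ := hTc.exists_bound_of_continuousOn hcont.continuousOn
      exact Measure.integrableOn_of_bounded hfin hcont.aestronglyMeasurable
        (ae_restrict_of_forall_mem hTc.isClosed.measurableSet hC)
    have hA0 : ∀ x, 0 ≤ ψ (height d x) * (kernelWeight n a ε σ R (q x) *
        (n * ε ^ 2 / regDist ε (q x) ^ (n + 2))) := fun x =>
      mul_nonneg (hψ.nonneg _) (mul_nonneg (kernelWeight_nonneg _)
        (div_nonneg (by positivity) (pow_pos (hw x) _).le))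
    refine integral_mono_of_nonneg (Eventually.of_forall fun x => ?_) hint
      (Eventually.of_forall fun x => ?_)
    · have := cutBubble_nonneg (n := n) N (ε⁻¹ • (x - z))
      have := hρ.1
      simp only [Pi.zero_apply]
      positivity
    · simp only
      rcases le_or_gt ‖x - z‖ ((N + 1) * ε) with hx | hx
      · have hqx : q x ≤ (√(1 + η) * (N + 1) * ε) ^ 2 := by
          refine (h.sqDist_le hz x).trans ?_
          rw [mul_assoc, mul_pow, Real.sq_sqrt (by linarith)]
          gcongr
        have hk := hε2 (q x) (hq0 x) hqx
        have hf := hε1 x hx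
        have hcut := cutBubble_le (n := n) N (ε⁻¹ • (x - z))
        have hv : ‖ε⁻¹ • (x - z)‖ = ‖x - z‖ / ε := by
          rw [norm_smul, norm_inv, Real.norm_of_nonneg hε0.le, inv_mul_eq_div]
        rw [hv] at hcut
        have hS : 0 < √(1 + (‖x - z‖ / ε) ^ 2) := Real.sqrt_pos.2 (by positivity)
        have hwle : regDist ε (q x) ≤ √(1 + η) * (ε * √(1 + (‖x - z‖ / ε) ^ 2)) := by
          refine Real.sqrt_le_iff.2 ⟨by positivity, ?_⟩
          rw [mul_pow, mul_pow, Real.sq_sqrt (by linarith), Real.sq_sqrt (by positivity)]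
          have h5 : ε ^ 2 * (1 + (‖x - z‖ / ε) ^ 2) = ε ^ 2 + ‖x - z‖ ^ 2 := by
            field_simp
          rw [h5]
          nlinarith [h.sqDist_le hz x]
        have hbub : (n / √(1 + η) ^ (n + 2)) * ((ε ^ n)⁻¹ *
            (1 / √(1 + (‖x - z‖ / ε) ^ 2) ^ (n + 2))) ≤
            n * ε ^ 2 / regDist ε (q x) ^ (n + 2) := by
          calc (n / √(1 + η) ^ (n + 2)) * ((ε ^ n)⁻¹ *
                (1 / √(1 + (‖x - z‖ / ε) ^ 2) ^ (n + 2)))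
              = n * ε ^ 2 / (√(1 + η) * (ε * √(1 + (‖x - z‖ / ε) ^ 2))) ^ (n + 2) := by
                rw [mul_pow, mul_pow]
                field_simp
                ring
            _ ≤ _ := by
                have := pow_pos (hw x) (n + 2)
                gcongr
                exact (hw x).le
        calc ρ * ψ 1 * ρ * (n / √(1 + η) ^ (n + 2)) * (ε ^ n)⁻¹ * cutBubble n N (ε⁻¹ • (x - z))
            ≤ ρ * ψ 1 * ρ * (n / √(1 + η) ^ (n + 2)) * (ε ^ n)⁻¹ *
              (1 / √(1 + (‖x - z‖ / ε) ^ 2) ^ (n + 2)) := by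
              have := hρ.1
              gcongr
          _ = ρ * ψ 1 * (ρ * ((n / √(1 + η) ^ (n + 2)) * ((ε ^ n)⁻¹ *
              (1 / √(1 + (‖x - z‖ / ε) ^ 2) ^ (n + 2))))) := by ring
          _ ≤ _ := by
              have := hρ.1
              exact mul_le_mul hf (mul_le_mul hk hbub (by positivity) (kernelWeight_nonneg _))
                (by positivity) (hψ.nonneg _)
      · rw [cutBubble_eq_zero, mul_zero]
        · exact hA0 x
        · rw [norm_smul, norm_inv, Real.norm_of_nonneg hε0.le, inv_mul_eq_div, le_div_iff₀ hε0]
          exact hx.le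
  have key2 : ∀ ρ ∈ Ioo (0 : ℝ) 1,
      ρ * ψ 1 * ρ * (n / √(1 + η) ^ (n + 2)) * (c * unitBallVolume n) ≤ Q := fun ρ hρ =>
    le_of_tendsto (((tendsto_integral_cutBubble P hn).const_mul c).const_mul _)
      (Eventually.of_forall (key ρ hρ))
  have hcont : Continuous fun ρ : ℝ =>
      ρ * ψ 1 * ρ * (n / √(1 + η) ^ (n + 2)) * (c * unitBallVolume n) := by fun_prop
  have hlim := (hcont.tendsto 1).mono_left (nhdsWithin_le_nhds (s := Iio 1))
  rw [one_mul, mul_one] at hlim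
  refine le_of_tendsto hlim ?_
  filter_upwards [Ioo_mem_nhdsLT zero_lt_one] with ρ hρ using key2 ρ hρ

/-- The mean value inequality at a point `z` of depth `d` and density at least `√(1 - η) ^ n`. The
error consists of a part proportional to `η` and of the tilt-excess, which enters only if `ψ` fails
to be convex, that is, if `b ≠ 0`. -/
theorem IsAlmostMinimal.mean_value (h : IsAlmostMinimal V H η)
    (hψ : IsHeightProfile ψ ψ₁ ψ₂ K M M' b) (hψ1 : 0 < ψ 1) (hn : 1 ≤ n) (hz : z ∈ halfBall n)
    (hz' : ‖z‖ < 1 / 8) (hd : 0 < d) (hzd : z 0 = -d) (hdR : 2 * d ≤ R) (hRK : R ≤ K * d)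
    (hR' : R ≤ 1 / 4) (ha : a = absorbConst n K M' * η) (ha' : a ≤ 1 / 2) (ha0 : 0 ≤ a)
    {P : Gr n} {c : ℝ} (hc : HasBlowUp V.mass z P c) (hc0 : √(1 - η) ^ n ≤ c) :
    ψ 1 * (√(1 - η) ^ n / √(1 + η) ^ (n + 2)) * unitBallVolume n ≤
      profile n a R * ∫ x in {x | sqDist (g.toFun z) z x ≤ R ^ 2}, ψ (height d x) ∂V.mass +
        farConst n K M / d ^ n *
          (η * V.mass.real {x | sqDist (g.toFun z) z x ≤ R ^ 2} +
            b * ∫ x in {x | sqDist (g.toFun z) z x ≤ R ^ 2},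
              ‖(V.tangent x).proj - wallProj n‖ ^ 2 ∂V.mass) := by
  have hη0 := h.nonneg
  have hR : 0 < R := by linarith
  have hfin := h.mass_setOf_sqDist_le_ne_top hz hz' hR.le hR'
  set T := {x | sqDist (g.toFun z) z x ≤ R ^ 2} with hT
  set I := ∫ x in T, ψ (height d x) ∂V.mass with hI
  have hI0 : 0 ≤ I := integral_nonneg fun x => hψ.nonneg _
  set E := η * V.mass.real T + b * ∫ x in T, ‖(V.tangent x).proj - wallProj n‖ ^ 2 ∂V.mass with hE
  have hE0 : 0 ≤ E := add_nonneg (mul_nonneg hη0 measureReal_nonneg)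
    (mul_nonneg hψ.convexity_nonneg (integral_nonneg fun x => sq_nonneg _))
  have hF0 : 0 ≤ farConst n K M / d ^ n := by
    have := hψ.one_le
    have := hψ.bound_nonneg
    unfold farConst
    positivity
  set F := farConst n K M / d ^ n with hF
  have hn0 : (1 : ℝ) ≤ n := by exact_mod_cast hn
  have hs : 0 ≤ √(1 - η) ^ n := by positivity
  have hs1 : 0 < √(1 + η) := Real.sqrt_pos.2 (by linarith)
  have key : ∀ σ ∈ Ioc (0 : ℝ) (1 / (4 * d ^ n)),
      ψ 1 * (n / √(1 + η) ^ (n + 2)) * (c * unitBallVolume n) ≤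
        n * (σ + profile n a R) * I + F * E := by
    intro σ hσ
    refine h.le_of_forall_integral_le hψ hψ1 hn hz hd hzd ha0 hσ.1 hR hc hfin ?_
    have hev : ∀ᶠ ε in 𝓝[>] (0 : ℝ), ε ≤ d / 4 :=
      (eventually_le_nhds (by linarith)).filter_mono nhdsWithin_le_nhds
    filter_upwards [hev, self_mem_nhdsWithin] with ε hε hε0
    have hε0' : 0 < ε := hε0
    refine (h.integral_kernelWeight_le hψ hn hz hz' hd hzd hdR hRK hR' ha ha' ha0 hε0' hε hσ.1
      hσ.2).trans ?_
    have : profile n a (regDist ε (R ^ 2)) ≤ profile n a R :=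
      profile_le ha0 hR hn (Real.le_sqrt_of_sq_le (by nlinarith))
    gcongr
  have key2 : ψ 1 * (n / √(1 + η) ^ (n + 2)) * (c * unitBallVolume n) ≤
      n * (0 + profile n a R) * I + F * E := by
    have hcont : Continuous fun σ : ℝ => n * (σ + profile n a R) * I + F * E := by fun_prop
    refine ge_of_tendsto ((hcont.tendsto 0).mono_left (nhdsWithin_le_nhds (s := Ioi 0))) ?_
    filter_upwards [Ioc_mem_nhdsGT (show (0 : ℝ) < 1 / (4 * d ^ n) by positivity)] with σ hσ
      using key σ hσ
  have hω := unitBallVolume_pos n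
  have h1 : n * (ψ 1 * (√(1 - η) ^ n / √(1 + η) ^ (n + 2)) * unitBallVolume n) ≤
      n * (profile n a R * I + F * E) := by
    calc n * (ψ 1 * (√(1 - η) ^ n / √(1 + η) ^ (n + 2)) * unitBallVolume n)
        = ψ 1 * (n / √(1 + η) ^ (n + 2)) * (√(1 - η) ^ n * unitBallVolume n) := by ring
      _ ≤ ψ 1 * (n / √(1 + η) ^ (n + 2)) * (c * unitBallVolume n) := by gcongr
      _ ≤ n * (profile n a R) * I + F * E := by simpa using key2
      _ ≤ n * (profile n a R * I + F * E) := by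
        have : 0 ≤ F * E := by positivity
        nlinarith
  exact le_of_mul_le_mul_left h1 (by linarith)

end

end BoundaryRigidity

/-! ### Height profiles and the density bound at the wall -/

namespace BoundaryRigidity

open C1Metric

variable {n : ℕ}

/-- The bound on the derivatives of the cubic profile on the range `|t| ≤ 1 + 2 * K`. -/
noncomputable def cubicBound (K : ℝ) : ℝ := 6 * (64 / 27) * (1 + 2 * K) ^ 2

/-- The cubic height profile, normalised to be one at height one. -/
noncomputable def cubicProfile (t : ℝ) : ℝ := 64 / 27 * max (t - 1 / 4) 0 ^ 3

theorem hasDerivAt_max_zero_pow_three (s : ℝ) :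
    HasDerivAt (fun s : ℝ => max s 0 ^ 3) (3 * max s 0 ^ 2) s := by
  rcases lt_trichotomy s 0 with h | h | h
  · rw [max_eq_right h.le]
    refine ((hasDerivAt_const s (0 : ℝ)).congr_deriv (by norm_num)).congr_of_eventuallyEq ?_
    filter_upwards [Iio_mem_nhds h] with y hy
    simp [max_eq_right (le_of_lt (mem_Iio.1 hy))]
  · subst h
    rw [max_self, hasDerivAt_iff_isLittleO]
    simp only [max_self, sub_zero, smul_eq_mul]
    norm_num
    refine Asymptotics.IsLittleO.of_bound fun c hc => ?_
    filter_upwards [Metric.ball_mem_nhds (0 : ℝ) (lt_min hc one_pos)] with y hy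
    rw [mem_ball_zero_iff, lt_min_iff] at hy
    have h1 : |max y 0| ≤ ‖y‖ := by
      rw [abs_of_nonneg (le_max_right _ _)]
      exact max_le (le_abs_self y) (norm_nonneg y)
    rw [Real.norm_eq_abs, abs_pow]
    have h0 := norm_nonneg y
    calc |max y 0| ^ 3 ≤ ‖y‖ ^ 3 := by gcongr
      _ = ‖y‖ * ‖y‖ * ‖y‖ := by ring
      _ ≤ c * 1 * ‖y‖ := by
        gcongr
        · exact hy.1.le
        · exact hy.2.le
      _ = c * ‖y‖ := by ring
  · rw [max_eq_left h.le]
    refine ((hasDerivAt_pow 3 s).congr_deriv (by norm_num)).congr_of_eventuallyEq ?_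
    filter_upwards [Ioi_mem_nhds h] with y hy
    simp [max_eq_left (le_of_lt (mem_Ioi.1 hy))]

theorem isHeightProfile_cubicProfile {K : ℝ} (hK : 1 ≤ K) :
    IsHeightProfile cubicProfile (fun t => 64 / 27 * (3 * max (t - 1 / 4) 0 ^ 2))
      (fun t => 64 / 27 * (3 * (2 * max (t - 1 / 4) 0))) K (cubicBound K) 96 0 where
  hasDerivAt t := by
    have h := (hasDerivAt_max_zero_pow_three (t - 1 / 4)).comp t
        ((hasDerivAt_id t).sub_const (1 / 4))
    exact (h.const_mul (64 / 27)).congr_deriv (by simp)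
  hasDerivAt_deriv t := by
    have h := (hasDerivAt_max_zero_sq (t - 1 / 4)).comp t ((hasDerivAt_id t).sub_const (1 / 4))
    simpa using (h.const_mul 3).const_mul (64 / 27)
  continuous_deriv := by fun_prop
  nonneg t := by
    have : 0 ≤ max (t - 1 / 4) 0 := le_max_right _ _
    unfold cubicProfile
    positivity
  exists_eq_zero := ⟨1 / 4, by norm_num, fun t ht => by
    rw [cubicProfile, max_eq_right (sub_nonpos.2 ht)]
    simp⟩
  one_le := hK
  bound_nonneg := by
    unfold cubicBound
    positivity
  near_bound_nonneg := by norm_num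
  convexity_nonneg := le_rfl
  abs_le t ht := by
    have h0 : 0 ≤ max (t - 1 / 4) 0 := le_max_right _ _
    have h1 : max (t - 1 / 4) 0 ≤ 1 + 2 * K :=
      max_le (by linarith [le_abs_self t]) (by linarith)
    have h2 : max (t - 1 / 4) 0 ^ 2 ≤ (1 + 2 * K) ^ 2 := by gcongr
    rw [abs_of_nonneg (by positivity), abs_of_nonneg (by positivity), cubicBound]
    constructor <;> nlinarith
  near t ht := by
    have h1 := (abs_le.1 ht).1
    have h2 : max (t - 1 / 4) 0 = t - 1 / 4 := max_eq_left (by linarith)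
    simp only [cubicProfile]
    rw [h2]
    set m := t - 1 / 4 with hm
    have h3 : 1 / 4 ≤ m := by linarith
    have h4 : 0 ≤ m := by linarith
    rw [abs_of_nonneg (by positivity), abs_of_nonneg (by positivity)]
    refine ⟨?_, ?_, by positivity⟩
    · have : 0 ≤ m ^ 2 * (m - 1 / 4) := mul_nonneg (sq_nonneg m) (by linarith)
      nlinarith
    · have : 0 ≤ m * ((m - 1 / 4) * (m + 1 / 4)) :=
        mul_nonneg h4 (mul_nonneg (by linarith) (by linarith))
      nlinarith
  neg_le t := by
    have : 0 ≤ max (t - 1 / 4) 0 := le_max_right _ _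
    have h : 0 ≤ 64 / 27 * (3 * (2 * max (t - 1 / 4) 0)) := by positivity
    linarith

theorem cubicProfile_one : cubicProfile 1 = 1 := by
  rw [cubicProfile, max_eq_left (by norm_num)]
  norm_num

theorem monotone_cubicProfile : Monotone cubicProfile := fun s t h => by
  unfold cubicProfile
  gcongr

theorem continuous_cubicProfile : Continuous cubicProfile :=
  (isHeightProfile_cubicProfile le_rfl).continuous

/-- A bounded height profile that is identically one near height one. -/
theorem exists_isHeightProfile_le_one :
    ∃ (ψ ψ₁ ψ₂ : ℝ → ℝ) (M : ℝ), (∀ t, ψ t ≤ 1) ∧ ψ 1 = 1 ∧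
      ∀ K, 1 ≤ K → IsHeightProfile ψ ψ₁ ψ₂ K M 0 M := by
  let f : ContDiffBump (1 : ℝ) := ⟨5 / 8, 3 / 4, by norm_num, by norm_num⟩
  have hf : ContDiff ℝ 2 f := f.contDiff
  have hf1 : ContDiff ℝ 1 (deriv f) := ((contDiff_succ_iff_deriv (n := 1)).1 hf).2.2
  have hf2 : Continuous (deriv (deriv f)) := hf1.continuous_deriv le_rfl
  obtain ⟨M₁, hM₁⟩ := (f.hasCompactSupport.deriv).exists_bound_of_continuous hf1.continuous
  obtain ⟨M₂, hM₂⟩ := (f.hasCompactSupport.deriv.deriv).exists_bound_of_continuous hf2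
  have h1 : ∀ t, |deriv f t| ≤ max M₁ M₂ := fun t => (hM₁ t).trans (le_max_left _ _)
  have h2 : ∀ t, |deriv (deriv f) t| ≤ max M₁ M₂ := fun t => (hM₂ t).trans (le_max_right _ _)
  have hM : 0 ≤ max M₁ M₂ := (abs_nonneg _).trans (h1 0)
  have hone : ∀ t ∈ ball (1 : ℝ) (5 / 8), f t = 1 := fun t ht =>
    f.one_of_mem_closedBall (ball_subset_closedBall ht)
  have hd1 : ∀ t ∈ ball (1 : ℝ) (5 / 8), deriv f t = 0 := fun t ht => by
    have : (f : ℝ → ℝ) =ᶠ[𝓝 t] fun _ => 1 := by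
      filter_upwards [isOpen_ball.mem_nhds ht] with s hs using hone s hs
    rw [this.deriv_eq, deriv_const]
  have hd2 : ∀ t ∈ ball (1 : ℝ) (5 / 8), deriv (deriv f) t = 0 := fun t ht => by
    have : deriv f =ᶠ[𝓝 t] fun _ => 0 := by
      filter_upwards [isOpen_ball.mem_nhds ht] with s hs using hd1 s hs
    rw [this.deriv_eq, deriv_const]
  refine ⟨f, deriv f, deriv (deriv f), max M₁ M₂, fun t => f.le_one,
    hone 1 (mem_ball_self (by norm_num)), fun K hK => ?_⟩
  exact
    { hasDerivAt := fun t => (hf.differentiable (by norm_num) t).hasDerivAt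
      hasDerivAt_deriv := fun t => (hf1.differentiable (by norm_num) t).hasDerivAt
      continuous_deriv := hf2
      nonneg := fun t => f.nonneg
      exists_eq_zero := ⟨1 / 4, by norm_num, fun t ht => f.zero_of_le_dist (by
        change (3 / 4 : ℝ) ≤ _
        rw [Real.dist_eq, abs_sub_comm, abs_of_nonneg (by linarith)]
        linarith)⟩
      one_le := hK
      bound_nonneg := hM
      near_bound_nonneg := le_rfl
      convexity_nonneg := hM
      abs_le := fun t _ => ⟨h1 t, h2 t⟩
      near := fun t ht => by
        have hm : t ∈ ball (1 : ℝ) (5 / 8) := by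
          rw [mem_ball, Real.dist_eq]
          linarith
        simp [hd1 t hm, hd2 t hm]
      neg_le := fun t => (neg_le_abs _).trans (h2 t) }

/-- An almost minimal varifold whose density ratios at the wall stay below `1 - α` and whose planes
are almost parallel to the wall. As `Measure.real` vanishes on sets of infinite measure, the
finiteness of the mass of balls is recorded separately. -/
structure IsAlmostWall (α : ℝ) {g : C1Metric (halfBall n)} (V : RectifiableVarifold g)
    (H : Space n → Space n) (η : ℝ) : Prop extends IsAlmostMinimal V H η where
  ball_ne_top : ∀ p : Space n, p 0 = 0 → ‖p‖ < 1 / 2 → ∀ r ∈ Ioo (0 : ℝ) (1 / 2),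
    V.mass (ball p r) ≠ ⊤
  density_le : ∀ p : Space n, p 0 = 0 → ‖p‖ < 1 / 2 → ∀ r ∈ Ioo (0 : ℝ) (1 / 2),
    V.mass.real (ball p r) ≤ (1 - α) * unitBallVolume n * r ^ n
  excess_le : ∫ x in ball 0 (7 / 16), ‖(V.tangent x).proj - wallProj n‖ ^ 2 ∂V.mass ≤ η
  ae_hasBlowUp : ∀ᵐ x ∂V.mass, x ∈ ball (0 : Space n) (7 / 16) →
    ∃ c ≥ √(1 - η) ^ n, HasBlowUp V.mass x (V.tangent x) c

/-- The arithmetic behind `exists_forall_not_ae_le`. -/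
theorem mean_value_terms_le {A F K S W ω R η b Q I m X p f : ℝ} (hω : 0 < ω) (hR : 0 < R)
    (hK : 0 ≤ K) (hA : 0 ≤ A * η) (hF : 0 ≤ F) (hη : 0 ≤ η) (hb : 0 ≤ b) (hS : 0 ≤ S)
    (hI : I ≤ S * m) (hI0 : 0 ≤ I) (hm : m ≤ W * ω * R ^ n) (hX : X ≤ η) (hX0 : 0 ≤ η * m + b * X)
    (hp : p ≤ (1 + A * η) / R ^ n) (hf : f ≤ F * (K / R) ^ n) (hQ : b * (K / R) ^ n ≤ Q) :
    p * I + f * (η * m + b * X) ≤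
      (W * ((1 + A * η) * S + F * K ^ n * η) + F * Q * η / ω) * ω := by
  have h3 : I ≤ S * (W * ω * R ^ n) := hI.trans (mul_le_mul_of_nonneg_left hm hS)
  have h4 : 0 ≤ (1 + A * η) / R ^ n := by positivity
  have h5 : η * m + b * X ≤ η * (W * ω * R ^ n) + b * η := by gcongr
  calc p * I + f * (η * m + b * X)
      ≤ (1 + A * η) / R ^ n * (S * (W * ω * R ^ n)) +
        F * (K / R) ^ n * (η * (W * ω * R ^ n) + b * η) := by
        refine add_le_add (mul_le_mul hp h3 hI0 h4) (mul_le_mul hf h5 hX0 ?_)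
        positivity
    _ = (W * ((1 + A * η) * S + F * K ^ n * η)) * ω + F * η * (b * (K / R) ^ n) := by
        rw [div_pow]
        field_simp
        ring
    _ ≤ (W * ((1 + A * η) * S + F * K ^ n * η)) * ω + F * η * Q :=
        add_le_add le_rfl (mul_le_mul_of_nonneg_left hQ (mul_nonneg hF hη))
    _ = _ := by
        field_simp

/-- For small `η` the mean value inequality is incompatible with the density bound at the wall:
the profile cannot stay below `S` on an ellipsoid that is large compared with the height of its
centre. -/
theorem exists_forall_not_ae_le {α : ℝ} (hn : 1 ≤ n) (hα : α ≤ 1) {ψ ψ₁ ψ₂ : ℝ → ℝ}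
    {K M M' b ρ S Q : ℝ} (hψ : IsHeightProfile ψ ψ₁ ψ₂ K M M' b) (hψ1 : ψ 1 = 1) (hρ : 0 ≤ ρ)
    (hρ' : ρ ≤ 1 / 16) (hS : (1 - α) * (1 + 2 * ρ) ^ n * S < 1) (hS0 : 0 ≤ S) :
    ∃ η₀ > 0, ∀ (g : C1Metric (halfBall n)) (V : RectifiableVarifold g) (H : Space n → Space n)
      (η : ℝ), η ≤ η₀ → IsAlmostWall α V H η → ∀ z ∈ halfBall n, ‖z‖ < 1 / 8 →
      (∃ c ≥ √(1 - η) ^ n, HasBlowUp V.mass z (V.tangent z) c) →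
      ∀ d R : ℝ, z 0 = -d → d ≤ ρ * R → R ≤ K * d → R ≤ 1 / 4 → b * (K / R) ^ n ≤ Q →
      ¬ ∀ᵐ x ∂V.mass, sqDist (g.toFun z) z x ≤ R ^ 2 → ψ (height d x) ≤ S := by
  set A := absorbConst n K M' with hA
  set F := farConst n K M with hF
  have hK := hψ.one_le
  have hM := hψ.bound_nonneg
  have hM' := hψ.near_bound_nonneg
  have hb := hψ.convexity_nonneg
  have hA0 : 0 ≤ A := by
    rw [hA]
    unfold absorbConst
    positivity
  have hF0 : 0 ≤ F := by
    rw [hF]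
    unfold farConst
    positivity
  have hω := unitBallVolume_pos n
  have hev1 : ∀ᶠ η in 𝓝 (0 : ℝ), (1 - α) * (1 + η + 2 * ρ) ^ n * ((1 + A * η) * S + F * K ^ n * η) +
      F * Q * η / unitBallVolume n < √(1 - η) ^ n / √(1 + η) ^ (n + 2) := by
    have h1 : ContinuousAt (fun η : ℝ => (1 - α) * (1 + η + 2 * ρ) ^ n *
        ((1 + A * η) * S + F * K ^ n * η) + F * Q * η / unitBallVolume n) 0 := by fun_prop
    have h2 : ContinuousAt (fun η : ℝ => √(1 - η) ^ n / √(1 + η) ^ (n + 2)) 0 := by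
      refine ContinuousAt.div (by fun_prop) (by fun_prop) ?_
      simp
    refine h1.eventually_lt h2 ?_
    simpa using hS
  have hev2 : ∀ᶠ η in 𝓝 (0 : ℝ), A * η < 1 / 2 := by
    have h1 : Continuous fun η : ℝ => A * η := by fun_prop
    exact (h1.tendsto 0).eventually_lt_const (by simp)
  obtain ⟨δ, hδ, hball⟩ := Metric.eventually_nhds_iff.1 (hev1.and hev2)
  refine ⟨δ / 2, by positivity, ?_⟩
  intro g V H η hη h z hz hz' ⟨c, hc, hblow⟩ d R hzd hdρ hRK hR hQ hae
  have hη0 := h.nonneg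
  have hη4 := h.le
  obtain ⟨hlt, ha'⟩ := hball (y := η) (by
    rw [Real.dist_eq, sub_zero, abs_of_nonneg hη0]
    linarith)
  have hd : 0 < d := by
    have : z 0 < 0 := hz.2
    linarith
  have hR0 : 0 < R := by nlinarith
  have hmv := h.mean_value hψ (by rw [hψ1]; exact one_pos) hn hz hz' hd hzd (by nlinarith) hRK hR
    rfl ha'.le (mul_nonneg hA0 hη0) hblow hc
  rw [hψ1, one_mul, ← hA, ← hF] at hmv
  have hfin := h.mass_setOf_sqDist_le_ne_top hz hz' hR0.le hR
  have hTc := h.isCompact_setOf_sqDist_le hz hR0.le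
  have hTsub : {x | sqDist (g.toFun z) z x ≤ R ^ 2} ⊆ ball 0 (7 / 16) := fun x hx => by
    simpa using h.norm_le_of_sqDist_le hz hz' hR0.le hR hx
  have hTsub' : {x | sqDist (g.toFun z) z x ≤ R ^ 2} ⊆ closedBall z (R * (1 + η)) := fun x hx => by
    rw [mem_closedBall, dist_eq_norm]
    exact h.norm_sub_le_of_sqDist_le hz hR0.le hx
  set T := {x | sqDist (g.toFun z) z x ≤ R ^ 2} with hT
  have hTm : MeasurableSet T := hTc.isClosed.measurableSet
  -- the mass of the ellipsoid, from the density at the foot of `z` on the wall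
  set p : Space n := z + EuclideanSpace.single 0 d with hp
  have hp0 : p 0 = 0 := by simp [hp, hzd]
  have hzp : dist z p = d := by
    rw [hp, dist_self_add_right, PiLp.norm_single, Real.norm_of_nonneg hd.le]
  have hd8 : d ≤ 1 / 64 := by nlinarith
  have hr : R * (1 + η) + 2 * d ∈ Ioo (0 : ℝ) (1 / 2) := ⟨by positivity, by nlinarith⟩
  have hpn : ‖p‖ < 1 / 2 := by
    have h1 : ‖p‖ ≤ ‖z‖ + d := by
      refine (norm_add_le _ _).trans ?_
      rw [PiLp.norm_single, Real.norm_of_nonneg hd.le]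
    linarith
  have hmass : V.mass.real T ≤ (1 - α) * unitBallVolume n * (R ^ n * (1 + η + 2 * ρ) ^ n) := by
    have hsub1 : T ⊆ ball p (R * (1 + η) + 2 * d) := fun x hx => by
      have h1 := hTsub' hx
      rw [mem_closedBall] at h1
      rw [mem_ball]
      linarith [dist_triangle x z p]
    calc V.mass.real T ≤ V.mass.real (ball p (R * (1 + η) + 2 * d)) :=
          measureReal_mono hsub1 (h.ball_ne_top p hp0 hpn _ hr)
      _ ≤ (1 - α) * unitBallVolume n * (R * (1 + η) + 2 * d) ^ n := h.density_le p hp0 hpn _ hr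
      _ ≤ _ := by
        have h1 : 0 ≤ 1 - α := by linarith
        rw [← mul_pow]
        refine mul_le_mul_of_nonneg_left (pow_le_pow_left₀ hr.1.le ?_ n) (mul_nonneg h1 hω.le)
        linarith
  have hI : ∫ x in T, ψ (height d x) ∂V.mass ≤ S * V.mass.real T := by
    have h1 : ∫ x in T, ψ (height d x) ∂V.mass ≤ ∫ _ in T, S ∂V.mass := by
      refine integral_mono_of_nonneg (Eventually.of_forall fun x => hψ.nonneg _)
        (integrableOn_const hfin) ((ae_restrict_iff' hTm).2 hae)
    rwa [setIntegral_const, smul_eq_mul, mul_comm] at h1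
  have hX : ∫ x in T, ‖(V.tangent x).proj - wallProj n‖ ^ 2 ∂V.mass ≤ η :=
    (setIntegral_mono_set (V.integrableOn_tilt_sq h.mass_ne_top)
      (Eventually.of_forall fun x => sq_nonneg _) hTsub.eventuallyLE).trans h.excess_le
  set W := (1 - α) * (1 + η + 2 * ρ) ^ n with hW
  have hW0 : 0 ≤ W := mul_nonneg (by linarith) (by positivity)
  have hmass' : V.mass.real T ≤ W * unitBallVolume n * R ^ n := by
    refine hmass.trans (le_of_eq ?_)
    rw [hW]
    ring
  have hprof : profile n (A * η) R ≤ (1 + A * η) / R ^ n := by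
    unfold profile
    have : A * η * R ≤ A * η := mul_le_of_le_one_right (mul_nonneg hA0 hη0) (by linarith)
    gcongr
  have hdn : F / d ^ n ≤ F * (K / R) ^ n := by
    rw [div_eq_mul_inv]
    refine mul_le_mul_of_nonneg_left ?_ hF0
    rw [← inv_pow]
    have : d⁻¹ ≤ K / R := by
      rw [le_div_iff₀ hR0, inv_mul_le_iff₀ hd]
      linarith
    gcongr
  have hX0 : 0 ≤ ∫ x in T, ‖(V.tangent x).proj - wallProj n‖ ^ 2 ∂V.mass :=
    integral_nonneg fun x => sq_nonneg _
  have hmain := hmv.trans (mean_value_terms_le hω hR0 (by linarith) (mul_nonneg hA0 hη0) hF0 hη0 hb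
    hS0 hI (integral_nonneg fun x => hψ.nonneg _) hmass' hX
    (add_nonneg (mul_nonneg hη0 measureReal_nonneg) (mul_nonneg hb hX0)) hprof hdn hQ)
  exact absurd (le_of_mul_le_mul_right hmain hω) (not_le.2 hlt)

end BoundaryRigidity

/-! ### Point picking and conclusion -/

namespace BoundaryRigidity

open C1Metric

variable {n : ℕ}

/-- Point picking: a point `z` that almost maximises `u - l * dist · x₀`. -/
theorem exists_almost_maximal {E : Type*} [SeminormedAddCommGroup E] {S : Set E} {u : E → ℝ}
    {δ l τ : ℝ} (hl : 0 ≤ l) (hτ : 0 < τ) (hτ' : τ ≤ 1) (hu : ∀ x ∈ S, u x ≤ δ) {x₀ : E}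
      (hx₀ : x₀ ∈ S)
    (hux₀ : 0 < u x₀) :
    ∃ z ∈ S, l * ‖z - x₀‖ ≤ u z ∧ ∀ x ∈ S, u x ≤ (1 + τ / 2) * u z + l * ‖x - z‖ := by
  set φ : E → ℝ := fun x => u x - l * ‖x - x₀‖ with hφ
  have hbdd : BddAbove (φ '' S) := by
    refine ⟨δ, ?_⟩
    rintro _ ⟨x, hx, rfl⟩
    have := hu x hx
    have : 0 ≤ l * ‖x - x₀‖ := by positivity
    simp only [hφ]
    linarith
  set m := sSup (φ '' S) with hm
  have hm0 : 0 < m := by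
    refine hux₀.trans_le ?_
    have := le_csSup hbdd (mem_image_of_mem φ hx₀)
    simpa [hφ] using this
  obtain ⟨_, ⟨z, hz, rfl⟩, hlt⟩ := exists_lt_of_lt_csSup ((nonempty_of_mem hx₀).image φ)
    (show m - τ / 4 * m < m by nlinarith)
  have h0 : 0 ≤ l * ‖z - x₀‖ := by positivity
  have hτm : τ / 4 * m ≤ m / 2 := by nlinarith
  simp only [hφ] at hlt
  refine ⟨z, hz, by linarith, fun x hx => ?_⟩
  have h1 := le_csSup hbdd (mem_image_of_mem φ hx)
  rw [← hm] at h1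
  simp only [hφ] at h1
  have h2 : l * ‖x - x₀‖ ≤ l * (‖x - z‖ + ‖z - x₀‖) := by
    gcongr
    exact norm_sub_le_norm_sub_add_norm_sub x z x₀
  have h3 : τ / 4 * m ≤ τ / 4 * (2 * u z) := by
    gcongr
    linarith
  nlinarith

/-- An almost minimal varifold with small density ratios at the wall has no mass near the origin. -/
theorem exists_forall_mass_ball_eq_zero {α : ℝ} (hn : 1 ≤ n) (hα₀ : 0 < α) (hα₁ : α ≤ 1) :
    ∃ η₀ γ : ℝ, 0 < η₀ ∧ 0 < γ ∧ γ < 1 ∧ ∀ (g : C1Metric (halfBall n)) (V : RectifiableVarifold g)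
      (H : Space n → Space n) (η : ℝ), η ≤ η₀ → IsAlmostWall α V H η → V.mass (ball 0 γ) = 0 := by
  -- one parameter `τ` serves as the relative gain in depth and as the inverse of the scale `K`
  obtain ⟨τ, hτ, hτ16, hτS⟩ : ∃ τ : ℝ, 0 < τ ∧ τ ≤ 1 / 16 ∧
      (1 - α) * (1 + 2 * τ) ^ n * cubicProfile (1 + τ) < 1 := by
    have h1 : ContinuousAt (fun τ : ℝ => (1 - α) * (1 + 2 * τ) ^ n * cubicProfile (1 + τ)) 0 := by
      have := continuous_cubicProfile
      fun_prop
    have h2 : ∀ᶠ τ in 𝓝[>] (0 : ℝ), (1 - α) * (1 + 2 * τ) ^ n * cubicProfile (1 + τ) < 1 :=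
      (h1.eventually_lt_const (by simpa [cubicProfile_one] using hα₀)).filter_mono
        nhdsWithin_le_nhds
    obtain ⟨τ, h3, h4⟩ := (h2.and (Ioc_mem_nhdsGT (show (0 : ℝ) < 1 / 16 by norm_num))).exists
    exact ⟨τ, h4.1, h4.2, h3⟩
  have hS1 : 1 ≤ cubicProfile (1 + τ) :=
    cubicProfile_one.symm.le.trans (monotone_cubicProfile (by linarith))
  have hW0 : 0 ≤ (1 - α) * (1 + 2 * τ) ^ n := mul_nonneg (by linarith) (by positivity)
  have hK : 1 ≤ 1 / τ := by
    rw [le_div_iff₀ hτ]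
    linarith
  obtain ⟨ψ, ψ₁, ψ₂, M, hψle, hψ1, hψ⟩ := exists_isHeightProfile_le_one
  -- a bound for the depth of the points of positive density in the ball of radius `τ / 4`; it is
  -- small enough that the point picking and the ellipsoids of radius `K * δ` stay in that ball
  set δ := τ / 8 / (4 / τ ^ 2 + 2 / τ) with hδ
  have hD : 16 ≤ 2 / τ := by
    rw [le_div_iff₀ hτ]
    linarith
  have hD' : 0 < 4 / τ ^ 2 := by positivity
  have hδ0 : 0 < δ := by positivity
  have hδD : δ * (4 / τ ^ 2 + 2 / τ) = τ / 8 := div_mul_cancel₀ _ (by positivity)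
  have hδ4 : δ ≤ 1 / 4 := by nlinarith
  have hKδ : 1 / τ * δ ≤ 1 / 4 := by
    have h1 : 0 < δ * (4 / τ ^ 2) := by positivity
    have h2 : 1 / τ * δ = δ * (2 / τ) / 2 := by
      field_simp
    nlinarith
  have hKA : 1 ≤ 1 / (4 * δ) := by
    rw [le_div_iff₀ (by positivity)]
    linarith
  obtain ⟨ηA, hηA0, hA⟩ := exists_forall_not_ae_le (n := n) (Q := M * (1 / (4 * δ) / (1 / 4)) ^ n)
    hn hα₁ (hψ _ hKA) hψ1 hτ.le hτ16 (S := 1)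
    (lt_of_le_of_lt (mul_le_mul_of_nonneg_left hS1 hW0) hτS) zero_le_one
  obtain ⟨ηB, hηB0, hB⟩ := exists_forall_not_ae_le (n := n) (Q := 0)
    hn hα₁ (isHeightProfile_cubicProfile hK) cubicProfile_one hτ.le hτ16 hτS (by linarith)
  refine ⟨min ηA ηB, τ / 8, lt_min hηA0 hηB0, by positivity, by linarith, ?_⟩
  intro g V H η hη h
  have hη0 := h.nonneg
  have hη4 := h.le
  set S : Set (Space n) := {z | z ∈ halfBall n ∧ ‖z‖ < τ / 4 ∧
    ∃ c ≥ √(1 - η) ^ n, HasBlowUp V.mass z (V.tangent z) c} with hSdef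
  have hpos : ∀ z ∈ S, 0 < -(z 0) := fun z hz => neg_pos.2 hz.1.2
  -- points of positive density lie close to the wall
  have hshallow : ∀ z ∈ S, -(z 0) ≤ δ := by
    intro z hz
    by_contra! hlt
    have hzn := hz.2.1
    have hdz : -(z 0) ≤ ‖z‖ := (neg_le_abs _).trans (abs_apply_zero_le z)
    refine hA g V H η (hη.trans (min_le_left _ _)) h z hz.1 (by linarith) hz.2.2 (-(z 0)) (1 / 4)
      (neg_neg _).symm (by linarith) ?_ le_rfl le_rfl (Eventually.of_forall fun x _ => hψle _)
    rw [div_mul_eq_mul_div, one_mul, le_div_iff₀ (by positivity)]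
    linarith
  -- no such point is almost the deepest one at its own scale
  have hdeep : ∀ z ∈ S, ¬ ∀ x ∈ halfBall n, ‖x - z‖ ≤ 2 / τ * -(z 0) →
      (∃ c ≥ √(1 - η) ^ n, HasBlowUp V.mass x (V.tangent x) c) →
      -(x 0) ≤ (1 + τ) * -(z 0) := by
    intro z hz hmax
    have hzn := hz.2.1
    have hd := hpos z hz
    have hdδ := hshallow z hz
    have hR4 : 1 / τ * -(z 0) ≤ 1 / 4 := (by gcongr : 1 / τ * -(z 0) ≤ 1 / τ * δ).trans hKδ
    refine hB g V H η (hη.trans (min_le_right _ _)) h z hz.1 (by linarith) hz.2.2 (-(z 0))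
      (1 / τ * -(z 0)) (neg_neg _).symm ?_ le_rfl hR4 (by simp) ?_
    · rw [← mul_assoc, mul_one_div_cancel hτ.ne', one_mul]
    · filter_upwards [V.ae_mem_domain, h.ae_hasBlowUp] with x hx hblow hxT
      have hRn : 0 ≤ 1 / τ * -(z 0) := by positivity
      have hx7 := h.norm_le_of_sqDist_le hz.1 (by linarith) hRn hR4 hxT
      have hxz := h.norm_sub_le_of_sqDist_le hz.1 hRn hxT
      have hle := hmax x hx (hxz.trans (by
        have : 2 / τ = 1 / τ * 2 := by ring
        rw [this]
        nlinarith)) (hblow (by simpa using hx7))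
      refine monotone_cubicProfile ?_
      rw [height, div_le_iff₀ hd]
      exact hle
  have hempty : ∀ x₀ ∈ S, τ / 8 ≤ ‖x₀‖ := by
    intro x₀ hx₀
    by_contra! hlt
    obtain ⟨z, hz, hzx, hzmax⟩ := exists_almost_maximal (u := fun x : Space n => -(x 0))
      (l := τ ^ 2 / 4) (by positivity) hτ (by linarith) hshallow hx₀ (hpos x₀ hx₀)
    have hd := hpos z hz
    have hdδ := hshallow z hz
    refine hdeep z hz fun x hx hxz hblow => ?_
    have h1 : ‖z - x₀‖ ≤ δ * (4 / τ ^ 2) := by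
      rw [mul_div_assoc', le_div_iff₀ (by positivity)]
      linarith
    have h2 : ‖x - z‖ ≤ δ * (2 / τ) := by
      refine hxz.trans ?_
      rw [mul_comm]
      gcongr
    have h3 : ‖x‖ < τ / 4 := by
      have h4 : x = (x - z) + (z - x₀) + x₀ := by abel
      have h5 : ‖x‖ ≤ ‖x - z‖ + ‖z - x₀‖ + ‖x₀‖ := by
        conv_lhs => rw [h4]
        exact norm_add₃_le
      linarith
    have h6 := hzmax x ⟨hx, h3, hblow⟩
    have h7 : τ ^ 2 / 4 * ‖x - z‖ ≤ τ / 2 * -(z 0) := by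
      calc τ ^ 2 / 4 * ‖x - z‖ ≤ τ ^ 2 / 4 * (2 / τ * -(z 0)) := by gcongr
        _ = τ / 2 * -(z 0) := by
          field_simp
          ring
    linarith
  refine measure_eq_zero_iff_ae_notMem.2 ?_
  filter_upwards [V.ae_mem_domain, h.ae_hasBlowUp] with x hx hblow hxb
  rw [mem_ball_zero_iff] at hxb
  have := hempty x ⟨hx, by linarith, hblow (by rw [mem_ball_zero_iff]; linarith)⟩
  linarith

/-- The hypotheses of the boundary rigidity theorem give an `IsAlmostWall`. -/
theorem isAlmostWall_of_bounds {α η : ℝ} (hn : 1 ≤ n) (hα₁ : α < 1) (hη0 : 0 ≤ η) (hη4 : η ≤ 1 / 4)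
    {g : C1Metric (unitBall n)} {V : RectifiableVarifold (g.restrict (halfBall_le n))}
    {H ν : Space n → Space n} (hV : V.IsFirstVariationDecomposition H 0 ν)
    (hmult : ∀ᵐ x ∂V.mass, 1 ≤ V.mult x)
    (hdens : ∀ x : Space n, x 0 = 0 → x ∈ ball 0 (1 / 2) → ∀ r ∈ Ioo (0 : ℝ) (1 / 2),
      V.densityRatio x r ≤ ENNReal.ofReal (1 - α))
    (hexc : V.tiltExcess 0 1 ≤ ENNReal.ofReal η)
    (hmax : max (eLpNorm H ⊤ (V.mass.restrict (ball 0 1))) g.c1DistEuclidean ≤ ENNReal.ofReal η) :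
    IsAlmostWall α V H η := by
  obtain ⟨hH, hg⟩ := max_le_iff.1 hmax
  have hball : ∀ p : Space n, p 0 = 0 → ‖p‖ < 1 / 2 → ∀ r ∈ Ioo (0 : ℝ) (1 / 2),
      V.mass (ball p r) ≤ ENNReal.ofReal ((1 - α) * unitBallVolume n * r ^ n) := by
    intro p hp hpn r hr
    have hr0 : 0 < r ^ n := pow_pos hr.1 n
    have hω : volume (ball (0 : EuclideanSpace ℝ (Fin n)) 1) =
        ENNReal.ofReal (unitBallVolume n) := by
      rw [unitBallVolume, measureReal_def, ENNReal.ofReal_toReal measure_ball_lt_top.ne]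
    have h1 := hdens p hp (by simpa using hpn) r hr
    rw [RectifiableVarifold.densityRatio, hω, ← ENNReal.ofReal_mul (unitBallVolume_pos n).le,
      ENNReal.div_le_iff (by
        rw [Ne, ENNReal.ofReal_eq_zero, not_le]
        exact mul_pos (unitBallVolume_pos n) hr0) ENNReal.ofReal_ne_top,
      ← ENNReal.ofReal_mul (by linarith)] at h1
    rwa [mul_assoc]
  have htop : V.mass (ball 0 (7 / 16)) ≠ ⊤ :=
    ne_top_of_le_ne_top ENNReal.ofReal_ne_top (hball 0 (by simp) (by simp) _ (by norm_num))
  have h0 : IsAlmostMinimal V H η :=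
    { nonneg := hη0
      le := hη4
      norm_sub_le := fun x hx => by
        have h1 : ‖g.toFun x - euclideanForm n‖ₑ ≤ ENNReal.ofReal η :=
          le_trans (le_trans (le_iSup₂ (f := fun x (_ : x ∈ unitBall n) =>
            ‖g.toFun x - euclideanForm n‖ₑ) x (halfBall_le n hx)) le_self_add) hg
        rwa [← ofReal_norm, ENNReal.ofReal_le_ofReal_iff hη0] at h1
      norm_fderiv_le := fun x hx => by
        have h1 : ‖fderiv ℝ g.toFun x‖ₑ ≤ ENNReal.ofReal η :=
          le_trans (le_trans (le_iSup₂ (f := fun x (_ : x ∈ unitBall n) =>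
            ‖fderiv ℝ g.toFun x‖ₑ) x (halfBall_le n hx)) le_add_self) hg
        rwa [← ofReal_norm, ENNReal.ofReal_le_ofReal_iff hη0] at h1
      norm_curvature_le := by
        rw [eLpNorm_exponent_top] at hH
        have h1 : ∀ᵐ x ∂V.mass.restrict (ball 0 1), ‖H x‖ₑ ≤ ENNReal.ofReal η :=
          (enorm_ae_le_eLpNormEssSup H _).mono fun x hx => hx.trans hH
        rw [ae_restrict_iff' measurableSet_ball] at h1
        filter_upwards [h1, V.ae_mem_domain] with x hx hxU
        have h2 := hx hxU.1
        rwa [← ofReal_norm, ENNReal.ofReal_le_ofReal_iff hη0] at h2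
      firstVariation_eq := fun X hX => by
        rw [hV.firstVariation_eq X hX, integral_zero_measure, add_zero]
      mass_ne_top := htop }
  refine
    { h0 with
      ball_ne_top := fun p hp hpn r hr =>
        ne_top_of_le_ne_top ENNReal.ofReal_ne_top (hball p hp hpn r hr)
      density_le := fun p hp hpn r hr => by
        have hr0 : 0 < r ^ n := pow_pos hr.1 n
        exact ENNReal.toReal_le_of_le_ofReal (mul_nonneg (mul_nonneg (by linarith)
          (unitBallVolume_pos n).le) hr0.le) (hball p hp hpn r hr)
      excess_le := ?_
      ae_hasBlowUp := ?_ }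
  · have hm : AEStronglyMeasurable (fun x => ‖(V.tangent x).proj - wallProj n‖ ^ 2) V.mass :=
      (V.aestronglyMeasurable_proj.sub aestronglyMeasurable_const).norm.pow 2
    rw [integral_eq_lintegral_of_nonneg_ae (Eventually.of_forall fun x => sq_nonneg _) hm.restrict]
    refine ENNReal.toReal_le_of_le_ofReal hη0 (le_trans ?_ hexc)
    rw [RectifiableVarifold.tiltExcess]
    refine (lintegral_mono_set (ball_subset_ball (by norm_num : (7 / 16 : ℝ) ≤
        1))).trans (le_of_eq ?_)
    refine lintegral_congr fun x => ?_
    rw [ENNReal.ofReal_pow (norm_nonneg _), ofReal_norm]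
  · exact V.ae_exists_hasBlowUp (by omega) (Real.sqrt_pos.2 (by linarith))
      (fun x hx v => h0.sq_le_apply hx v) hmult isOpen_ball htop

theorem RectifiableVarifold.toMeasure_restrict_eq_zero {U : Opens (Space n)} {g : C1Metric U}
    (V : RectifiableVarifold g) {s : Set (Space n)} (hs : MeasurableSet s) (h : V.mass s = 0) :
    V.toMeasure.restrict (s ×ˢ univ) = 0 := by
  have hmeas : AEMeasurable (fun x => (x, V.tangent x)) V.mass :=
    aemeasurable_id.prodMk V.aemeasurable_tangent
  rw [Measure.restrict_eq_zero, RectifiableVarifold.toMeasure,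
    Measure.map_apply_of_aemeasurable hmeas (hs.prod MeasurableSet.univ)]
  exact measure_mono_null (fun x hx => hx.1) h

end BoundaryRigidity

theorem mainTheorem9 (n : ℕ) (hn : 1 ≤ n) (α : ℝ) (hα₀ : 0 < α) (hα₁ : α < 1) :
    ∃ η γ : ℝ, 0 < η ∧ η < γ ∧ γ < 1 ∧
      ∀ (g : BoundaryRigidity.C1Metric (BoundaryRigidity.unitBall n))
        (V : BoundaryRigidity.RectifiableVarifold
          (g.restrict (BoundaryRigidity.halfBall_le n)))
        (H : BoundaryRigidity.Space n → BoundaryRigidity.Space n)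
        (σ : Measure (BoundaryRigidity.Space n))
        (ν : BoundaryRigidity.Space n → BoundaryRigidity.Space n),
        V.HasLocallyFiniteFirstVariation →
        V.IsFirstVariationDecomposition H σ ν →
        σ = 0 →
        (∀ᵐ x ∂V.mass, 1 ≤ V.mult x) →
        (∀ x : BoundaryRigidity.Space n, x 0 = 0 → x ∈ ball 0 (1 / 2) →
          ∀ r ∈ Ioo (0 : ℝ) (1 / 2), V.densityRatio x r ≤ ENNReal.ofReal (1 - α)) →
        V.tiltExcess 0 1 ≤ ENNReal.ofReal η →
        max (eLpNorm H ⊤ (V.mass.restrict (ball 0 1))) g.c1DistEuclidean ≤ ENNReal.ofReal η →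
        V.toMeasure.restrict (ball 0 γ ×ˢ univ) = 0
 := by
  obtain ⟨η₀, γ, hη₀, hγ, hγ1, hmain⟩ :=
    BoundaryRigidity.exists_forall_mass_ball_eq_zero (α := α) hn hα₀ hα₁.le
  refine ⟨min η₀ (min (γ / 2) (1 / 4)), γ, lt_min hη₀ (lt_min (by linarith) (by norm_num)),
    (min_le_right _ _).trans_lt ((min_le_left _ _).trans_lt (by linarith)), hγ1, ?_⟩
  intro g V H σ ν _ hV hσ hmult hdens hexc hmax
  subst hσ
  exact V.toMeasure_restrict_eq_zero measurableSet_ball (hmain _ V H _ (min_le_left _ _)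
    (BoundaryRigidity.isAlmostWall_of_bounds hn hα₁
      (le_min hη₀.le (le_min (by linarith) (by norm_num)))
      ((min_le_right _ _).trans (min_le_right _ _)) hV hmult hdens hexc hmax))
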